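/- All graphs are finite. For a simple graph $H$, $\omega(H)$ is the size of a largest complete subgraph ($\omega=0$ for the empty graph). **Galled-trees.** A galled-tree $N$ on $X$ is a finite DAG such that either $V(N)=X=\{x\}$, or: there is a unique root $\rho_N$, of indegree $0$ and with outdegree $\ge 2$; $X$ is the set of vertices (leaves) of outdegree $0$ and indegree $1$; every other vertex has indegree $1$ and outdegree $\ge2$, or indegree $2$ and outdegree $\ge 1$ (hybrid-vertex); and each biconnected component contains at most one hybrid-vertex both of whose parents lie in that component. A rooted cycle $C$ in a DAG consists of two distinct directed paths (its sides $P^1,P^2$) with common start $\rho_C$ and common end $\eta_C$ and no other common vertex. $N$ is elementary if it consists of a rooted cycle $C$ of length $|X|+1$ with $\rho_C=\rho_N$ and edges attaching one leaf of $X$ to each vertex of $C$ other than $\rho_C$. $N$ is strong if no rooted cycle has a side without internal vertices and none has exactly one internal vertex on both sides. A labeling is a map $t:V(N)\to\{0,1,\odot\}$ with $t(v)=\odot$ iff $v\in X$; it is quasi-discriminating if $t(u)\ne t(v)$ for every edge $(u,v)$ with $v$ not a hybrid-vertex. $(N,t)$ explains the graph on $X$ in which distinct $x,y$ are adjacent iff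 $t(\mathrm{lca}_N(x,y))=1$. A graph is GaTEx if it is isomorphic to a graph explained by a labeled galled-tree. **Modular decomposition and pvr-networks.** Let $G=(V,E)$ be a graph with $V\neq\emptyset$. Its modular decomposition tree $\mathscr T_G$ has the non-empty strong modules of $G$ as vertices, the children of $M$ being the maximal strong modules properly contained in $M$. Its labels are $t_G(M)=\odot$ if $|M|=1$; otherwise $0$ if $G[M]$ is disconnected, $1$ if $G[M]$ is connected but $\overline G[M]$ is not, and *prime* if both are connected. A pvr-network $(N,t)$ of $G$ arises by choosing, for each prime $M$, a strong quasi-discriminating elementary labeled galled-tree $(N_M,t_M)$ that explains the quotient of $G[M]$ by its maximal strong modules $\neq M$, and replacing the edges from $M$ to its children in $\mathscr T_G$ by $N_M$, where the root of $N_M$ is identified with $M$ and each leaf with the corresponding child of $M$. Labels are $t_M$ on the non-leaf vertices of $N_M$ and $t_G$ on the non-prime vertices of $\mathscr T_G$. Leaves $\{x\}$ are identified with $x\in V$. $L(N(v))\subseteq V$ denotes the set of leaves reachable from $v$ in $N$. **Algorithm 2** on $G$ with pvr-network $(N,t)$. Initially $\omega(x):=1$ for all leaves $x$ and no vertex is active.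 Process the non-leaf vertices $v$ of $\mathscr T_G$ in postorder (arg max ties are broken arbitrarily): * $t_G(v)=0$: put $\omega(v):=\max\omega(w)$ over the children $w$ of $v$ in $\mathscr T_G$; activate exactly one child attaining the maximum. * $t_G(v)=1$: put $\omega(v):=\sum\omega(w)$ over the children of $v$ in $\mathscr T_G$; activate all of them. * $t_G(v)=$ prime: let $C$ be the cycle of $N$ with $\rho_C=v$, $\eta=\eta_C$. Put $\omega(\eta):=\omega(u)$ for the child $u$ of $\eta$, and $\omega_{\neg\eta}(\eta):=0$. For the internal vertices $w$ of the sides, bottom-up, let $u'$ be the child of $w$ in $C$ and $u''$ the one not in $C$; put $\omega(w):=\max\{\omega(u'),\omega(u'')\}$, $\omega_{\neg\eta}(w):=\max\{\omega_{\neg\eta}(u'),\omega(u'')\}$ if $t(w)=0$, and the same with sums in place of maxima if $t(w)=1$. Let $x,y$ be the two children of $\rho_C$. * If $t(\rho_C)=0$: put $\omega(v):=\max\{\omega(x),\omega(y)\}$, activate one $w\in\{x,y\}$ attaining it, and for each $w'\neq\rho_C$ on the side containing $w$ (including $\eta$) activate one child of $w'$ with maximum $\omega$ if $t(w')=0$,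 and all children of $w'$ if $t(w')=1$. * If $t(\rho_C)=1$: let $\alpha:=\omega(x)+\omega(y)-\omega(\eta)$, $\beta:=\omega_{\neg\eta}(x)+\omega_{\neg\eta}(y)$, $\omega(v):=\max\{\alpha,\beta\}$, and activate $x,y$. If $\alpha\le\beta$: activate the child other than $\eta$ of each of the two parents of $\eta$; for every other internal vertex $w'$ of the sides activate one of $u',u''$ attaining $\max\{\omega_{\neg\eta}(u'),\omega(u'')\}$ if $t(w')=0$, and both if $t(w')=1$. If $\alpha>\beta$: activate $\eta$, its child, all internal vertices $w$ of the sides, and, if $t(w)=1$, also the child of $w$ not in $C$. Finally $\Omega$ is the set of leaves $x$ for which there is a directed path from $\rho_N$ to $x$ all of whose vertices other than $\rho_N$ are active. The output is $G[\Omega]$ and $\omega(\rho_N)$. **Proposition.** Let $G$ be a GaTEx graph and $(N,t)$ a pvr-network of $G$. Algorithm 2 can be executed on $G$ with $(N,t)$, and after every such execution (whatever choices were made): 1. $\omega(\rho_N)=\omega(G)$; 2. $\omega(v)=\omega(G[L(N(v))])$ for all $v\in V(N)$; 3. $\omega_{\neg\eta}(v)=\omega(G[L(N(v))\setminus L(N(\eta_C))])$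 for every cycle $C$ of $N$ and every vertex $v\ne\rho_C$ of $C$; 4. $\Omega$ induces a maximum clique of $G$. -/

import Mathlib

universe u v

/-! ### Directed acyclic graphs, galled-trees -/

/-- Vertex labels `0`, `1`, `⊙` of a labeled galled-tree. -/
inductive NLabel
  | zero
  | one
  | leaf

namespace Gatex

section Networks

variable {W : Type v}

/-- The children of a vertex. -/
def children (N : Digraph W) (w : W) : Set W := {u | N.Adj w u}

/-- The parents of a vertex. -/
def parents (N : Digraph W) (w : W) : Set W := {u | N.Adj u w}

/-- `Anc N u w`: there is a directed path, possibly a single vertex, from `u` to `w`. -/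
def Anc (N : Digraph W) (u w : W) : Prop := Relation.ReflTransGen N.Adj u w

def IsAcyclic (N : Digraph W) : Prop := ∀ w, ¬ Relation.TransGen N.Adj w w

/-- The subgraph induced by `B` is biconnected: it is connected and no removal of a vertex
disconnects it. -/
def IsBiconnected (N : Digraph W) (B : Set W) : Prop :=
  (N.toSimpleGraphInclusive.induce B).Connected ∧
    ∀ w ∈ B, (N.toSimpleGraphInclusive.induce (B \ {w})).Preconnected

/-- The (vertex set of a) biconnected component; an inclusion-maximal biconnected subgraph is
always an induced subgraph. -/
def IsBiconnectedComponent (N : Digraph W) (B : Set W) : Prop :=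
  Maximal (IsBiconnected N) B

/-- In a galled-tree, the hybrid-vertices are the vertices of indegree 2. -/
def IsHybrid (N : Digraph W) (w : W) : Prop := (parents N w).ncard = 2

/-- `N` is a galled-tree on `X`. -/
structure IsGalledTree (N : Digraph W) (X : Set W) : Prop where
  finite : Finite W
  acyclic : IsAcyclic N
  shape :
    (∃ x, X = {x} ∧ (Set.univ : Set W) = {x}) ∨
    (∃ ρ : W,
      ((parents N ρ).ncard = 0 ∧ 2 ≤ (children N ρ).ncard ∧
        ∀ w, (parents N w).ncard = 0 → w = ρ) ∧
      (∀ x, x ∈ X ↔ (children N x).ncard = 0 ∧ (parents N x).ncard = 1) ∧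
      (∀ w, w ∉ X → w ≠ ρ →
        ((parents N w).ncard = 1 ∧ 2 ≤ (children N w).ncard) ∨
        ((parents N w).ncard = 2 ∧ 1 ≤ (children N w).ncard)) ∧
      (∀ B, IsBiconnectedComponent N B → ∀ h h' : W,
        h ∈ B → IsHybrid N h → parents N h ⊆ B →
        h' ∈ B → IsHybrid N h' → parents N h' ⊆ B → h = h'))

/-- A vertex labeling takes the value `⊙` precisely on the leaves. -/
def IsLabeling (X : Set W) (t : W → NLabel) : Prop := ∀ w, t w = NLabel.leaf ↔ w ∈ X

/-- `w` is a lowest common ancestor of `x` and `y`. -/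
def IsLCA (N : Digraph W) (x y w : W) : Prop :=
  (Anc N w x ∧ Anc N w y) ∧ ∀ z, Anc N z x → Anc N z y → Anc N w z → z = w

/-- The graph explained by `(N,t)`: its vertices are the leaves, and distinct leaves `x`, `y` are
adjacent iff `t(lca(x,y)) = 1`. (In a galled-tree, lowest common ancestors are unique.) -/
def explained (N : Digraph W) (X : Set W) (t : W → NLabel) : SimpleGraph X where
  Adj x y := x ≠ y ∧ ∃ w, IsLCA N x y w ∧ t w = NLabel.one
  symm := ⟨fun _ _ h => ⟨h.1.symm, h.2.imp fun _ hw =>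
    ⟨⟨⟨hw.1.1.2, hw.1.1.1⟩, fun z hx hy => hw.1.2 z hy hx⟩, hw.2⟩⟩⟩
  loopless := ⟨fun _ h => h.1 rfl⟩

/-- A rooted cycle: two directed paths with the same start-vertex `root` and the same end-vertex
`hybrid` that have no other vertex in common. `inner₁` and `inner₂` list the internal vertices of
the two sides from top to bottom. -/
structure RootedCycle (N : Digraph W) where
  root : W
  hybrid : W
  inner₁ : List W
  inner₂ : List W
  path₁ : List.IsChain N.Adj (root :: (inner₁ ++ [hybrid]))
  path₂ : List.IsChain N.Adj (root :: (inner₂ ++ [hybrid]))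
  nodup : (root :: hybrid :: (inner₁ ++ inner₂)).Nodup
  nontrivial : inner₁ ≠ [] ∨ inner₂ ≠ []

namespace RootedCycle

variable {N : Digraph W} (C : RootedCycle N)

/-- The vertices of the cycle, without repetition. -/
def vertexList : List W := C.root :: C.hybrid :: (C.inner₁ ++ C.inner₂)

def verts : Set W := {w | w ∈ C.vertexList}

def length : ℕ := C.vertexList.length

/-- `(a,b)` is an edge of one of the two sides. -/
def IsEdge (a b : W) : Prop :=
  [a, b] <:+: (C.root :: (C.inner₁ ++ [C.hybrid])) ∨
    [a, b] <:+: (C.root :: (C.inner₂ ++ [C.hybrid]))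

end RootedCycle

/-- A galled-tree on `X` is elementary if it consists of a rooted cycle of length `|X|+1` whose root
is the root of `N` and of edges that attach to each cycle vertex other than the root its own
leaf. -/
def IsElementary (N : Digraph W) (X : Set W) : Prop :=
  IsGalledTree N X ∧ ∃ C : RootedCycle N,
    C.length = X.ncard + 1 ∧
    parents N C.root = ∅ ∧
    (∀ w, w ∈ C.verts ∨ w ∈ X) ∧
    (∀ w ∈ C.verts, w ≠ C.root → ∃! x, x ∈ X ∧ N.Adj w x) ∧
    (∀ a b, N.Adj a b → C.IsEdge a b ∨ (a ∈ C.verts ∧ a ≠ C.root ∧ b ∈ X))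

/-- No cycle has a side without internal vertices, and no cycle has precisely one internal vertex
on both sides. -/
def IsStrongTree (N : Digraph W) : Prop :=
  ∀ C : RootedCycle N, ¬ (C.inner₁ = [] ∨ C.inner₂ = []) ∧
    ¬ (C.inner₁.length = 1 ∧ C.inner₂.length = 1)

def IsQuasiDiscriminating (N : Digraph W) (t : W → NLabel) : Prop :=
  ∀ a b, N.Adj a b → ¬ IsHybrid N b → t a ≠ t b

end Networks

/-- `G` is galled-tree explainable. -/
def IsGaTEx {V : Type u} (G : SimpleGraph V) : Prop :=
  ∃ (W : Type) (N : Digraph W) (X : Set W) (t : W → NLabel),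
    IsGalledTree N X ∧ IsLabeling X t ∧ Nonempty (G ≃g explained N X t)

/-! ### Modular decomposition -/

section Modules

variable {V : Type u}

/-- `M` is a non-empty module of the induced subgraph `G[S]`. -/
def IsModule (G : SimpleGraph V) (S M : Finset V) : Prop :=
  M.Nonempty ∧ M ⊆ S ∧ ∀ x ∈ M, ∀ y ∈ M, ∀ z ∈ S, z ∉ M → (G.Adj x z ↔ G.Adj y z)

/-- `M` is a strong module of `G[S]`: it overlaps with no module of `G[S]`. -/
def IsStrongModule (G : SimpleGraph V) (S M : Finset V) : Prop :=
  IsModule G S M ∧ ∀ M', IsModule G S M' → M ⊆ M' ∨ M' ⊆ M ∨ Disjoint M M'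

/-- `A` belongs to the partition of `S` into the inclusion-maximal strong modules of `G[S]` that are
different from `S`. -/
def IsMaxStrong (G : SimpleGraph V) (S A : Finset V) : Prop :=
  Maximal (fun B => IsStrongModule G S B ∧ B ≠ S) A

/-- The quotient of `G[S]` by its maximal strong modules. -/
def quotientGraph (G : SimpleGraph V) (S : Finset V) : SimpleGraph {A // IsMaxStrong G S A} where
  Adj A B := A ≠ B ∧ ∃ x ∈ A.1, ∃ y ∈ B.1, G.Adj x y
  symm := ⟨fun _ _ ⟨h, x, hx, y, hy, hxy⟩ => ⟨h.symm, y, hy, x, hx, hxy.symm⟩⟩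
  loopless := ⟨fun _ h => h.1 rfl⟩

variable [Fintype V]

/-- The vertices of the modular decomposition tree of `G`: the strong modules of `G`, ordered by
inclusion. The children of a vertex are the strong modules that it covers. -/
abbrev StrongMod (G : SimpleGraph V) : Type u := {M : Finset V // IsStrongModule G Finset.univ M}

theorem isStrongModule_singleton (G : SimpleGraph V) (x : V) :
    IsStrongModule G Finset.univ {x} := by
  refine ⟨⟨Finset.singleton_nonempty x, Finset.subset_univ _, ?_⟩, fun M' _ => ?_⟩
  · intro a ha b hb z _ _
    rw [Finset.mem_singleton.1 ha, Finset.mem_singleton.1 hb]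
  · by_cases h : x ∈ M'
    · exact Or.inl (Finset.singleton_subset_iff.2 h)
    · exact Or.inr (Or.inr (Finset.disjoint_singleton_left.2 h))

theorem isStrongModule_univ [Nonempty V] (G : SimpleGraph V) :
    IsStrongModule G Finset.univ (Finset.univ : Finset V) :=
  ⟨⟨Finset.univ_nonempty, Finset.Subset.refl _, fun _ _ _ _ z _ hz => absurd (Finset.mem_univ z) hz⟩,
    fun M' _ => Or.inr (Or.inl (Finset.subset_univ M'))⟩

/-- Strong modules of `G[S]` are strong modules of `G` if `S` is one. -/
theorem IsStrongModule.trans {G : SimpleGraph V} {S A : Finset V}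
    (hS : IsStrongModule G Finset.univ S) (hA : IsStrongModule G S A) :
    IsStrongModule G Finset.univ A := by
  obtain ⟨⟨hne, hAS, hmod⟩, hstr⟩ := hA
  refine ⟨⟨hne, Finset.subset_univ _, ?_⟩, ?_⟩
  · intro x hx y hy z _ hz
    by_cases hzS : z ∈ S
    · exact hmod x hx y hy z hzS hz
    · exact hS.1.2.2 x (hAS hx) y (hAS hy) z (Finset.mem_univ _) hzS
  · intro K hK
    rcases hS.2 K hK with h | h | h
    · exact Or.inl (hAS.trans h)
    · exact hstr K ⟨hK.1, h, fun x hx y hy z _ hz => hK.2.2 x hx y hy z (Finset.mem_univ _) hz⟩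
    · exact Or.inr (Or.inr (Finset.disjoint_of_subset_left hAS h))

/-- Vertex labels of the modular decomposition tree. -/
inductive MDLabel
  | zero
  | one
  | leaf
  | prime

open Classical in
/-- The label `t_G(M)`. -/
noncomputable def mdLabel (G : SimpleGraph V) (M : StrongMod G) : MDLabel :=
  if M.1.card = 1 then MDLabel.leaf
  else if ¬ (G.induce (M.1 : Set V)).Connected then MDLabel.zero
  else if ¬ (Gᶜ.induce (M.1 : Set V)).Connected then MDLabel.one
  else MDLabel.prime

/-- The prime vertices of the modular decomposition tree. -/
abbrev PrimeMod (G : SimpleGraph V) : Type u := {M : StrongMod G // mdLabel G M = MDLabel.prime}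

/-! ### Prime-vertex replacement networks -/

/-- The choices that determine a pvr-network of `G`: for each prime vertex `M` of the modular
decomposition tree a strong quasi-discriminating elementary galled-tree that explains the quotient
of `G[M]` by its maximal strong modules. -/
structure PvrNetwork (G : SimpleGraph V) where
  /-- vertices of the galled-tree for `M` -/
  W : PrimeMod G → Type v
  tree : ∀ M, Digraph (W M)
  leaves : ∀ M, Set (W M)
  treeLabel : ∀ M, W M → NLabel
  elementary : ∀ M, IsElementary (tree M) (leaves M)
  strong : ∀ M, IsStrongTree (tree M)
  labeling : ∀ M, IsLabeling (leaves M) (treeLabel M)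
  quasiDiscriminating : ∀ M, IsQuasiDiscriminating (tree M) (treeLabel M)
  /-- the root of the galled-tree for `M` -/
  treeRoot : ∀ M, W M
  treeRoot_spec : ∀ M, parents (tree M) (treeRoot M) = ∅
  explains : ∀ M, quotientGraph G M.1.1 ≃g explained (tree M) (leaves M) (treeLabel M)

namespace PvrNetwork

variable {G : SimpleGraph V} (D : PvrNetwork.{u, v} G)

/-- The vertices of the pvr-network: the vertices of the modular decomposition tree and, for each
prime vertex `M`, the vertices of its galled-tree that are neither leaves (these are identified with
the maximal strong modules of `G[M]`) nor the root (which is identified with `M`). -/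
abbrev Vert : Type (max u v) :=
  StrongMod G ⊕ (Σ M : PrimeMod G, {w : D.W M // w ∉ D.leaves M ∧ w ≠ D.treeRoot M})

open Classical in
/-- The identification of the vertices of the galled-tree for `M` with vertices of the network. -/
noncomputable def glue (M : PrimeMod G) (w : D.W M) : D.Vert :=
  if hl : w ∈ D.leaves M then
    Sum.inl ⟨((D.explains M).symm ⟨w, hl⟩).1,
      IsStrongModule.trans M.1.2 ((D.explains M).symm ⟨w, hl⟩).2.prop.1⟩
  else if hr : w = D.treeRoot M then Sum.inl M.1
  else Sum.inr ⟨M, w, hl, hr⟩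

/-- The pvr-network as a directed graph: edges below non-prime vertices come from the modular
decomposition tree, all other edges from the galled-trees. -/
def network : Digraph D.Vert where
  Adj a b :=
    (∃ A B : StrongMod G, mdLabel G A ≠ MDLabel.prime ∧ B ⋖ A ∧ a = Sum.inl A ∧ b = Sum.inl B) ∨
    (∃ (M : PrimeMod G) (w z : D.W M), (D.tree M).Adj w z ∧ a = D.glue M w ∧ b = D.glue M z)

open Classical in
/-- The labeling `t` of the pvr-network. -/
noncomputable def label : D.Vert → NLabel
  | Sum.inl A =>
    if h : mdLabel G A = MDLabel.prime then D.treeLabel ⟨A, h⟩ (D.treeRoot ⟨A, h⟩)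
    else if mdLabel G A = MDLabel.zero then NLabel.zero
    else if mdLabel G A = MDLabel.one then NLabel.one
    else NLabel.leaf
  | Sum.inr p => D.treeLabel p.1 p.2.1

/-- The leaf of the network that is identified with the vertex `x` of `G`. -/
def leafVert (x : V) : D.Vert := Sum.inl ⟨{x}, isStrongModule_singleton G x⟩

/-- The root of the network. -/
def root [Nonempty V] : D.Vert := Sum.inl ⟨Finset.univ, isStrongModule_univ G⟩

/-- The leaves `L(N(w))` below `w`, as vertices of `G`. -/
def leavesBelow (w : D.Vert) : Set V := {x | Anc D.network w (D.leafVert x)}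

/-- The children of a vertex of the network. -/
abbrev ch (w : D.Vert) : Set D.Vert := children D.network w

end PvrNetwork

end Modules

/-! ### The algorithm -/

/-- A for-loop that executes the (non-deterministic) body for the entries of a list in order. -/
inductive Loop {α : Type*} {S : Type*} (body : α → S → S → Prop) : List α → S → S → Prop
  | nil (s : S) : Loop body [] s s
  | cons {a : α} {l : List α} {s s' s'' : S} :
      body a s s' → Loop body l s' s'' → Loop body (a :: l) s s''

namespace PvrNetwork

variable {V : Type u} [Fintype V] {G : SimpleGraph V} (D : PvrNetwork.{u, v} G)

/-- The variables of the algorithm: `ω`, `ω_¬η` and the set of active vertices. -/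
structure State where
  omega : D.Vert → ℤ
  omegaNot : D.Vert → ℤ
  active : Set D.Vert

open Classical in
/-- The procedure `Activate`, which turns the set `a` of active vertices into `a'`. The sides in `Ps`
are given by their internal vertices from top to bottom. -/
def Activate (C : RootedCycle D.network) (Ps : List (List D.Vert)) (ω ωNot : D.Vert → ℤ)
    (α β : ℤ) (labelρ : NLabel) (a a' : Set D.Vert) : Prop :=
  if labelρ = NLabel.zero then
    Loop (fun w b b' =>
        if D.label w = NLabel.zero then
          ∃ x ∈ D.ch w, (∀ z ∈ D.ch w, ω z ≤ ω x) ∧ b' = b ∪ {x}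
        else b' = b ∪ D.ch w)
      (Ps.flatMap fun P => (P ++ [C.hybrid]).reverse) a a'
  else if α ≤ β then
    ∃ w₁ w₂, w₁ ≠ w₂ ∧ parents D.network C.hybrid = {w₁, w₂} ∧
      Loop (fun w b b' =>
          ∃ x y, D.ch w ∩ C.verts = {x} ∧ D.ch w \ C.verts = {y} ∧
            if D.label w = NLabel.zero then
              (ω y ≤ ωNot x ∧ b' = b ∪ {x}) ∨ (ωNot x ≤ ω y ∧ b' = b ∪ {y})
            else b' = b ∪ {x, y})
        ((Ps.flatMap List.reverse).filter fun w => w ≠ w₁ ∧ w ≠ w₂)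
        (a ∪ D.ch C.root ∪ (D.ch w₁ \ {C.hybrid}) ∪ (D.ch w₂ \ {C.hybrid})) a'
  else
    Loop (fun w b b' =>
        b' = b ∪ {w} ∪ (if D.label w = NLabel.one then D.ch w \ C.verts else ∅))
      (Ps.flatMap List.reverse) (a ∪ D.ch C.root ∪ {C.hybrid} ∪ D.ch C.hybrid) a'

open Classical in
/-- The computation of `ω(w)` and `ω_¬η(w)` for an internal vertex `w` of a side of `C`. -/
def InitInner (C : RootedCycle D.network) (w : D.Vert) (s s' : D.State) : Prop :=
  ∃ x y, D.ch w ∩ C.verts = {x} ∧ D.ch w \ C.verts = {y} ∧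
    if D.label w = NLabel.zero then
      s' = { s with
        omega := Function.update s.omega w (max (s.omega x) (s.omega y))
        omegaNot := Function.update s.omegaNot w (max (s.omegaNot x) (s.omega y)) }
    else
      s' = { s with
        omega := Function.update s.omega w (s.omega x + s.omega y)
        omegaNot := Function.update s.omegaNot w (s.omegaNot x + s.omega y) }

open Classical in
/-- The processing of a prime vertex `M`. -/
def VisitPrime (M : StrongMod G) (s s' : D.State) : Prop :=
  ∃ C : RootedCycle D.network, C.root = Sum.inl M ∧
  ∃ (c : D.Vert) (s₁ s₂ : D.State),
    D.ch C.hybrid = {c} ∧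
    s₁ = { s with
      omega := Function.update s.omega C.hybrid (s.omega c)
      omegaNot := Function.update s.omegaNot C.hybrid 0 } ∧
    Loop (D.InitInner C) (C.inner₁.reverse ++ C.inner₂.reverse) s₁ s₂ ∧
    ∃ x y, x ≠ y ∧ D.ch C.root = {x, y} ∧
      if D.label C.root = NLabel.zero then
        ∃ w P a, (w = x ∨ w = y) ∧ s₂.omega w = max (s₂.omega x) (s₂.omega y) ∧
          (P = C.inner₁ ∨ P = C.inner₂) ∧ w ∈ P ++ [C.hybrid] ∧
          D.Activate C [P] s₂.omega s₂.omegaNot 0 0 NLabel.zero (s₂.active ∪ {w}) a ∧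
          s' = { s₂ with
            omega := Function.update s₂.omega C.root (max (s₂.omega x) (s₂.omega y))
            active := a }
      else
        ∃ α β a, α = s₂.omega x + s₂.omega y - s₂.omega C.hybrid ∧
          β = s₂.omegaNot x + s₂.omegaNot y ∧
          D.Activate C [C.inner₁, C.inner₂] s₂.omega s₂.omegaNot α β NLabel.one s₂.active a ∧
          s' = { s₂ with
            omega := Function.update s₂.omega C.root (max α β)
            active := a }

open Classical in
/-- The body of the main loop, executed for an inner vertex `M` of the modular decomposition
tree. -/
def VisitVertex (M : StrongMod G) (s s' : D.State) : Prop :=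
  match mdLabel G M with
  | MDLabel.leaf => False
  | MDLabel.zero =>
    ∃ B : StrongMod G, B ⋖ M ∧ (∀ B' : StrongMod G, B' ⋖ M →
        s.omega (Sum.inl B') ≤ s.omega (Sum.inl B)) ∧
      s' = { s with
        omega := Function.update s.omega (Sum.inl M) (s.omega (Sum.inl B))
        active := s.active ∪ {Sum.inl B} }
  | MDLabel.one =>
      s' = { s with
        omega := Function.update s.omega (Sum.inl M)
          (∑ B : StrongMod G with B ⋖ M, s.omega (Sum.inl B))
        active := s.active ∪ {b | ∃ B : StrongMod G, B ⋖ M ∧ b = Sum.inl B} }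
  | MDLabel.prime => D.VisitPrime M s s'

/-- `s` is the final state of an execution of the algorithm with the pvr-network `D`. The inner
vertices of the modular decomposition tree are visited in an arbitrary order in which every vertex
comes after all its descendants, as it does in every postorder. The values of `ω` and `ω_¬η` that
the algorithm does not initialize are arbitrary at the start. -/
def IsResult (s : D.State) : Prop :=
  ∃ (l : List (StrongMod G)) (s₀ : D.State),
    l.Nodup ∧ (∀ M, M ∈ l ↔ mdLabel G M ≠ MDLabel.leaf) ∧ l.Pairwise (fun A B => ¬ B < A) ∧
    (∀ x, s₀.omega (D.leafVert x) = 1) ∧ s₀.active = ∅ ∧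
    Loop D.VisitVertex l s₀ s

open Classical in
/-- The set `Ω` of all leaves that are reached from the root by a directed path on which all vertices
other than the root are active. -/
noncomputable def Omega [Nonempty V] (s : D.State) : Finset V :=
  Finset.univ.filter fun x =>
    Relation.ReflTransGen (fun a b => D.network.Adj a b ∧ b ∈ s.active) D.root (D.leafVert x)

end PvrNetwork

end Gatex

/-!
The maximal strong modules of a module `M` are pairwise fully adjacent if `M` is labeled `1`, and
pairwise non-adjacent if it is labeled `0`, so clique numbers add up or are maximized over them. If
`M` is prime, let `C` be the cycle of its galled-tree. Two vertices of `C` on the same side, one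
above the other, have the upper one as the lowest common ancestor of the leaves attached to them,
and two vertices on different sides have the root of `C`. Hence along a side the clique number is
again a sum or a maximum, depending on the label of each vertex, and `ω` and `ω_¬η` compute it with
and without the module `B η` attached to the hybrid vertex `η`, which lies below both sides.

If the root of `C` is labeled `0`, a clique cannot mix leaves attached to different sides, so the
better side wins. If it is labeled `1`, a maximum clique avoids `B η` and has size at most
`β = ω_¬η(x) + ω_¬η(y)`, or it contains a vertex of `B η`. In the latter case it uses the modules
attached to vertices labeled `1` only, and `α = ω(x) + ω(y) - ω(η)` is at least its size.

The activated vertices split into disjoint zones, one for each inner module, and the vertices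
activated in the zone of `M` join maximum cliques of the children of `M` to a maximum clique of `M`.
By induction on the modular decomposition tree `Ω` is a maximum clique.
-/

namespace Gatex

section Cliques

variable {V : Type u} {G : SimpleGraph V} {S T R Q K : Set V}

/-- `R` is a maximum clique of `G[S]`. Both are subsets of `V` rather than finsets or subsets of a
subtype, since `S` will be some `L(N(v))` and `R` the leaves reached along active vertices. -/
structure IsMaxCliqueIn (G : SimpleGraph V) (S R : Set V) : Prop where
  subset : R ⊆ S
  isClique : G.IsClique R
  ncard_eq : R.ncard = (G.induce S).cliqueNum

theorem exists_isMaxCliqueIn (G : SimpleGraph V) (S : Set V) : ∃ R, IsMaxCliqueIn G S R := by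
  obtain ⟨s, hs⟩ := (G.induce S).exists_isNClique_cliqueNum
  refine ⟨Subtype.val '' (s : Set S), by simp, ?_, ?_⟩
  · rintro _ ⟨a, ha, rfl⟩ _ ⟨b, hb, rfl⟩ hab
    exact hs.isClique ha hb fun h => hab (congrArg _ h)
  · rw [Set.ncard_image_of_injective _ Subtype.val_injective, Set.ncard_coe_finset, hs.card_eq]

theorem cliqueNum_induce_le_of_forall {n : ℕ}
    (h : ∀ K ⊆ S, G.IsClique K → K.ncard ≤ n) : (G.induce S).cliqueNum ≤ n := by
  obtain ⟨R, hR⟩ := exists_isMaxCliqueIn G S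
  exact hR.ncard_eq ▸ h R hR.subset hR.isClique

theorem isMaxCliqueIn_empty : IsMaxCliqueIn G ∅ ∅ := by
  refine ⟨subset_rfl, by simp, le_antisymm (by simp) (cliqueNum_induce_le_of_forall ?_)⟩
  exact fun K hK _ => (congrArg Set.ncard (Set.subset_empty_iff.1 hK)).le

theorem cliqueNum_induce_empty : (G.induce (∅ : Set V)).cliqueNum = 0 := by
  rw [← isMaxCliqueIn_empty.ncard_eq, Set.ncard_empty]

theorem isClique_union_of_isCompleteBetween (hR : G.IsClique R) (hQ : G.IsClique Q)
    (h : G.IsCompleteBetween R Q) : G.IsClique (R ∪ Q) := by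
  rintro a (ha | ha) b (hb | hb) hab
  · exact hR ha hb hab
  · exact h ha hb
  · exact (h hb ha).symm
  · exact hQ ha hb hab

theorem isCompleteBetween_biUnion_of_insert {ι : Type*} {F : Finset ι} {A : ι → Set V} {i : ι}
    (hi : i ∉ F)
    (h : (insert i F : Set ι).Pairwise fun i j => G.IsCompleteBetween (A i) (A j)) :
    G.IsCompleteBetween (A i) (⋃ j ∈ F, A j) := by
  intro a ha b hb
  obtain ⟨j, hj, hbj⟩ := Set.mem_iUnion₂.1 hb
  exact h (Set.mem_insert _ _) (Set.mem_insert_of_mem _ hj) (ne_of_mem_of_not_mem hj hi).symm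
    ha hbj

variable [Finite V]

theorem ncard_le_cliqueNum_induce (hKS : K ⊆ S) (hK : G.IsClique K) :
    K.ncard ≤ (G.induce S).cliqueNum := by
  have hclique : (G.induce S).IsClique (Subtype.val ⁻¹' K) :=
    fun a ha b hb hab => hK ha hb fun h => hab (Subtype.ext h)
  have hfin : (Subtype.val ⁻¹' K : Set S).Finite := Set.toFinite _
  have hle := SimpleGraph.IsClique.card_le_cliqueNum (G := G.induce S) (t := hfin.toFinset)
    (tc := by simpa only [Set.Finite.coe_toFinset] using hclique)
  rwa [← Set.ncard_eq_toFinset_card _ hfin,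
    Set.ncard_preimage_of_injective_subset_range Subtype.val_injective
      (by simpa only [Subtype.range_coe] using hKS)] at hle

theorem isMaxCliqueIn_of_forall_ncard_le (hRS : R ⊆ S) (hR : G.IsClique R)
    (h : ∀ K ⊆ S, G.IsClique K → K.ncard ≤ R.ncard) : IsMaxCliqueIn G S R :=
  ⟨hRS, hR, le_antisymm (ncard_le_cliqueNum_induce hRS hR) (cliqueNum_induce_le_of_forall h)⟩

theorem isMaxCliqueIn_singleton (x : V) : IsMaxCliqueIn G {x} {x} :=
  isMaxCliqueIn_of_forall_ncard_le subset_rfl (by simp) fun _ hK _ => Set.ncard_le_ncard hK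

theorem cliqueNum_induce_singleton (x : V) : (G.induce ({x} : Set V)).cliqueNum = 1 := by
  rw [← (isMaxCliqueIn_singleton x).ncard_eq, Set.ncard_singleton]

theorem cliqueNum_induce_univ : (G.induce Set.univ).cliqueNum = G.cliqueNum := by
  have := Fintype.ofFinite V
  refine le_antisymm (G.cliqueNum_induce_le _) ?_
  obtain ⟨s, hs⟩ := G.exists_isNClique_cliqueNum
  rw [← hs.card_eq, ← Set.ncard_coe_finset]
  exact ncard_le_cliqueNum_induce (Set.subset_univ _) hs.isClique

theorem cliqueNum_induce_mono (h : S ⊆ T) :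
    (G.induce S).cliqueNum ≤ (G.induce T).cliqueNum :=
  cliqueNum_induce_le_of_forall fun _ hK hc => ncard_le_cliqueNum_induce (hK.trans h) hc

theorem IsMaxCliqueIn.superset (hR : IsMaxCliqueIn G S R) (hST : S ⊆ T)
    (hle : (G.induce T).cliqueNum ≤ (G.induce S).cliqueNum) : IsMaxCliqueIn G T R :=
  ⟨hR.subset.trans hST, hR.isClique, hR.ncard_eq.trans ((cliqueNum_induce_mono hST).antisymm hle)⟩

theorem cliqueNum_induce_union_of_not_adj (h : ∀ a ∈ S \ T, ∀ b ∈ T \ S, ¬ G.Adj a b) :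
    (G.induce (S ∪ T)).cliqueNum = max (G.induce S).cliqueNum (G.induce T).cliqueNum := by
  refine le_antisymm (cliqueNum_induce_le_of_forall fun K hK hc => ?_)
    (max_le (cliqueNum_induce_mono Set.subset_union_left)
      (cliqueNum_induce_mono Set.subset_union_right))
  by_cases hKT : K ⊆ T
  · exact (ncard_le_cliqueNum_induce hKT hc).trans (le_max_right _ _)
  · obtain ⟨a, haK, haT⟩ := Set.not_subset.1 hKT
    have haS : a ∈ S := (hK haK).resolve_right haT
    have hKS : K ⊆ S := fun b hb => by_contra fun hbS =>
      h a ⟨haS, haT⟩ b ⟨(hK hb).resolve_left hbS, hbS⟩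
        (hc haK hb (ne_of_mem_of_not_mem haS hbS))
    exact (ncard_le_cliqueNum_induce hKS hc).trans (le_max_left _ _)

theorem IsMaxCliqueIn.union (hR : IsMaxCliqueIn G S R) (hQ : IsMaxCliqueIn G T Q)
    (h : G.IsCompleteBetween S T) : IsMaxCliqueIn G (S ∪ T) (R ∪ Q) := by
  refine isMaxCliqueIn_of_forall_ncard_le (Set.union_subset_union hR.subset hQ.subset)
    (isClique_union_of_isCompleteBetween hR.isClique hQ.isClique
      fun a ha b hb => h (hR.subset ha) (hQ.subset hb)) fun K hK hc => ?_
  calc K.ncard = ((K ∩ S) ∪ (K ∩ T)).ncard := by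
        rw [← Set.inter_union_distrib_left, Set.inter_eq_left.2 hK]
    _ ≤ (K ∩ S).ncard + (K ∩ T).ncard := Set.ncard_union_le _ _
    _ ≤ R.ncard + Q.ncard := by
        rw [hR.ncard_eq, hQ.ncard_eq]
        exact Nat.add_le_add
          (ncard_le_cliqueNum_induce Set.inter_subset_right (hc.subset Set.inter_subset_left))
          (ncard_le_cliqueNum_induce Set.inter_subset_right (hc.subset Set.inter_subset_left))
    _ = (R ∪ Q).ncard :=
        (Set.ncard_union_eq (h.disjoint.mono hR.subset hQ.subset)).symm

theorem cliqueNum_induce_union_of_isCompleteBetween (h : G.IsCompleteBetween S T) :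
    (G.induce (S ∪ T)).cliqueNum = (G.induce S).cliqueNum + (G.induce T).cliqueNum := by
  obtain ⟨R, hR⟩ := exists_isMaxCliqueIn G S
  obtain ⟨Q, hQ⟩ := exists_isMaxCliqueIn G T
  rw [← (hR.union hQ h).ncard_eq, ← hR.ncard_eq, ← hQ.ncard_eq,
    Set.ncard_union_eq (h.disjoint.mono hR.subset hQ.subset)]

section FamiliesOfCliques

variable {ι : Type*} {F : Finset ι} {A B : ι → Set V}

theorem IsMaxCliqueIn.biUnion (hB : ∀ i ∈ F, IsMaxCliqueIn G (A i) (B i))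
    (h : (F : Set ι).Pairwise fun i j => G.IsCompleteBetween (A i) (A j)) :
    IsMaxCliqueIn G (⋃ i ∈ F, A i) (⋃ i ∈ F, B i) := by
  classical
  induction F using Finset.induction_on with
  | empty => simpa using isMaxCliqueIn_empty
  | insert i F hi ih =>
    rw [Finset.coe_insert] at h
    rw [Finset.set_biUnion_insert, Finset.set_biUnion_insert]
    exact (hB i (Finset.mem_insert_self _ _)).union
      (ih (fun j hj => hB j (Finset.mem_insert_of_mem hj)) (h.mono (Set.subset_insert _ _)))
      (isCompleteBetween_biUnion_of_insert hi h)

theorem cliqueNum_induce_biUnion_of_isCompleteBetween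
    (h : (F : Set ι).Pairwise fun i j => G.IsCompleteBetween (A i) (A j)) :
    (G.induce (⋃ i ∈ F, A i)).cliqueNum = ∑ i ∈ F, (G.induce (A i)).cliqueNum := by
  classical
  induction F using Finset.induction_on with
  | empty =>
    rw [show ⋃ i ∈ (∅ : Finset ι), A i = ∅ by simp, cliqueNum_induce_empty, Finset.sum_empty]
  | insert i F hi ih =>
    rw [Finset.coe_insert] at h
    rw [Finset.set_biUnion_insert,
      cliqueNum_induce_union_of_isCompleteBetween (isCompleteBetween_biUnion_of_insert hi h),
      Finset.sum_insert hi, ih (h.mono (Set.subset_insert _ _))]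

end FamiliesOfCliques

end Cliques

section ModularDecomposition

variable {V : Type u} {G : SimpleGraph V}

theorem IsModule.compl {S M : Finset V} (h : IsModule G S M) : IsModule Gᶜ S M := by
  refine ⟨h.1, h.2.1, fun x hx y hy z hz hzM => ?_⟩
  have hxz : x ≠ z := ne_of_mem_of_not_mem hx hzM
  have hyz : y ≠ z := ne_of_mem_of_not_mem hy hzM
  simp only [SimpleGraph.compl_adj, ne_eq, hxz, hyz, h.2.2 x hx y hy z hz hzM]

theorem isModule_compl_iff {S M : Finset V} : IsModule Gᶜ S M ↔ IsModule G S M :=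
  ⟨fun h => compl_compl G ▸ h.compl, IsModule.compl⟩

theorem isStrongModule_compl_iff {S M : Finset V} :
    IsStrongModule Gᶜ S M ↔ IsStrongModule G S M := by
  simp only [IsStrongModule, isModule_compl_iff]

open Classical in
/-- The vertex set of a connected component of `G[S]`, as a finset of vertices of `G`. -/
noncomputable def componentFinset {S : Finset V}
    (c : (G.induce (S : Set V)).ConnectedComponent) : Finset V :=
  S.filter fun x => ∃ hx : x ∈ S, (G.induce (S : Set V)).connectedComponentMk ⟨x, hx⟩ = c

section Components

variable {S : Finset V} {c : (G.induce (S : Set V)).ConnectedComponent}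

theorem mem_componentFinset {x : V} : x ∈ componentFinset c ↔
    ∃ hx : x ∈ S, (G.induce (S : Set V)).connectedComponentMk ⟨x, hx⟩ = c := by
  simp only [componentFinset, Finset.mem_filter]
  exact and_iff_right_of_imp fun ⟨hx, _⟩ => hx

theorem componentFinset_subset : componentFinset c ⊆ S :=
  fun _ hx => (mem_componentFinset.1 hx).1

theorem mem_componentFinset_of_adj {x y : V} (hx : x ∈ componentFinset c) (hy : y ∈ S)
    (hxy : G.Adj x y) : y ∈ componentFinset c := by
  obtain ⟨hxS, rfl⟩ := mem_componentFinset.1 hx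
  have hadj : (G.induce (S : Set V)).Adj ⟨y, hy⟩ ⟨x, hxS⟩ := hxy.symm
  exact mem_componentFinset.2 ⟨hy, SimpleGraph.ConnectedComponent.sound hadj.reachable⟩

theorem isModule_componentFinset : IsModule G S (componentFinset c) := by
  obtain ⟨⟨x, hx⟩, rfl⟩ := c.exists_rep
  refine ⟨⟨x, mem_componentFinset.2 ⟨hx, rfl⟩⟩, componentFinset_subset, fun y hy y' hy' z hz hzc =>
    ⟨fun h => ?_, fun h => ?_⟩⟩
  · exact absurd (mem_componentFinset_of_adj hy hz h) hzc
  · exact absurd (mem_componentFinset_of_adj hy' hz h) hzc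

theorem IsModule.componentFinset_subset {K : Finset V} (hK : IsModule G S K) {x d : V}
    (hxK : x ∈ K) (hxc : x ∈ componentFinset c) (hdK : d ∈ K) (hdc : d ∉ componentFinset c) :
    componentFinset c ⊆ K := by
  intro y hyc
  obtain ⟨hxS, rfl⟩ := mem_componentFinset.1 hxc
  obtain ⟨hyS, hy⟩ := mem_componentFinset.1 hyc
  have hreach := (SimpleGraph.reachable_iff_reflTransGen _ _).1
    (SimpleGraph.ConnectedComponent.exact hy.symm)
  suffices ∀ u, Relation.ReflTransGen (G.induce (S : Set V)).Adj ⟨x, hxS⟩ u →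
      u.1 ∈ K ∧ u.1 ∈ componentFinset ((G.induce (S : Set V)).connectedComponentMk ⟨x, hxS⟩) from
    (this _ hreach).1
  intro u hu
  induction hu with
  | refl => exact ⟨hxK, hxc⟩
  | @tail u z _ huz ih =>
    have hzc := mem_componentFinset_of_adj ih.2 z.2 huz
    refine ⟨?_, hzc⟩
    by_contra hzK
    have hdz : G.Adj d z := (hK.2.2 u ih.1 d hdK z z.2 hzK).1 huz
    exact hdc (mem_componentFinset_of_adj hzc (hK.2.1 hdK) hdz.symm)

theorem isStrongModule_componentFinset : IsStrongModule G S (componentFinset c) := by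
  refine ⟨isModule_componentFinset, fun K hK => or_iff_not_imp_right.2 fun h => ?_⟩
  obtain ⟨hKc, hdisj⟩ := not_or.1 h
  obtain ⟨d, hdK, hdc⟩ := Finset.not_subset.1 hKc
  obtain ⟨x, hxc, hxK⟩ := Finset.not_disjoint_iff.1 hdisj
  exact hK.componentFinset_subset hxK hxc hdK hdc

theorem connected_of_componentFinset_eq (h : componentFinset c = S) :
    (G.induce (S : Set V)).Connected := by
  obtain ⟨x, hx⟩ := c.exists_rep
  refine (SimpleGraph.connected_iff_exists_forall_reachable _).2 ⟨x, fun y => ?_⟩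
  obtain ⟨_, hy⟩ := mem_componentFinset.1 (h.symm ▸ y.2 : y.1 ∈ componentFinset c)
  exact SimpleGraph.ConnectedComponent.exact (hx.trans hy.symm)

end Components

variable [Fintype V]

theorem IsModule.of_isModule_induce {M A : Finset V} (hM : IsModule G Finset.univ M)
    (hA : IsModule G M A) : IsModule G Finset.univ A := by
  refine ⟨hA.1, Finset.subset_univ _, fun x hx y hy z _ hz => ?_⟩
  by_cases hzM : z ∈ M
  · exact hA.2.2 x hx y hy z hzM hz
  · exact hM.2.2 x (hA.2.1 hx) y (hA.2.1 hy) z (Finset.mem_univ _) hzM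

theorem IsStrongModule.restrict {M A : Finset V} (hM : IsModule G Finset.univ M)
    (hA : IsStrongModule G Finset.univ A) (hAM : A ⊆ M) : IsStrongModule G M A :=
  ⟨⟨hA.1.1, hAM, fun x hx y hy z _ hz => hA.1.2.2 x hx y hy z (Finset.mem_univ _) hz⟩,
    fun _ hK => hA.2 _ (hM.of_isModule_induce hK)⟩

namespace StrongMod

variable {A B M M' : StrongMod G} {x : V}

theorem nonempty (A : StrongMod G) : A.1.Nonempty := A.2.1.1

theorem le_or_le_of_mem (hA : x ∈ A.1) (hB : x ∈ B.1) : A ≤ B ∨ B ≤ A := by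
  rcases A.2.2 _ B.2.1 with h | h | h
  · exact Or.inl h
  · exact Or.inr h
  · exact absurd hB (Finset.disjoint_left.1 h hA)

theorem eq_of_covBy_of_mem (hA : A ⋖ M) (hB : B ⋖ M) (hxA : x ∈ A.1) (hxB : x ∈ B.1) :
    A = B := by
  rcases le_or_le_of_mem hxA hxB with h | h
  · exact ((hA.eq_or_eq h hB.le).resolve_right hB.lt.ne).symm
  · exact (hB.eq_or_eq h hA.le).resolve_right hA.lt.ne

theorem eq_of_covBy (h : A ⋖ M) (h' : A ⋖ M') : M = M' := by
  obtain ⟨x, hx⟩ := A.nonempty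
  rcases le_or_le_of_mem (h.le hx) (h'.le hx) with hle | hle
  · exact (h'.eq_or_eq h.le hle).resolve_left h.lt.ne'
  · exact ((h.eq_or_eq h'.le hle).resolve_left h'.lt.ne').symm

theorem card_ne_one_of_covBy (h : A ⋖ M) : M.1.card ≠ 1 := by
  have hlt : A.1.card < M.1.card := Finset.card_lt_card h.lt
  have hpos := A.nonempty.card_pos
  omega

theorem exists_covBy_mem (hM : M.1.card ≠ 1) (hx : x ∈ M.1) :
    ∃ B : StrongMod G, B ⋖ M ∧ x ∈ B.1 := by
  have hlt : (⟨{x}, isStrongModule_singleton G x⟩ : StrongMod G) < M :=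
    lt_of_le_of_ne (Finset.singleton_subset_iff.2 hx) fun e =>
      hM (e ▸ Finset.card_singleton x)
  obtain ⟨B, hB, hBM⟩ := exists_le_covBy_of_lt hlt
  exact ⟨B, hBM, hB (Finset.mem_singleton_self x)⟩

theorem coe_eq_biUnion_covBy (hM : M.1.card ≠ 1) :
    (M.1 : Set V) = ⋃ B ∈ {B : StrongMod G | B ⋖ M}, (B.1 : Set V) := by
  ext x
  simp only [Set.mem_iUnion, Finset.mem_coe, Set.mem_ofPred_eq, exists_prop]
  exact ⟨fun hx => exists_covBy_mem hM hx, fun ⟨B, hB, hx⟩ => hB.le hx⟩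

end StrongMod

theorem not_adj_of_not_connected {M A B : StrongMod G}
    (hM : ¬ (G.induce (M.1 : Set V)).Connected) (hA : A ⋖ M) (hB : B ⋖ M) (hAB : A ≠ B) {a b : V}
    (ha : a ∈ A.1) (hb : b ∈ B.1) : ¬ G.Adj a b := by
  intro hadj
  let c := (G.induce (M.1 : Set V)).connectedComponentMk ⟨a, hA.le ha⟩
  let K : StrongMod G := ⟨componentFinset c, M.2.trans isStrongModule_componentFinset⟩
  have haK : a ∈ K.1 := mem_componentFinset.2 ⟨hA.le ha, rfl⟩
  have hbK : b ∈ K.1 := mem_componentFinset_of_adj haK (hB.le hb) hadj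
  have hKM : K < M := lt_of_le_of_ne componentFinset_subset fun e =>
    hM (connected_of_componentFinset_eq (congrArg Subtype.val e))
  have hKA : K ≤ A := by
    rcases StrongMod.le_or_le_of_mem ha haK with hAK | hKA
    · exact ((hA.eq_or_eq hAK hKM.le).resolve_right hKM.ne).le
    · exact hKA
  exact hAB (StrongMod.eq_of_covBy_of_mem hA hB (hKA hbK) hb)

/-- Complementation preserves strong modules. -/
def StrongMod.complIso (G : SimpleGraph V) : StrongMod G ≃o StrongMod Gᶜ where
  toFun M := ⟨M.1, isStrongModule_compl_iff.2 M.2⟩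
  invFun M := ⟨M.1, isStrongModule_compl_iff.1 M.2⟩
  left_inv _ := rfl
  right_inv _ := rfl
  map_rel_iff' := Iff.rfl

theorem adj_of_not_connected_compl {M A B : StrongMod G}
    (hM : ¬ (Gᶜ.induce (M.1 : Set V)).Connected) (hA : A ⋖ M) (hB : B ⋖ M) (hAB : A ≠ B)
    {a b : V} (ha : a ∈ A.1) (hb : b ∈ B.1) : G.Adj a b := by
  have hne : a ≠ b := by
    rintro rfl
    exact hAB (StrongMod.eq_of_covBy_of_mem hA hB ha hb)
  have hnot : ¬ Gᶜ.Adj a b :=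
    not_adj_of_not_connected (M := StrongMod.complIso G M) hM
      ((apply_covBy_apply_iff (StrongMod.complIso G)).2 hA)
      ((apply_covBy_apply_iff (StrongMod.complIso G)).2 hB)
      ((StrongMod.complIso G).injective.ne hAB) ha hb
  by_contra hn
  exact hnot ((SimpleGraph.compl_adj _ _ _).2 ⟨hne, hn⟩)

theorem isMaxStrong_iff_covBy {M A : StrongMod G} : IsMaxStrong G M.1 A.1 ↔ A ⋖ M := by
  constructor
  · intro h
    have hAM : A < M := lt_of_le_of_ne h.prop.1.1.2.1 fun e => h.prop.2 (congrArg Subtype.val e)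
    refine ⟨hAM, fun B hAB hBM => hAB.not_ge ?_⟩
    exact h.le_of_ge (y := B.1)
      ⟨B.2.restrict M.2.1 hBM.le, fun e => hBM.ne (Subtype.ext e)⟩ hAB.le
  · intro h
    refine ⟨⟨A.2.restrict M.2.1 h.le, fun e => h.lt.ne (Subtype.ext e)⟩, fun B hB hAB => ?_⟩
    let B' : StrongMod G := ⟨B, M.2.trans hB.1⟩
    rcases h.eq_or_eq (c := B') hAB hB.1.1.2.1 with e | e
    · exact (congrArg Subtype.val e).le
    · exact absurd (congrArg Subtype.val e) hB.2

/-- The maximal strong modules of `G[M]` other than `M` are the children of `M`. -/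
def IsMaxStrong.toStrongMod {M : StrongMod G} {A : Finset V} (hA : IsMaxStrong G M.1 A) :
    StrongMod G :=
  ⟨A, M.2.trans hA.prop.1⟩

theorem IsMaxStrong.toStrongMod_covBy {M : StrongMod G} {A : Finset V}
    (hA : IsMaxStrong G M.1 A) : hA.toStrongMod ⋖ M :=
  isMaxStrong_iff_covBy.1 hA

theorem quotientGraph_adj_iff {M : StrongMod G} {A B : {A // IsMaxStrong G M.1 A}} (hAB : A ≠ B)
    {a b : V} (ha : a ∈ A.1) (hb : b ∈ B.1) : (quotientGraph G M.1).Adj A B ↔ G.Adj a b := by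
  have notMem_of_mem {x : V} (hxA : x ∈ A.1) (hxB : x ∈ B.1) : False :=
    have heq : A.2.toStrongMod = B.2.toStrongMod := StrongMod.eq_of_covBy_of_mem
      A.2.toStrongMod_covBy B.2.toStrongMod_covBy hxA hxB
    hAB (Subtype.ext (congrArg (fun X : StrongMod G => X.1) heq))
  refine ⟨?_, fun h => ⟨hAB, a, ha, b, hb, h⟩⟩
  rintro ⟨-, x, hx, y, hy, hxy⟩
  have hay : G.Adj a y := (A.2.toStrongMod.2.1.2.2 x hx a ha y (Finset.mem_univ _)
    fun h => notMem_of_mem h hy).1 hxy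
  exact ((B.2.toStrongMod.2.1.2.2 y hy b hb a (Finset.mem_univ _)
    fun h => notMem_of_mem ha h).1 hay.symm).symm

section Labels

variable {M : StrongMod G}

theorem mdLabel_eq_leaf_iff : mdLabel G M = MDLabel.leaf ↔ M.1.card = 1 := by
  unfold mdLabel
  split_ifs <;> simp_all

theorem not_connected_of_mdLabel_zero (h : mdLabel G M = MDLabel.zero) :
    ¬ (G.induce (M.1 : Set V)).Connected := by
  unfold mdLabel at h
  split_ifs at h
  assumption

theorem not_connected_compl_of_mdLabel_one (h : mdLabel G M = MDLabel.one) :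
    ¬ (Gᶜ.induce (M.1 : Set V)).Connected := by
  unfold mdLabel at h
  split_ifs at h
  assumption

theorem card_ne_one_of_prime (M : PrimeMod G) : M.1.1.card ≠ 1 :=
  fun h => MDLabel.noConfusion ((mdLabel_eq_leaf_iff.2 h).symm.trans M.2)

end Labels

end ModularDecomposition

section Lists

variable {α : Type*}

theorem eq_of_nodup_append_cons {l s s' r r' : List α} {a : α} (hl : l.Nodup)
    (h : l = s ++ a :: r) (h' : l = s' ++ a :: r') : s = s' ∧ r = r' := by
  rw [h] at hl h'
  have hs := List.nodup_append.1 hl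
  have has : a ∉ s := fun ha => hs.2.2 a ha a List.mem_cons_self rfl
  exact (((List.append_cons_inj_of_notMem has (List.nodup_cons.1 hs.2.1).1).1 h').imp_right
    And.right)

theorem head?_eq_of_pair_infix {l s r : List α} {a b : α} (hl : l.Nodup) (h : l = s ++ a :: r)
    (hab : [a, b] <:+: l) : r.head? = some b := by
  obtain ⟨s', t, h'⟩ := hab
  have := eq_of_nodup_append_cons hl h (s' := s') (r' := b :: t) (by simp [← h'])
  simp [this.2]

theorem getLast?_eq_of_pair_infix {l s r : List α} {a b : α} (hl : l.Nodup) (h : l = s ++ b :: r)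
    (hab : [a, b] <:+: l) : s.getLast? = some a := by
  obtain ⟨s', t, h'⟩ := hab
  have := eq_of_nodup_append_cons hl h (s' := s' ++ [a]) (r' := t) (by simp [← h'])
  simp [this.1]

theorem head?_append_singleton (q : List α) (a : α) : (q ++ [a]).head? = some (q.headD a) := by
  cases q <;> simp

theorem pair_infix_headD (p q : List α) (a c : α) :
    [a, q.headD c] <:+: p ++ a :: (q ++ [c]) := by
  cases q with
  | nil => exact ⟨p, [], by simp⟩
  | cons b q => exact ⟨p, q ++ [c], by simp⟩

theorem rel_of_pair_infix {r : α → α → Prop} {l : List α} {a b : α} (h : l.IsChain r)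
    (hab : [a, b] <:+: l) : r a b := by
  simpa using h.infix hab

theorem transGen_of_isChain_cons {r : α → α → Prop} {a b : α} {l : List α}
    (h : (a :: l).IsChain r) (hb : b ∈ l) : Relation.TransGen r a b :=
  (h.imp fun _ _ => Relation.TransGen.single).rel_cons hb

end Lists

section Cycles

variable {W : Type v} {N : Digraph W}

namespace RootedCycle

variable {C : RootedCycle N} {P Q p q : List W} {a b w : W}

/-- `P` and `Q` list the internal vertices of the two sides of `C`, the sides being taken in either
order. This lets statements about one side be applied to both. -/
def IsSides (C : RootedCycle N) (P Q : List W) : Prop :=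
  (P = C.inner₁ ∧ Q = C.inner₂) ∨ (P = C.inner₂ ∧ Q = C.inner₁)

/-- The vertices of the cycle other than its root. -/
def lower (C : RootedCycle N) : Set W := {w | w ∈ C.verts ∧ w ≠ C.root}

theorem isSides_inner (C : RootedCycle N) : C.IsSides C.inner₁ C.inner₂ := Or.inl ⟨rfl, rfl⟩

namespace IsSides

theorem symm (h : C.IsSides P Q) : C.IsSides Q P :=
  (Or.symm h).imp And.symm And.symm

theorem nodup (h : C.IsSides P Q) : (C.root :: C.hybrid :: (P ++ Q)).Nodup := by
  rcases h with ⟨rfl, rfl⟩ | ⟨rfl, rfl⟩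
  · exact C.nodup
  · exact (((List.perm_append_comm).cons _).cons _).nodup C.nodup

theorem path (h : C.IsSides P Q) : List.IsChain N.Adj (C.root :: (P ++ [C.hybrid])) := by
  rcases h with ⟨rfl, rfl⟩ | ⟨rfl, rfl⟩
  · exact C.path₁
  · exact C.path₂

theorem mem_verts (h : C.IsSides P Q) :
    w ∈ C.verts ↔ w = C.root ∨ w = C.hybrid ∨ w ∈ P ∨ w ∈ Q := by
  rcases h with ⟨rfl, rfl⟩ | ⟨rfl, rfl⟩
  · simp [verts, vertexList]
  · simp [verts, vertexList, or_comm]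

theorem isEdge_iff (h : C.IsSides P Q) :
    C.IsEdge a b ↔ [a, b] <:+: (C.root :: (P ++ [C.hybrid])) ∨
      [a, b] <:+: (C.root :: (Q ++ [C.hybrid])) := by
  rcases h with ⟨rfl, rfl⟩ | ⟨rfl, rfl⟩
  · rfl
  · exact or_comm

theorem nodup_left (h : C.IsSides P Q) : P.Nodup := by
  have := h.nodup
  simp only [List.nodup_cons, List.nodup_append] at this
  exact this.2.2.1

theorem root_notMem (h : C.IsSides P Q) : C.root ∉ P := by
  have := h.nodup
  simp only [List.nodup_cons, List.mem_cons, List.mem_append, not_or] at this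
  exact this.1.2.1

theorem hybrid_notMem (h : C.IsSides P Q) : C.hybrid ∉ P := by
  have := h.nodup
  simp only [List.nodup_cons, List.mem_cons, List.mem_append, not_or] at this
  exact this.2.1.1

theorem notMem_right (h : C.IsSides P Q) (hw : w ∈ P) : w ∉ Q := by
  have := h.nodup
  simp only [List.nodup_cons, List.nodup_append] at this
  exact fun hQ => this.2.2.2.2 w hw w hQ rfl

end IsSides

theorem root_ne_hybrid (C : RootedCycle N) : C.root ≠ C.hybrid := by
  have := C.nodup
  simp only [List.nodup_cons, List.mem_cons, not_or] at this
  exact this.1.1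

theorem root_mem_verts (C : RootedCycle N) : C.root ∈ C.verts :=
  C.isSides_inner.mem_verts.2 (Or.inl rfl)

theorem hybrid_mem_lower (C : RootedCycle N) : C.hybrid ∈ C.lower :=
  ⟨C.isSides_inner.mem_verts.2 (Or.inr (Or.inl rfl)), C.root_ne_hybrid.symm⟩

namespace IsSides

theorem mem_lower (h : C.IsSides P Q) (hw : w ∈ P) : w ∈ C.lower :=
  ⟨h.mem_verts.2 (Or.inr (Or.inr (Or.inl hw))), fun e => h.root_notMem (e ▸ hw)⟩

theorem mem_lower_iff (h : C.IsSides P Q) : w ∈ C.lower ↔ w = C.hybrid ∨ w ∈ P ∨ w ∈ Q := by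
  refine ⟨fun hw => (h.mem_verts.1 hw.1).resolve_left hw.2, ?_⟩
  rintro (rfl | hw | hw)
  · exact C.hybrid_mem_lower
  · exact h.mem_lower hw
  · exact h.symm.mem_lower hw

theorem mem_lower_of_mem_append_hybrid (h : C.IsSides P Q) (hw : w ∈ P ++ [C.hybrid]) :
    w ∈ C.lower := by
  rw [h.mem_lower_iff]
  simp only [List.mem_append, List.mem_singleton] at hw
  tauto

theorem nodup_path (h : C.IsSides P Q) : (C.root :: (P ++ [C.hybrid])).Nodup := by
  rw [List.nodup_cons, ← List.concat_eq_append, List.nodup_concat]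
  refine ⟨?_, h.hybrid_notMem, h.nodup_left⟩
  simpa [C.root_ne_hybrid] using h.root_notMem

theorem notMem_path (h : C.IsSides P Q) (hw : w ∈ P) : w ∉ C.root :: (Q ++ [C.hybrid]) := by
  simp only [List.mem_cons, List.mem_append, List.not_mem_nil, or_false, not_or]
  exact ⟨fun e => h.root_notMem (e ▸ hw), h.notMem_right hw, fun e => h.hybrid_notMem (e ▸ hw)⟩

theorem path_eq_append (hP : P = p ++ w :: q) :
    C.root :: (P ++ [C.hybrid]) = (C.root :: p) ++ w :: (q ++ [C.hybrid]) := by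
  simp [hP]

theorem isEdge_root_iff (h : C.IsSides P Q) :
    C.IsEdge C.root b ↔ b = P.headD C.hybrid ∨ b = Q.headD C.hybrid := by
  have first_edge {P Q : List W} (h : C.IsSides P Q) :
      [C.root, b] <:+: (C.root :: (P ++ [C.hybrid])) ↔ b = P.headD C.hybrid := by
    refine ⟨fun hb => ?_, ?_⟩
    · have := head?_eq_of_pair_infix h.nodup_path (s := []) rfl hb
      rw [head?_append_singleton] at this
      exact (Option.some.inj this).symm
    · rintro rfl
      exact pair_infix_headD [] P C.root C.hybrid
  rw [h.isEdge_iff, first_edge h, first_edge h.symm]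

theorem isEdge_side_iff (h : C.IsSides P Q) (hP : P = p ++ w :: q) :
    C.IsEdge w b ↔ b = q.headD C.hybrid := by
  have hwP : w ∈ P := by simp [hP]
  have hl := path_eq_append (C := C) hP
  rw [h.isEdge_iff]
  constructor
  · rintro (hb | hb)
    · have := head?_eq_of_pair_infix h.nodup_path hl hb
      rw [head?_append_singleton] at this
      exact (Option.some.inj this).symm
    · exact absurd (hb.subset List.mem_cons_self) (h.notMem_path hwP)
  · rintro rfl
    exact Or.inl (hl ▸ pair_infix_headD _ q w C.hybrid)

theorem eq_of_isEdge (h : C.IsSides P Q) (hw : w ∈ P) (ha : C.IsEdge a w) (hb : C.IsEdge b w) :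
    a = b := by
  obtain ⟨p, q, hP⟩ := List.append_of_mem hw
  have last_eq {c : W} (hc : C.IsEdge c w) : (C.root :: p).getLast? = some c := by
    rcases h.isEdge_iff.1 hc with hc | hc
    · exact getLast?_eq_of_pair_infix h.nodup_path (path_eq_append hP) hc
    · exact absurd (hc.subset (by simp)) (h.notMem_path hw)
  exact Option.some.inj ((last_eq ha).symm.trans (last_eq hb))

theorem isEdge_hybrid_iff (h : C.IsSides P Q) (hPne : P ≠ []) (hQne : Q ≠ []) :
    C.IsEdge w C.hybrid ↔ (∃ p, P = p ++ [w]) ∨ ∃ p, Q = p ++ [w] := by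
  have last_edge {P Q : List W} (h : C.IsSides P Q) (hP : P ≠ []) :
      [w, C.hybrid] <:+: (C.root :: (P ++ [C.hybrid])) ↔ ∃ p, P = p ++ [w] := by
    constructor
    · intro hw
      have := getLast?_eq_of_pair_infix h.nodup_path (s := C.root :: P) (r := []) (by simp) hw
      obtain ⟨a, l, rfl⟩ := List.exists_cons_of_ne_nil hP
      rw [List.getLast?_cons_cons] at this
      exact ⟨_, (List.dropLast_append_getLast? w this).symm⟩
    · rintro ⟨p, rfl⟩
      exact ⟨C.root :: p, [], by simp⟩
  rw [h.isEdge_iff, last_edge h hPne, last_edge h.symm hQne]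

end IsSides

theorem not_isEdge_hybrid : ¬ C.IsEdge C.hybrid b := by
  have not_infix {P Q : List W} (h : C.IsSides P Q) :
      ¬ [C.hybrid, b] <:+: (C.root :: (P ++ [C.hybrid])) := by
    intro hb
    have := head?_eq_of_pair_infix h.nodup_path (s := C.root :: P) (r := []) (by simp) hb
    simp at this
  rintro (h | h)
  · exact not_infix C.isSides_inner h
  · exact not_infix C.isSides_inner.symm h

theorem IsEdge.adj (h : C.IsEdge a b) : N.Adj a b := by
  rcases h with h | h
  · exact rel_of_pair_infix C.path₁ h
  · exact rel_of_pair_infix C.path₂ h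

theorem IsEdge.mem_verts (h : C.IsEdge a b) : a ∈ C.verts ∧ b ∈ C.verts := by
  have path_subset {P Q : List W} (hPQ : C.IsSides P Q) :
      ∀ w ∈ C.root :: (P ++ [C.hybrid]), w ∈ C.verts := by
    intro w hw
    rcases List.mem_cons.1 hw with rfl | hw
    · exact C.root_mem_verts
    · exact (hPQ.mem_lower_of_mem_append_hybrid hw).1
  rcases h with h | h
  · exact ⟨path_subset C.isSides_inner _ (h.subset (by simp)),
      path_subset C.isSides_inner _ (h.subset (by simp))⟩
  · exact ⟨path_subset C.isSides_inner.symm _ (h.subset (by simp)),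
      path_subset C.isSides_inner.symm _ (h.subset (by simp))⟩

/-- Both sides of `C` have internal vertices, `C` is entered from outside only at its root, and
the edges that leave `C` join each vertex `w` other than the root to `lf w`. This is how the cycle
of an elementary galled-tree sits in that tree as well as in a pvr-network. -/
structure HasPendants (C : RootedCycle N) (lf : W → W) : Prop where
  side_ne_nil : ∀ {P Q}, C.IsSides P Q → P ≠ []
  adj_iff : ∀ a ∈ C.verts, ∀ b, N.Adj a b ↔ C.IsEdge a b ∨ (a ≠ C.root ∧ b = lf a)
  isEdge_of_adj : ∀ a, ∀ b ∈ C.lower, N.Adj a b → C.IsEdge a b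

namespace HasPendants

variable {lf : W → W} (h : C.HasPendants lf)
include h

theorem adj_pendant (hw : w ∈ C.lower) : N.Adj w (lf w) :=
  (h.adj_iff w hw.1 _).2 (Or.inr ⟨hw.2, rfl⟩)

theorem children_root (hPQ : C.IsSides P Q) :
    children N C.root = {P.headD C.hybrid, Q.headD C.hybrid} := by
  ext b
  simp [children, h.adj_iff _ C.root_mem_verts, hPQ.isEdge_root_iff]

theorem children_side (hPQ : C.IsSides P Q) (hP : P = p ++ w :: q) :
    children N w = {q.headD C.hybrid, lf w} := by
  have hw : w ∈ C.lower := hPQ.mem_lower (by simp [hP])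
  ext b
  simp [children, h.adj_iff w hw.1, hw.2, hPQ.isEdge_side_iff hP]

theorem children_hybrid : children N C.hybrid = {lf C.hybrid} := by
  ext b
  simp [children, h.adj_iff _ C.hybrid_mem_lower.1, C.hybrid_mem_lower.2, not_isEdge_hybrid]

theorem adj_hybrid_iff (hPQ : C.IsSides P Q) :
    N.Adj w C.hybrid ↔ (∃ p, P = p ++ [w]) ∨ ∃ p, Q = p ++ [w] := by
  rw [← hPQ.isEdge_hybrid_iff (h.side_ne_nil hPQ) (h.side_ne_nil hPQ.symm)]
  exact ⟨h.isEdge_of_adj w _ C.hybrid_mem_lower, IsEdge.adj⟩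

theorem parents_subsingleton (hw : w ∈ C.lower) (hne : w ≠ C.hybrid) :
    (parents N w).Subsingleton := by
  intro a ha b hb
  replace ha := h.isEdge_of_adj a w hw ha
  replace hb := h.isEdge_of_adj b w hw hb
  rcases (C.isSides_inner.mem_lower_iff.1 hw).resolve_left hne with hw | hw
  · exact C.isSides_inner.eq_of_isEdge hw ha hb
  · exact C.isSides_inner.symm.eq_of_isEdge hw ha hb

end HasPendants

end RootedCycle

/-- `N` is the elementary galled-tree on `X` that consists of the cycle `C` and of the edges from
each vertex `w` of `C` other than the root to its leaf `lf w`. -/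
structure IsElementaryWith (N : Digraph W) (X : Set W) (C : RootedCycle N) (lf : W → W) :
    Prop where
  hasPendants : C.HasPendants lf
  acyclic : IsAcyclic N
  parents_eq_empty_iff : ∀ w, parents N w = ∅ ↔ w = C.root
  notMem_leaves_iff : ∀ w, w ∉ X ↔ w ∈ C.verts
  children_leaf : ∀ x ∈ X, children N x = ∅
  parents_leaf : ∀ x ∈ X, (parents N x).Subsingleton
  bijOn : Set.BijOn lf C.lower X

theorem RootedCycle.notMem_leaves {C : RootedCycle N} {X : Set W}
    (hch : ∀ x ∈ X, children N x = ∅)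
    (hlf : ∀ w ∈ C.verts, w ≠ C.root → ∃! x, x ∈ X ∧ N.Adj w x) :
    ∀ w ∈ C.verts, w ∉ X := by
  intro w hw hwX
  suffices h : ∃ x, N.Adj w x by
    obtain ⟨x, hx⟩ := h
    have : x ∈ children N w := hx
    simp [hch w hwX] at this
  by_cases hr : w = C.root
  · exact ⟨_, hr ▸ (C.isSides_inner.isEdge_root_iff.2 (Or.inl rfl)).adj⟩
  · exact (hlf w hw hr).exists.imp fun x hx => hx.2

theorem IsElementary.exists_isElementaryWith {X : Set W} (h : IsElementary N X)
    (hs : IsStrongTree N) :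
    ∃ C lf, IsElementaryWith N X C lf := by
  obtain ⟨hG, C, -, hroot, hcover, hlf, hedge⟩ := h
  have := hG.finite
  rcases hG.shape with ⟨x, -, hx⟩ | ⟨ρ, ⟨-, -, hρ⟩, hX, -, -⟩
  · have eq_x (w : W) : w = x := hx.le (Set.mem_univ w)
    exact absurd ((eq_x _).trans (eq_x _).symm) C.root_ne_hybrid
  have hch : ∀ x ∈ X, children N x = ∅ := fun x hx =>
    (Set.ncard_eq_zero (Set.toFinite _)).1 ((hX x).1 hx).1
  have hpar : ∀ x ∈ X, (parents N x).Subsingleton := fun x hx => by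
    obtain ⟨a, ha⟩ := Set.ncard_eq_one.1 ((hX x).1 hx).2
    exact ha ▸ Set.subsingleton_singleton
  have hCX := RootedCycle.notMem_leaves hch hlf
  choose! lf hlf lf_unique using hlf
  have leaf_eq {a b : W} (hab : N.Adj a b) (ha : a ∈ C.lower) (hb : b ∈ X) : b = lf a :=
    lf_unique a ha.1 ha.2 b ⟨hb, hab⟩
  refine ⟨C, lf, ⟨?_, ?_, ?_⟩, hG.acyclic, ?_, ?_, hch, hpar, ?_, ?_, ?_⟩
  · have := (hs C).1
    rintro P Q (⟨rfl, rfl⟩ | ⟨rfl, rfl⟩) <;> tauto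
  · refine fun a ha b => ⟨fun hab => (hedge a b hab).imp_right fun h =>
      ⟨h.2.1, leaf_eq hab ⟨ha, h.2.1⟩ h.2.2⟩, ?_⟩
    rintro (h | ⟨h, rfl⟩)
    · exact h.adj
    · exact (hlf a ha h).2
  · exact fun a b hb hab => (hedge a b hab).resolve_right fun h => hCX b hb.1 h.2.2
  · refine fun w => ⟨fun hw => ?_, fun hw => hw ▸ hroot⟩
    rw [hρ w (by simp [hw]), hρ C.root (by simp [hroot])]
  · exact fun w => ⟨(hcover w).resolve_right, hCX w⟩
  · exact fun w hw => (hlf w hw.1 hw.2).1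
  · intro w hw z hz e
    exact hpar _ (hlf w hw.1 hw.2).1 (hlf w hw.1 hw.2).2 (e ▸ (hlf z hz.1 hz.2).2)
  · intro x hx
    obtain ⟨a, ha⟩ := Set.ncard_eq_one.1 ((hX x).1 hx).2
    have hax : N.Adj a x := ha.ge rfl
    rcases hedge _ _ hax with hE | ⟨haC, har, -⟩
    · exact absurd hx (hCX _ hE.mem_verts.2)
    · exact ⟨a, ⟨haC, har⟩, (leaf_eq hax ⟨haC, har⟩ hx).symm⟩

end Cycles

section LowestCommonAncestors

variable {W : Type v} {N : Digraph W} {X : Set W}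

theorem IsAcyclic.eq_of_anc (h : IsAcyclic N) {a b : W} (hab : Anc N a b) (hba : Anc N b a) :
    a = b := by
  rcases Relation.reflTransGen_iff_eq_or_transGen.1 hab with e | hab
  · exact e.symm
  · exact absurd (hab.trans_left hba) (h a)

theorem IsAcyclic.isLCA_iff (h : IsAcyclic N) {x y w : W}
    (hw : ∀ z, Anc N z x ∧ Anc N z y ↔ Anc N z w) (z : W) : IsLCA N x y z ↔ z = w := by
  have hww := (hw w).2 Relation.ReflTransGen.refl
  constructor
  · rintro ⟨hz, hmin⟩
    exact (hmin w hww.1 hww.2 ((hw z).1 hz)).symm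
  · rintro rfl
    exact ⟨hww, fun z hx hy hwz => h.eq_of_anc ((hw z).1 ⟨hx, hy⟩) hwz⟩

namespace IsElementaryWith

variable {C : RootedCycle N} {lf : W → W} {P Q p q : List W} {u w x z : W}
  (h : IsElementaryWith N X C lf)
include h

theorem lf_mem (hw : w ∈ C.lower) : lf w ∈ X := h.bijOn.mapsTo hw

theorem anc_lf_iff (hw : w ∈ C.lower) : Anc N z (lf w) ↔ z = lf w ∨ Anc N z w := by
  constructor
  · intro hz
    rcases Relation.ReflTransGen.cases_tail hz with e | ⟨b, hzb, hb⟩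
    · exact Or.inl e.symm
    · right
      rwa [h.parents_leaf _ (h.lf_mem hw) hb (h.hasPendants.adj_pendant hw)] at hzb
  · rintro (rfl | hz)
    · exact Relation.ReflTransGen.refl
    · exact Relation.ReflTransGen.tail hz (h.hasPendants.adj_pendant hw)

theorem not_anc_of_mem_leaves (hx : x ∈ X) (hw : w ∈ C.lower) : ¬ Anc N x w := by
  intro hxw
  rcases Relation.ReflTransGen.cases_head hxw with rfl | ⟨b, hb, -⟩
  · exact (h.notMem_leaves_iff x).2 hw.1 hx
  · have : b ∈ children N x := hb
    simp [h.children_leaf x hx] at this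

theorem common_anc_lf_iff (hw : w ∈ C.lower) (hu : u ∈ C.lower) (hwu : w ≠ u) (z : W) :
    Anc N z (lf w) ∧ Anc N z (lf u) ↔ Anc N z w ∧ Anc N z u := by
  rw [h.anc_lf_iff hw, h.anc_lf_iff hu]
  constructor
  · rintro ⟨rfl | hzw, hz⟩
    · rcases hz with e | hz
      · exact absurd (h.bijOn.injOn hw hu e) hwu
      · exact absurd hz (h.not_anc_of_mem_leaves (h.lf_mem hw) hu)
    · rcases hz with rfl | hzu
      · exact absurd hzw (h.not_anc_of_mem_leaves (h.lf_mem hu) hw)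
      · exact ⟨hzw, hzu⟩
  · exact fun h' => ⟨Or.inr h'.1, Or.inr h'.2⟩

theorem parents_subsingleton (hr : w ≠ C.root) (hne : w ≠ C.hybrid) :
    (parents N w).Subsingleton := by
  by_cases hw : w ∈ X
  · exact h.parents_leaf w hw
  · exact h.hasPendants.parents_subsingleton ⟨(h.notMem_leaves_iff w).1 hw, hr⟩ hne

theorem mem_of_anc_side (hPQ : C.IsSides P Q) (hu : u ∈ P) (hz : Anc N z u) :
    z = C.root ∨ z ∈ P := by
  induction hz using Relation.ReflTransGen.head_induction_on with
  | refl => exact Or.inr hu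
  | @head a c hac _ ih =>
    rcases ih with rfl | hc
    · have : a ∈ parents N C.root := hac
      simp [(h.parents_eq_empty_iff C.root).2 rfl] at this
    · obtain ⟨p, q, rfl⟩ := List.append_of_mem hc
      have hch : c ≠ C.hybrid := fun e => hPQ.hybrid_notMem (e ▸ hc)
      have parent_eq {b : W} (hb : N.Adj b c) : a = b :=
        h.hasPendants.parents_subsingleton (hPQ.mem_lower hc) hch hac hb
      rcases List.eq_nil_or_concat p with rfl | ⟨p', b, rfl⟩
      · exact Or.inl (parent_eq (rel_of_pair_infix hPQ.path ⟨[], q ++ [C.hybrid], by simp⟩))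
      · right
        have hb : N.Adj b c := rel_of_pair_infix hPQ.path ⟨C.root :: p', q ++ [C.hybrid], by simp⟩
        simp [parent_eq hb]

variable (t : W → NLabel)

theorem explained_adj_iff (hw : w ∈ C.lower) (hu : u ∈ C.lower) (hwu : w ≠ u)
    (hz : ∀ y, Anc N y w ∧ Anc N y u ↔ Anc N y z) :
    (explained N X t).Adj ⟨lf w, h.lf_mem hw⟩ ⟨lf u, h.lf_mem hu⟩ ↔ t z = NLabel.one := by
  have hlca := h.acyclic.isLCA_iff fun y => (h.common_anc_lf_iff hw hu hwu y).trans (hz y)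
  have hne : lf w ≠ lf u := fun e => hwu (h.bijOn.injOn hw hu e)
  simp [explained, hlca, hne]

theorem explained_adj_side (hPQ : C.IsSides P Q) (hP : P = p ++ w :: q) (hw : w ∈ C.lower)
    (hu : u ∈ q ++ [C.hybrid]) (hu' : u ∈ C.lower) :
    (explained N X t).Adj ⟨lf w, h.lf_mem hw⟩ ⟨lf u, h.lf_mem hu'⟩ ↔ t w = NLabel.one := by
  have hpath := hPQ.path
  rw [RootedCycle.IsSides.path_eq_append hP] at hpath
  have hwu : Relation.TransGen N.Adj w u := transGen_of_isChain_cons hpath.right_of_append hu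
  refine h.explained_adj_iff t hw hu' ?_ fun y =>
    ⟨And.left, fun hy => ⟨hy, Relation.ReflTransGen.trans hy hwu.to_reflTransGen⟩⟩
  rintro rfl
  exact h.acyclic w hwu

theorem explained_adj_cross (hPQ : C.IsSides P Q) (hw : w ∈ P) (hu : u ∈ Q) :
    (explained N X t).Adj ⟨lf w, h.lf_mem (hPQ.mem_lower hw)⟩
      ⟨lf u, h.lf_mem (hPQ.symm.mem_lower hu)⟩ ↔ t C.root = NLabel.one := by
  have root_anc {P Q : List W} (hPQ : C.IsSides P Q) {w : W} (hw : w ∈ P) : Anc N C.root w :=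
    (transGen_of_isChain_cons hPQ.path (by simp [hw])).to_reflTransGen
  refine h.explained_adj_iff t (hPQ.mem_lower hw) (hPQ.symm.mem_lower hu)
    (fun e => hPQ.notMem_right hw (e ▸ hu)) fun y => ⟨?_, ?_⟩
  · rintro ⟨hyw, hyu⟩
    rcases h.mem_of_anc_side hPQ hw hyw with rfl | hy
    · exact Relation.ReflTransGen.refl
    · rcases h.mem_of_anc_side hPQ.symm hu hyu with rfl | hy'
      · exact Relation.ReflTransGen.refl
      · exact absurd hy' (hPQ.notMem_right hy)
  · exact fun hy => ⟨hy.trans (root_anc hPQ hw), hy.trans (root_anc hPQ.symm hu)⟩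

end IsElementaryWith

end LowestCommonAncestors

namespace PvrNetwork

variable {V : Type u} [Fintype V] {G : SimpleGraph V} (D : PvrNetwork.{u, v} G)

theorem exists_isElementaryWith (M : PrimeMod G) :
    ∃ C lf, IsElementaryWith (D.tree M) (D.leaves M) C lf ∧ D.treeRoot M = C.root := by
  obtain ⟨C, lf, h⟩ := (D.elementary M).exists_isElementaryWith (D.strong M)
  exact ⟨C, lf, h, (h.parents_eq_empty_iff _).1 (D.treeRoot_spec M)⟩

theorem treeRoot_notMem (M : PrimeMod G) : D.treeRoot M ∉ D.leaves M := by
  obtain ⟨C, lf, h, e⟩ := D.exists_isElementaryWith M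
  rw [e, h.notMem_leaves_iff]
  exact C.root_mem_verts

/-- The child of `M` that is identified with the leaf `w` of the galled-tree for `M`. -/
def childMod (M : PrimeMod G) (w : D.W M) (hl : w ∈ D.leaves M) : StrongMod G :=
  ⟨((D.explains M).symm ⟨w, hl⟩).1,
    IsStrongModule.trans M.1.2 ((D.explains M).symm ⟨w, hl⟩).2.prop.1⟩

theorem childMod_covBy (M : PrimeMod G) (w : D.W M) (hl : w ∈ D.leaves M) :
    D.childMod M w hl ⋖ M.1 :=
  isMaxStrong_iff_covBy.1 ((D.explains M).symm ⟨w, hl⟩).2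

theorem childMod_inj {M : PrimeMod G} {w z : D.W M} {hw : w ∈ D.leaves M} {hz : z ∈ D.leaves M}
    (h : D.childMod M w hw = D.childMod M z hz) : w = z := by
  have h1 : (D.explains M).symm ⟨w, hw⟩ = (D.explains M).symm ⟨z, hz⟩ :=
    Subtype.ext (congrArg (fun A : StrongMod G => A.1) h)
  exact congrArg Subtype.val ((D.explains M).symm.injective h1)

theorem exists_childMod_eq {M : PrimeMod G} {A : StrongMod G} (hA : A ⋖ M.1) :
    ∃ w hw, D.childMod M w hw = A := by
  refine ⟨(D.explains M ⟨A.1, isMaxStrong_iff_covBy.2 hA⟩).1,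
    (D.explains M ⟨A.1, isMaxStrong_iff_covBy.2 hA⟩).2, ?_⟩
  apply Subtype.ext
  simp [childMod]

theorem adj_iff_of_mem_childMod {M : PrimeMod G} {w z : D.W M} {hw : w ∈ D.leaves M}
    {hz : z ∈ D.leaves M} (hwz : w ≠ z) {a b : V} (ha : a ∈ (D.childMod M w hw).1)
    (hb : b ∈ (D.childMod M z hz).1) :
    G.Adj a b ↔ (explained (D.tree M) (D.leaves M) (D.treeLabel M)).Adj ⟨w, hw⟩ ⟨z, hz⟩ := by
  have hne : (D.explains M).symm ⟨w, hw⟩ ≠ (D.explains M).symm ⟨z, hz⟩ := fun e =>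
    hwz (congrArg Subtype.val ((D.explains M).symm.injective e))
  rw [← quotientGraph_adj_iff (M := M.1) hne ha hb]
  exact (D.explains M).symm.map_adj_iff

theorem glue_leaf {M : PrimeMod G} {w : D.W M} (hl : w ∈ D.leaves M) :
    D.glue M w = Sum.inl (D.childMod M w hl) := by
  simp [glue, hl, childMod]

theorem glue_root (M : PrimeMod G) : D.glue M (D.treeRoot M) = Sum.inl M.1 := by
  simp [glue, D.treeRoot_notMem]

theorem glue_inner {M : PrimeMod G} {w : D.W M} (hl : w ∉ D.leaves M) (hr : w ≠ D.treeRoot M) :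
    D.glue M w = Sum.inr ⟨M, w, hl, hr⟩ := by
  simp [glue, hl, hr]

theorem glue_eq_of_notMem {M M' : PrimeMod G} {w : D.W M} {w' : D.W M'} (hw : w ∉ D.leaves M)
    (hw' : w' ∉ D.leaves M') (h : D.glue M w = D.glue M' w') :
    (⟨M, w⟩ : Σ M, D.W M) = ⟨M', w'⟩ := by
  by_cases hr : w = D.treeRoot M <;> by_cases hr' : w' = D.treeRoot M'
  · rw [hr, hr', glue_root, glue_root] at h
    obtain rfl : M = M' := Subtype.ext (Sum.inl.inj h)
    rw [hr, hr']
  · rw [hr, glue_root, D.glue_inner hw' hr'] at h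
    exact absurd h (by simp)
  · rw [hr', glue_root, D.glue_inner hw hr] at h
    exact absurd h (by simp)
  · rw [D.glue_inner hw hr, D.glue_inner hw' hr'] at h
    cases h
    rfl

theorem glue_eq_of_ne_root {M M' : PrimeMod G} {w : D.W M} {w' : D.W M'} (hw : w ≠ D.treeRoot M)
    (hw' : w' ≠ D.treeRoot M') (h : D.glue M w = D.glue M' w') :
    (⟨M, w⟩ : Σ M, D.W M) = ⟨M', w'⟩ := by
  by_cases hl : w ∈ D.leaves M <;> by_cases hl' : w' ∈ D.leaves M'
  · rw [D.glue_leaf hl, D.glue_leaf hl'] at h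
    have h := Sum.inl.inj h
    obtain rfl : M = M' := Subtype.ext (StrongMod.eq_of_covBy (D.childMod_covBy M w hl)
      (h ▸ D.childMod_covBy M' w' hl'))
    rw [D.childMod_inj h]
  · rw [D.glue_leaf hl, D.glue_inner hl' hw'] at h
    exact absurd h (by simp)
  · rw [D.glue_leaf hl', D.glue_inner hl hw] at h
    exact absurd h (by simp)
  · exact D.glue_eq_of_notMem hl hl' h

theorem glue_injective (M : PrimeMod G) : Function.Injective (D.glue M) := by
  have key : ∀ w z, D.glue M w = D.glue M z → w ∈ D.leaves M → w = z := by
    intro w z h hw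
    have hwr : w ≠ D.treeRoot M := fun e => D.treeRoot_notMem M (e ▸ hw)
    by_cases hz : z = D.treeRoot M
    · rw [D.glue_leaf hw, hz, glue_root] at h
      exact absurd (Sum.inl.inj h) (D.childMod_covBy M w hw).lt.ne
    · simpa using D.glue_eq_of_ne_root hwr hz h
  intro w z h
  by_cases hw : w ∈ D.leaves M
  · exact key w z h hw
  by_cases hz : z ∈ D.leaves M
  · exact (key z w h.symm hz).symm
  · simpa using D.glue_eq_of_notMem hw hz h

theorem notMem_leaves_of_adj {M : PrimeMod G} {w z : D.W M} (h : (D.tree M).Adj w z) :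
    w ∉ D.leaves M := by
  obtain ⟨C, lf, hC, -⟩ := D.exists_isElementaryWith M
  intro hw
  have : z ∈ children (D.tree M) w := h
  rw [hC.children_leaf w hw] at this
  exact this

theorem ne_treeRoot_of_adj {M : PrimeMod G} {w z : D.W M} (h : (D.tree M).Adj w z) :
    z ≠ D.treeRoot M := by
  rintro rfl
  have : w ∈ parents (D.tree M) (D.treeRoot M) := h
  rw [D.treeRoot_spec] at this
  exact this

theorem adj_glue {M : PrimeMod G} {w z : D.W M} (h : (D.tree M).Adj w z) :
    D.network.Adj (D.glue M w) (D.glue M z) :=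
  Or.inr ⟨M, w, z, h, rfl, rfl⟩

theorem eq_of_glue_eq_inl {M : PrimeMod G} {w : D.W M} (hw : w ∉ D.leaves M) {A : StrongMod G}
    (h : D.glue M w = Sum.inl A) : M.1 = A := by
  by_cases hr : w = D.treeRoot M
  · rw [hr, glue_root] at h
    exact Sum.inl.inj h
  · rw [D.glue_inner hw hr] at h
    exact absurd h (by simp)

theorem ch_glue {M : PrimeMod G} {w : D.W M} (hw : w ∉ D.leaves M) :
    D.ch (D.glue M w) = D.glue M '' children (D.tree M) w := by
  ext b
  constructor
  · rintro (⟨A, B, hA, -, hwA, -⟩ | ⟨M', w', z', hadj, hww', rfl⟩)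
    · exact absurd M.2 (D.eq_of_glue_eq_inl hw hwA ▸ hA)
    · cases D.glue_eq_of_notMem hw (D.notMem_leaves_of_adj hadj) hww'
      exact ⟨z', hadj, rfl⟩
  · rintro ⟨z, hz, rfl⟩
    exact D.adj_glue hz

theorem parents_glue {M : PrimeMod G} {w : D.W M} (hw : w ≠ D.treeRoot M) :
    parents D.network (D.glue M w) = D.glue M '' parents (D.tree M) w := by
  ext a
  constructor
  · rintro (⟨A, B, hA, hBA, rfl, hB⟩ | ⟨M', a', w', hadj, rfl, hww'⟩)
    · by_cases hl : w ∈ D.leaves M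
      · rw [D.glue_leaf hl] at hB
        have := StrongMod.eq_of_covBy (D.childMod_covBy M w hl) (Sum.inl.inj hB ▸ hBA)
        exact absurd M.2 (this ▸ hA)
      · rw [D.glue_inner hl hw] at hB
        exact absurd hB (by simp)
    · cases D.glue_eq_of_ne_root hw (D.ne_treeRoot_of_adj hadj) hww'
      exact ⟨a', hadj, rfl⟩
  · rintro ⟨a, ha, rfl⟩
    exact D.adj_glue ha

theorem ch_inl {A : StrongMod G} (hA : mdLabel G A ≠ MDLabel.prime) :
    D.ch (Sum.inl A) = Sum.inl '' {B : StrongMod G | B ⋖ A} := by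
  ext b
  constructor
  · rintro (⟨A', B, -, hB, hAA', rfl⟩ | ⟨M, w, z, hadj, hw, rfl⟩)
    · obtain rfl := Sum.inl.inj hAA'
      exact ⟨B, hB, rfl⟩
    · exact absurd M.2 (D.eq_of_glue_eq_inl (D.notMem_leaves_of_adj hadj) hw.symm ▸ hA)
  · rintro ⟨B, hB, rfl⟩
    exact Or.inl ⟨A, B, hA, hB, rfl, rfl⟩

theorem label_glue {M : PrimeMod G} {w : D.W M} (hw : w ∉ D.leaves M) :
    D.label (D.glue M w) = D.treeLabel M w := by
  by_cases hr : w = D.treeRoot M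
  · rw [hr, glue_root]
    simp [label, M.2]
  · rw [D.glue_inner hw hr]
    rfl

theorem parents_subsingleton_or (v : D.Vert) :
    (parents D.network v).Subsingleton ∨
      ∃ M C lf, IsElementaryWith (D.tree M) (D.leaves M) C lf ∧ D.treeRoot M = C.root ∧
        v = D.glue M C.hybrid := by
  by_cases hv : ∃ M w, w ≠ D.treeRoot M ∧ v = D.glue M w
  · obtain ⟨M, w, hw, rfl⟩ := hv
    obtain ⟨C, lf, hC, e⟩ := D.exists_isElementaryWith M
    by_cases hh : w = C.hybrid
    · exact Or.inr ⟨M, C, lf, hC, e, by rw [hh]⟩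
    · left
      rw [D.parents_glue hw]
      exact (hC.parents_subsingleton (e ▸ hw) hh).image _
  · left
    push Not at hv
    rintro a (⟨A, B, -, hBA, rfl, hB⟩ | ⟨M, w, z, hadj, -, hz⟩)
    · rintro b (⟨A', B', -, hBA', rfl, hB'⟩ | ⟨M, w, z, hadj, -, hz⟩)
      · obtain rfl := Sum.inl.inj (hB.symm.trans hB')
        rw [StrongMod.eq_of_covBy hBA hBA']
      · exact absurd hz (hv M z (D.ne_treeRoot_of_adj hadj))
    · exact absurd hz (hv M z (D.ne_treeRoot_of_adj hadj))

/-- A height that does not increase along edges. The vertices strictly inside the galled-tree for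
`M` lie between `M` and the children of `M`. -/
def rank : D.Vert → ℕ
  | Sum.inl A => 2 * A.1.card
  | Sum.inr p => 2 * p.1.1.1.card - 1

theorem rank_le_of_adj {a b : D.Vert} (h : D.network.Adj a b) : D.rank b ≤ D.rank a := by
  rcases h with ⟨A, B, -, hBA, rfl, rfl⟩ | ⟨M, w, z, hadj, rfl, rfl⟩
  · have : B.1.card < A.1.card := Finset.card_lt_card hBA.lt
    simp only [rank]
    omega
  · have h1 : 2 * M.1.1.card - 1 ≤ D.rank (D.glue M w) := by
      by_cases hr : w = D.treeRoot M
      · rw [hr, glue_root]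
        simp only [rank]
        omega
      · rw [D.glue_inner (D.notMem_leaves_of_adj hadj) hr]
        exact le_rfl
    have h2 : D.rank (D.glue M z) ≤ 2 * M.1.1.card - 1 := by
      by_cases hl : z ∈ D.leaves M
      · rw [D.glue_leaf hl]
        have : (D.childMod M z hl).1.card < M.1.1.card :=
          Finset.card_lt_card (D.childMod_covBy M z hl).lt
        simp only [rank]
        omega
      · rw [D.glue_inner hl (D.ne_treeRoot_of_adj hadj)]
        exact le_rfl
    exact h2.trans h1

theorem rank_le_of_anc {a b : D.Vert} (h : Anc D.network a b) : D.rank b ≤ D.rank a := by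
  induction h with
  | refl => exact le_rfl
  | tail _ hbc ih => exact (D.rank_le_of_adj hbc).trans ih

end PvrNetwork

section CycleMaps

variable {W W' : Type*} {N : Digraph W} {N' : Digraph W'}

namespace RootedCycle

/-- The image of a rooted cycle under an injective homomorphism of directed graphs. -/
def map (C : RootedCycle N) (f : W → W') (hf : Function.Injective f)
    (hadj : ∀ a b, N.Adj a b → N'.Adj (f a) (f b)) : RootedCycle N' where
  root := f C.root
  hybrid := f C.hybrid
  inner₁ := C.inner₁.map f
  inner₂ := C.inner₂.map f
  path₁ := by simpa using List.isChain_map_of_isChain f hadj C.path₁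
  path₂ := by simpa using List.isChain_map_of_isChain f hadj C.path₂
  nodup := by simpa using C.nodup.map hf
  nontrivial := by simpa using C.nontrivial

variable {C : RootedCycle N} {f : W → W'} {hf : Function.Injective f}
  {hadj : ∀ a b, N.Adj a b → N'.Adj (f a) (f b)}

theorem IsSides.exists_of_map {P Q : List W'} (h : (C.map f hf hadj).IsSides P Q) :
    ∃ P' Q', C.IsSides P' Q' ∧ P'.map f = P ∧ Q'.map f = Q := by
  rcases h with ⟨rfl, rfl⟩ | ⟨rfl, rfl⟩
  · exact ⟨_, _, C.isSides_inner, rfl, rfl⟩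
  · exact ⟨_, _, C.isSides_inner.symm, rfl, rfl⟩

theorem verts_map : (C.map f hf hadj).verts = f '' C.verts := by
  have : (C.map f hf hadj).vertexList = C.vertexList.map f := by simp [vertexList, map]
  ext v
  simp [verts, this]

theorem lower_map : (C.map f hf hadj).lower = f '' C.lower := by
  ext v
  constructor
  · rintro ⟨hv, hr⟩
    rw [verts_map] at hv
    obtain ⟨w, hw, rfl⟩ := hv
    exact ⟨w, ⟨hw, fun e => hr (congrArg f e)⟩, rfl⟩
  · rintro ⟨w, hw, rfl⟩
    exact ⟨verts_map ▸ ⟨w, hw.1, rfl⟩, fun e => hw.2 (hf e)⟩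

theorem IsEdge.map {a b : W} (h : C.IsEdge a b) : (C.map f hf hadj).IsEdge (f a) (f b) := by
  refine h.imp (fun h => ?_) fun h => ?_ <;>
  simpa [RootedCycle.map] using h.map f

theorem IsEdge.of_map {a b : W} (h : (C.map f hf hadj).IsEdge (f a) (f b)) : C.IsEdge a b := by
  have infix_of_map {P : List W} (h : [f a, f b] <:+: (f C.root :: (P.map f ++ [f C.hybrid]))) :
      [a, b] <:+: (C.root :: (P ++ [C.hybrid])) := by
    have h : [f a, f b] <:+: (C.root :: (P ++ [C.hybrid])).map f := by simpa using h
    obtain ⟨l, hl, e⟩ := List.infix_map_iff.1 h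
    rwa [List.map_injective_iff.2 hf (a₁ := [a, b]) e]
  exact Or.imp infix_of_map infix_of_map h

theorem HasPendants.map {lf : W → W} {lf' : W' → W'} (h : C.HasPendants lf)
    (hch : ∀ w ∈ C.verts, children N' (f w) = f '' children N w)
    (hpar : ∀ w ∈ C.lower, parents N' (f w) = f '' parents N w)
    (hlf : ∀ w ∈ C.lower, lf' (f w) = f (lf w)) : (C.map f hf hadj).HasPendants lf' where
  side_ne_nil hPQ := by
    obtain ⟨P, Q, hPQ', rfl, rfl⟩ := hPQ.exists_of_map
    simpa using h.side_ne_nil hPQ'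
  adj_iff a ha b := by
    rw [verts_map] at ha
    obtain ⟨w, hw, rfl⟩ := ha
    have hroot : f w ≠ (C.map f hf hadj).root ↔ w ≠ C.root := hf.ne_iff
    change b ∈ children N' (f w) ↔ _
    rw [hch w hw, hroot]
    constructor
    · rintro ⟨z, hz, rfl⟩
      refine ((h.adj_iff w hw z).1 hz).imp IsEdge.map ?_
      rintro ⟨hr, rfl⟩
      exact ⟨hr, (hlf w ⟨hw, hr⟩).symm⟩
    · rintro (he | ⟨hr, rfl⟩)
      · obtain ⟨z, -, rfl⟩ := verts_map ▸ he.mem_verts.2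
        exact ⟨z, (h.adj_iff w hw z).2 (Or.inl he.of_map), rfl⟩
      · exact ⟨lf w, h.adj_pendant ⟨hw, hr⟩, (hlf w ⟨hw, hr⟩).symm⟩
  isEdge_of_adj a b hb hab := by
    rw [lower_map] at hb
    obtain ⟨w, hw, rfl⟩ := hb
    obtain ⟨z, hz, rfl⟩ := (hpar w hw).le hab
    exact (h.isEdge_of_adj z w hw hz).map

end RootedCycle

end CycleMaps

section CycleUniqueness

variable {W : Type*} {N : Digraph W}

namespace RootedCycle

/-- The rooted cycle with its two sides interchanged. -/
def swap (C : RootedCycle N) : RootedCycle N where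
  root := C.root
  hybrid := C.hybrid
  inner₁ := C.inner₂
  inner₂ := C.inner₁
  path₁ := C.path₂
  path₂ := C.path₁
  nodup := C.isSides_inner.symm.nodup
  nontrivial := C.nontrivial.symm

variable {C C' : RootedCycle N} {P Q P' Q' p q l : List W} {a b : W} {lf : W → W}

theorem isSides_swap : C.swap.IsSides P Q ↔ C.IsSides P Q := or_comm

theorem verts_swap : C.swap.verts = C.verts := by
  ext w
  rw [C.isSides_inner.mem_verts, (isSides_swap.2 C.isSides_inner).mem_verts]
  rfl

theorem lower_swap : C.swap.lower = C.lower := by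
  ext w
  simp only [lower, verts_swap]
  rfl

theorem isEdge_swap : C.swap.IsEdge a b ↔ C.IsEdge a b := or_comm

theorem HasPendants.swap (h : C.HasPendants lf) : C.swap.HasPendants lf where
  side_ne_nil hPQ := h.side_ne_nil (isSides_swap.1 hPQ)
  adj_iff a ha b := by
    rw [isEdge_swap]
    exact h.adj_iff a (verts_swap ▸ ha) b
  isEdge_of_adj a b hb hab := isEdge_swap.2 (h.isEdge_of_adj a b (lower_swap ▸ hb) hab)

theorem IsSides.eq_or_eq_swap (hPQ : C.IsSides P Q) (hPQ' : C'.IsSides P Q)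
    (hr : C'.root = C.root) (hh : C'.hybrid = C.hybrid) : C' = C ∨ C' = C.swap := by
  obtain ⟨r, h, P₁, P₂, _, _, _, _⟩ := C
  obtain ⟨r', h', P₁', P₂', _, _, _, _⟩ := C'
  simp only [IsSides] at hPQ hPQ'
  simp only [swap, mk.injEq]
  grind

theorem IsSides.getLast_ne (hPQ : C.IsSides P Q) :
    (C.root :: P).getLast (List.cons_ne_nil _ _) ≠
      (C.root :: Q).getLast (List.cons_ne_nil _ _) := by
  have hne : P ≠ [] ∨ Q ≠ [] := by
    rcases hPQ with ⟨rfl, rfl⟩ | ⟨rfl, rfl⟩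
    exacts [C.nontrivial, C.nontrivial.symm]
  rcases List.eq_nil_or_concat P with rfl | ⟨p, a, rfl⟩ <;>
    rcases List.eq_nil_or_concat Q with rfl | ⟨q, b, rfl⟩
  · simp at hne
  · simpa using fun e : C.root = b => hPQ.symm.root_notMem (by simp [e])
  · simpa using fun e : a = C.root => hPQ.root_notMem (by simp [e])
  · simpa using fun e : a = b => hPQ.notMem_right (w := a) (by simp) (by simp [e])

theorem IsSides.adj_getLast (hPQ : C.IsSides P Q) :
    N.Adj ((C.root :: P).getLast (List.cons_ne_nil _ _)) C.hybrid := by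
  refine rel_of_pair_infix hPQ.path ⟨(C.root :: P).dropLast, [], ?_⟩
  rw [List.append_nil, ← List.cons_append, List.append_cons, List.dropLast_append_getLast]

theorem HasPendants.exists_isSides (h : C.HasPendants lf) (ha : N.Adj a C.hybrid)
    (hb : N.Adj b C.hybrid) (hab : a ≠ b) : ∃ p q, C.IsSides (p ++ [a]) (q ++ [b]) := by
  have ne_of_eq {P p q : List W} (hp : P = p ++ [a]) (hq : P = q ++ [b]) : False := by
    simp_all
  have hPQ := C.isSides_inner
  rcases (h.adj_hybrid_iff hPQ).1 ha with ⟨p, hp⟩ | ⟨p, hp⟩ <;>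
    rcases (h.adj_hybrid_iff hPQ).1 hb with ⟨q, hq⟩ | ⟨q, hq⟩
  · exact (ne_of_eq hp hq).elim
  · exact ⟨p, q, hp ▸ hq ▸ hPQ⟩
  · exact ⟨p, q, hp ▸ hq ▸ hPQ.symm⟩
  · exact (ne_of_eq hp hq).elim

end RootedCycle

theorem suffix_or_suffix_of_isChain {l l' : List W} {c : W}
    (hl : List.IsChain N.Adj (l ++ [c])) (hl' : List.IsChain N.Adj (l' ++ [c]))
    (hpar : ∀ v ∈ (l ++ [c]).tail, (parents N v).Subsingleton) :
    l ++ [c] <:+ l' ++ [c] ∨ l' ++ [c] <:+ l ++ [c] := by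
  induction l using List.reverseRecOn generalizing l' c with
  | nil => exact Or.inl (List.suffix_append _ _)
  | append_singleton l d ih =>
    rcases List.eq_nil_or_concat l' with rfl | ⟨l', d', rfl⟩
    · exact Or.inr (List.suffix_append _ _)
    · rw [List.concat_eq_append] at hl' ⊢
      obtain rfl : d = d' :=
        hpar c (by cases l <;> simp) (rel_of_pair_infix hl ⟨l, [], by simp⟩)
          (rel_of_pair_infix hl' ⟨l', [], by simp⟩)
      exact (ih hl.left_of_append hl'.left_of_append
        fun v hv => hpar v (by cases l <;> simp at hv ⊢; tauto)).imp
          List.suffix_append_self_iff.2 List.suffix_append_self_iff.2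

theorem eq_of_cons_suffix_cons {a : W} {l l' : List W} (h : a :: l <:+ a :: l')
    (hl' : (a :: l').Nodup) : l = l' := by
  obtain ⟨s, hs⟩ := h
  exact (eq_of_nodup_append_cons hl' hs.symm (s' := []) rfl).2

namespace RootedCycle

variable {C C' : RootedCycle N} {P Q P' Q' p q l : List W} {a b : W} {lf : W → W}

theorem HasPendants.suffix_or_suffix (h : C.HasPendants lf) (hPQ : C.IsSides (p ++ [a]) Q)
    (hl : List.IsChain N.Adj (l ++ [a])) :
    C.root :: (p ++ [a]) <:+ l ++ [a] ∨ l ++ [a] <:+ C.root :: (p ++ [a]) := by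
  refine suffix_or_suffix_of_isChain (l := C.root :: p) ?_ hl fun v hv => ?_
  · exact List.IsChain.left_of_append (l₂ := [C.hybrid]) hPQ.path
  · exact h.parents_subsingleton (hPQ.mem_lower hv) fun e => hPQ.hybrid_notMem (e ▸ hv)

theorem IsSides.root_eq_of_suffix_or_suffix (hPQ : C.IsSides P Q) (hPQ' : C'.IsSides P' Q')
    (hanc : ∀ w ∈ C.lower, ¬ Anc N w C.root)
    (hP : C.root :: P <:+ C'.root :: P' ∨ C'.root :: P' <:+ C.root :: P)
    (hQ : C.root :: Q <:+ C'.root :: Q' ∨ C'.root :: Q' <:+ C.root :: Q) :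
    C'.root = C.root := by
  by_contra hne
  have mem_of_suffix {P P' : List W}
      (h : C.root :: P <:+ C'.root :: P' ∨ C'.root :: P' <:+ C.root :: P) :
      C.root ∈ P' ∨ C'.root ∈ P :=
    h.imp (fun h => (List.mem_cons.1 (h.subset (by simp))).resolve_left (Ne.symm hne))
      fun h => (List.mem_cons.1 (h.subset (by simp))).resolve_left hne
  have not_crossing {P Q P' Q' : List W} (hPQ : C.IsSides P Q) (hPQ' : C'.IsSides P' Q')
      (h : C'.root ∈ P) : C.root ∉ P' := fun h' =>
    hanc _ (hPQ.mem_lower h) (transGen_of_isChain_cons hPQ'.path (by simp [h'])).to_reflTransGen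
  rcases mem_of_suffix hP with h | h <;> rcases mem_of_suffix hQ with h' | h'
  · exact hPQ'.notMem_right h h'
  · exact not_crossing hPQ.symm hPQ' h' h
  · exact not_crossing hPQ hPQ'.symm h h'
  · exact hPQ.notMem_right h h'

theorem IsSides.eq_of_suffix_or_suffix (hPQ : C.IsSides P Q) (hPQ' : C'.IsSides P' Q')
    (hr : C'.root = C.root)
    (h : C.root :: P <:+ C'.root :: P' ∨ C'.root :: P' <:+ C.root :: P) : P' = P := by
  have hP := List.nodup_cons.2 ⟨hPQ.root_notMem, hPQ.nodup_left⟩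
  have hP' := List.nodup_cons.2 ⟨hPQ'.root_notMem, hPQ'.nodup_left⟩
  rw [hr] at h hP'
  rcases h with h | h
  · exact (eq_of_cons_suffix_cons h hP').symm
  · exact eq_of_cons_suffix_cons h hP

theorem HasPendants.eq_or_eq_swap (h : C.HasPendants lf) (hanc : ∀ w ∈ C.lower, ¬ Anc N w C.root)
    (hh : C'.hybrid = C.hybrid) : C' = C ∨ C' = C.swap := by
  have hPQ' := C'.isSides_inner
  obtain ⟨p, q, hPQ⟩ := h.exists_isSides (hh ▸ hPQ'.adj_getLast) (hh ▸ hPQ'.symm.adj_getLast)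
    hPQ'.getLast_ne
  have comparable {P' Q' p Q : List W} (hPQ' : C'.IsSides P' Q')
      (hPQ : C.IsSides (p ++ [(C'.root :: P').getLast (List.cons_ne_nil _ _)]) Q) :
      C.root :: (p ++ [(C'.root :: P').getLast (List.cons_ne_nil _ _)]) <:+ C'.root :: P' ∨
        C'.root :: P' <:+ C.root :: (p ++ [(C'.root :: P').getLast (List.cons_ne_nil _ _)]) := by
    have hpath : List.IsChain N.Adj (C'.root :: P') :=
      List.IsChain.left_of_append (l₂ := [C'.hybrid]) hPQ'.path
    have hlast := List.dropLast_append_getLast (List.cons_ne_nil C'.root P')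
    rw [← hlast] at hpath
    simpa only [hlast] using h.suffix_or_suffix hPQ hpath
  have hP := comparable hPQ' hPQ
  have hQ := comparable hPQ'.symm hPQ.symm
  have hr := hPQ.root_eq_of_suffix_or_suffix hPQ' hanc hP hQ
  rw [← hPQ.eq_of_suffix_or_suffix hPQ' hr hP,
    ← hPQ.symm.eq_of_suffix_or_suffix hPQ'.symm hr hQ] at hPQ
  exact hPQ.eq_or_eq_swap hPQ' hr hh

end RootedCycle

end CycleUniqueness

section NetworkCycles

namespace PvrNetwork

variable {V : Type u} [Fintype V] {G : SimpleGraph V} (D : PvrNetwork.{u, v} G)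

/-- `C` is the cycle of the network that replaces the edges below the prime module `M`, and `B` maps
the vertices of `C` other than the root to the children of `M` that are attached to them. -/
structure IsCycleAt (M : PrimeMod G) (C : RootedCycle D.network) (B : D.Vert → StrongMod G) :
    Prop where
  root_eq : C.root = Sum.inl M.1
  mem_lower_iff : ∀ v, v ∈ C.lower ↔ ∃ w, v = Sum.inr ⟨M, w⟩
  hasPendants : C.HasPendants fun w => Sum.inl (B w)
  bijOn : Set.BijOn B C.lower {A | A ⋖ M.1}
  adj_side : ∀ {P Q}, C.IsSides P Q → ∀ {p w q}, P = p ++ w :: q → ∀ u ∈ q ++ [C.hybrid],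
    ∀ a ∈ (B w).1, ∀ b ∈ (B u).1, G.Adj a b ↔ D.label w = NLabel.one
  adj_cross : ∀ {P Q}, C.IsSides P Q → ∀ w ∈ P, ∀ u ∈ Q,
    ∀ a ∈ (B w).1, ∀ b ∈ (B u).1, G.Adj a b ↔ D.label C.root = NLabel.one
  label_ne_leaf : ∀ v ∈ C.verts, D.label v ≠ NLabel.leaf

/-- A cycle of the galled-tree for `M` as a cycle of the network. -/
noncomputable def networkCycle {M : PrimeMod G} (T : RootedCycle (D.tree M)) :
    RootedCycle D.network :=
  T.map (D.glue M) (D.glue_injective M) fun _ _ => D.adj_glue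

section IsElementaryWith

variable {M : PrimeMod G} {T : RootedCycle (D.tree M)} {lf : D.W M → D.W M}
  (h : IsElementaryWith (D.tree M) (D.leaves M) T lf)

theorem exists_pendantMod : ∃ B : D.Vert → StrongMod G,
    ∀ w (hw : w ∈ T.lower), B (D.glue M w) = D.childMod M (lf w) (h.lf_mem hw) := by
  classical
  refine ⟨Function.extend (D.glue M)
    (fun w => if hl : lf w ∈ D.leaves M then D.childMod M (lf w) hl else M.1) fun _ => M.1,
    fun w hw => ?_⟩
  rw [(D.glue_injective M).extend_apply]
  exact dif_pos (h.lf_mem hw)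

include h

theorem mem_lower_networkCycle_iff (hr : D.treeRoot M = T.root) (v : D.Vert) :
    v ∈ (D.networkCycle T).lower ↔ ∃ w, v = Sum.inr ⟨M, w⟩ := by
  rw [networkCycle, RootedCycle.lower_map]
  constructor
  · rintro ⟨w, hw, rfl⟩
    have hl : w ∉ D.leaves M := (h.notMem_leaves_iff w).2 hw.1
    exact ⟨⟨w, hl, hr ▸ hw.2⟩, D.glue_inner hl (hr ▸ hw.2)⟩
  · rintro ⟨⟨w, hl, hw⟩, rfl⟩
    exact ⟨w, ⟨(h.notMem_leaves_iff w).1 hl, hr ▸ hw⟩, D.glue_inner hl hw⟩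

variable {B : D.Vert → StrongMod G}
  (hB : ∀ w (hw : w ∈ T.lower), B (D.glue M w) = D.childMod M (lf w) (h.lf_mem hw))
include hB

theorem hasPendants_networkCycle (hr : D.treeRoot M = T.root) :
    (D.networkCycle T).HasPendants fun w => Sum.inl (B w) :=
  h.hasPendants.map (fun w hw => D.ch_glue ((h.notMem_leaves_iff w).2 hw))
    (fun w hw => D.parents_glue (hr ▸ hw.2)) fun w hw => by
      rw [hB w hw, D.glue_leaf (h.lf_mem hw)]

theorem bijOn_networkCycle : Set.BijOn B (D.networkCycle T).lower {A | A ⋖ M.1} := by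
  rw [networkCycle, RootedCycle.lower_map]
  refine ⟨?_, ?_, fun A hA => ?_⟩
  · rintro _ ⟨w, hw, rfl⟩
    rw [hB w hw]
    exact D.childMod_covBy _ _ _
  · rintro _ ⟨w, hw, rfl⟩ _ ⟨z, hz, rfl⟩ e
    rw [hB w hw, hB z hz] at e
    rw [h.bijOn.injOn hw hz (D.childMod_inj e)]
  · obtain ⟨x, hx, rfl⟩ := D.exists_childMod_eq hA
    obtain ⟨w, hw, rfl⟩ := h.bijOn.surjOn hx
    exact ⟨_, ⟨w, hw, rfl⟩, hB w hw⟩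

theorem adj_iff_explained_adj {w u : D.W M} (hw : w ∈ T.lower) (hu : u ∈ T.lower) (hwu : w ≠ u)
    {a b : V} (ha : a ∈ (B (D.glue M w)).1) (hb : b ∈ (B (D.glue M u)).1) :
    G.Adj a b ↔ (explained (D.tree M) (D.leaves M) (D.treeLabel M)).Adj
      ⟨lf w, h.lf_mem hw⟩ ⟨lf u, h.lf_mem hu⟩ := by
  rw [hB w hw] at ha
  rw [hB u hu] at hb
  exact D.adj_iff_of_mem_childMod (fun e => hwu (h.bijOn.injOn hw hu e)) ha hb

theorem adj_iff_label_glue_eq_one {P Q p q : List (D.W M)} {w u : D.W M} (hPQ : T.IsSides P Q)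
    (hP : P = p ++ w :: q) (hu : u ∈ q ++ [T.hybrid]) {a b : V} (ha : a ∈ (B (D.glue M w)).1)
    (hb : b ∈ (B (D.glue M u)).1) : G.Adj a b ↔ D.label (D.glue M w) = NLabel.one := by
  have hw : w ∈ T.lower := hPQ.mem_lower (by simp [hP])
  have hu' : u ∈ T.lower := hPQ.mem_lower_of_mem_append_hybrid (by simp_all)
  have hwu : w ≠ u := by
    rintro rfl
    have hnodup := hPQ.nodup_path
    rw [RootedCycle.IsSides.path_eq_append hP] at hnodup
    exact (List.nodup_cons.1 (List.nodup_append.1 hnodup).2.1).1 hu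
  rw [D.adj_iff_explained_adj h hB hw hu' hwu ha hb,
    D.label_glue ((h.notMem_leaves_iff w).2 hw.1)]
  exact h.explained_adj_side _ hPQ hP hw hu hu'

theorem adj_iff_label_glue_root_eq_one {P Q : List (D.W M)} {w u : D.W M} (hPQ : T.IsSides P Q)
    (hw : w ∈ P) (hu : u ∈ Q) {a b : V} (ha : a ∈ (B (D.glue M w)).1)
    (hb : b ∈ (B (D.glue M u)).1) : G.Adj a b ↔ D.label (D.glue M T.root) = NLabel.one := by
  have hwu : w ≠ u := fun e => hPQ.notMem_right hw (e ▸ hu)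
  rw [D.adj_iff_explained_adj h hB (hPQ.mem_lower hw) (hPQ.symm.mem_lower hu) hwu ha hb,
    D.label_glue ((h.notMem_leaves_iff _).2 T.root_mem_verts)]
  exact h.explained_adj_cross _ hPQ hw hu

theorem isCycleAt_networkCycle (hr : D.treeRoot M = T.root) :
    D.IsCycleAt M (D.networkCycle T) B where
  root_eq := by
    change D.glue M T.root = _
    rw [← hr, glue_root]
  mem_lower_iff := D.mem_lower_networkCycle_iff h hr
  hasPendants := D.hasPendants_networkCycle h hB hr
  bijOn := D.bijOn_networkCycle h hB
  adj_side {P Q} hPQ {p w q} hP u hu a ha b hb := by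
    obtain ⟨P, Q, hPQ', rfl, rfl⟩ := hPQ.exists_of_map
    obtain ⟨p, r, hPr, rfl, hr⟩ := List.map_eq_append_iff.1 hP
    obtain ⟨w, q, rfl, rfl, rfl⟩ := List.map_eq_cons_iff.1 hr
    have hu : u ∈ (q ++ [T.hybrid]).map (D.glue M) := by
      simpa [networkCycle, RootedCycle.map] using hu
    obtain ⟨u, hu', rfl⟩ := List.mem_map.1 hu
    exact D.adj_iff_label_glue_eq_one h hB hPQ' hPr hu' ha hb
  adj_cross {P Q} hPQ w hw u hu a ha b hb := by
    obtain ⟨P, Q, hPQ', rfl, rfl⟩ := hPQ.exists_of_map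
    obtain ⟨w, hw', rfl⟩ := List.mem_map.1 hw
    obtain ⟨u, hu', rfl⟩ := List.mem_map.1 hu
    exact D.adj_iff_label_glue_root_eq_one h hB hPQ' hw' hu' ha hb
  label_ne_leaf v hv := by
    obtain ⟨w, hw, rfl⟩ := RootedCycle.verts_map.le hv
    have hl : w ∉ D.leaves M := (h.notMem_leaves_iff w).2 hw
    rw [D.label_glue hl]
    exact fun e => hl ((D.labeling M w).1 e)

end IsElementaryWith

variable {D}

theorem exists_isCycleAt (M : PrimeMod G) : ∃ C B, D.IsCycleAt M C B := by
  obtain ⟨T, lf, h, hr⟩ := D.exists_isElementaryWith M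
  obtain ⟨B, hB⟩ := D.exists_pendantMod h
  exact ⟨_, B, D.isCycleAt_networkCycle h hB hr⟩

namespace IsCycleAt

variable {M : PrimeMod G} {C C' : RootedCycle D.network} {B : D.Vert → StrongMod G}
  {P Q p q : List D.Vert} {w : D.Vert} (h : D.IsCycleAt M C B)
include h

theorem swap : D.IsCycleAt M C.swap B where
  root_eq := h.root_eq
  mem_lower_iff := RootedCycle.lower_swap ▸ h.mem_lower_iff
  hasPendants := h.hasPendants.swap
  bijOn := RootedCycle.lower_swap ▸ h.bijOn
  adj_side hPQ := h.adj_side (RootedCycle.isSides_swap.1 hPQ)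
  adj_cross hPQ := h.adj_cross (RootedCycle.isSides_swap.1 hPQ)
  label_ne_leaf := RootedCycle.verts_swap ▸ h.label_ne_leaf

theorem ch_root (hPQ : C.IsSides P Q) : D.ch C.root = {P.headD C.hybrid, Q.headD C.hybrid} :=
  h.hasPendants.children_root hPQ

theorem ch_side (hPQ : C.IsSides P Q) (hP : P = p ++ w :: q) :
    D.ch w = {q.headD C.hybrid, Sum.inl (B w)} :=
  h.hasPendants.children_side hPQ hP

theorem ch_hybrid : D.ch C.hybrid = {Sum.inl (B C.hybrid)} :=
  h.hasPendants.children_hybrid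

theorem not_anc_root (hw : w ∈ C.lower) : ¬ Anc D.network w C.root := by
  intro hanc
  obtain ⟨w, rfl⟩ := (h.mem_lower_iff w).1 hw
  have hle := D.rank_le_of_anc hanc
  rw [h.root_eq] at hle
  simp only [rank] at hle
  have := M.1.nonempty.card_pos
  omega

theorem eq_or_eq_swap (hh : C'.hybrid = C.hybrid) : C' = C ∨ C' = C.swap :=
  h.hasPendants.eq_or_eq_swap (fun _ => h.not_anc_root) hh

end IsCycleAt

theorem exists_isCycleAt_of_rootedCycle (C : RootedCycle D.network) :
    ∃ M B, D.IsCycleAt M C B := by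
  have hPQ := C.isSides_inner
  rcases D.parents_subsingleton_or C.hybrid with hsub | ⟨M, T, lf, hT, hr, hh⟩
  · exact absurd (hsub hPQ.adj_getLast hPQ.symm.adj_getLast) hPQ.getLast_ne
  · obtain ⟨B, hB⟩ := D.exists_pendantMod hT
    have h := D.isCycleAt_networkCycle hT hB hr
    refine ⟨M, B, ?_⟩
    rcases h.eq_or_eq_swap hh with rfl | rfl
    exacts [h, h.swap]

end PvrNetwork

end NetworkCycles

section Leaves

namespace PvrNetwork

variable {V : Type u} [Fintype V] {G : SimpleGraph V} (D : PvrNetwork.{u, v} G)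

/-- The leaves reached from `v` along directed paths whose vertices other than `v` lie in `a`. For
`a = Set.univ` this is `L(N(v))`, and for the final set of active vertices and the root it is
`Ω`. -/
def reach (a : Set D.Vert) (v : D.Vert) : Set V :=
  {x | Relation.ReflTransGen (fun y z => D.network.Adj y z ∧ z ∈ a) v (D.leafVert x)}

theorem leavesBelow_eq_reach (v : D.Vert) : D.leavesBelow v = D.reach Set.univ v := by
  simp [leavesBelow, reach, Anc]

theorem leafVert_injective : Function.Injective D.leafVert := fun _ _ h =>
  Finset.singleton_injective (congrArg Subtype.val (Sum.inl.inj h))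

theorem ch_inl_eq_empty {A : StrongMod G} (hA : A.1.card = 1) : D.ch (Sum.inl A) = ∅ := by
  rw [D.ch_inl (by simp [mdLabel_eq_leaf_iff.2 hA]), Set.image_eq_empty,
    Set.eq_empty_iff_forall_notMem]
  exact fun B hB => StrongMod.card_ne_one_of_covBy hB hA

theorem reach_inl_of_card_eq_one {A : StrongMod G} (hA : A.1.card = 1) (a : Set D.Vert) :
    D.reach a (Sum.inl A) = (A.1 : Set V) := by
  obtain ⟨x, hx⟩ := Finset.card_eq_one.1 hA
  have hAx : (Sum.inl A : D.Vert) = D.leafVert x := congrArg Sum.inl (Subtype.ext hx)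
  ext y
  rw [hx, Finset.coe_singleton, Set.mem_singleton_iff]
  refine ⟨fun hy => ?_, fun hy => ?_⟩
  · rcases Relation.ReflTransGen.cases_head hy with e | ⟨b, hb, -⟩
    · exact (D.leafVert_injective (hAx.symm.trans e)).symm
    · exact absurd hb.1 ((D.ch_inl_eq_empty hA).le ·)
  · rw [hy, hAx]
    exact Relation.ReflTransGen.refl

theorem reach_eq_biUnion {v : D.Vert} (hv : ∀ A, v = Sum.inl A → A.1.card ≠ 1) (a : Set D.Vert) :
    D.reach a v = ⋃ c ∈ D.ch v ∩ a, D.reach a c := by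
  ext y
  simp only [Set.mem_iUnion, exists_prop]
  refine ⟨fun hy => ?_, fun ⟨c, hc, hy⟩ => Relation.ReflTransGen.head hc hy⟩
  rcases Relation.ReflTransGen.cases_head hy with e | ⟨b, hb, hby⟩
  · exact absurd (Finset.card_singleton y) (hv _ e)
  · exact ⟨b, hb, hby⟩

/-- The union of the modules `B w` attached to the vertices `w` of a part `q` of a side. -/
def sideSet {W : Type*} (B : W → StrongMod G) (q : List W) : Set V := {x | ∃ w ∈ q, x ∈ (B w).1}

/-- The union of the modules `B w` attached to the vertices `w` of `q` that are labeled `1`: the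
vertices above `q` that are adjacent to all leaves below the hybrid-vertex. -/
def oneSet (B : D.Vert → StrongMod G) (q : List D.Vert) : Set V :=
  {x | ∃ w ∈ q, D.label w = NLabel.one ∧ x ∈ (B w).1}

variable {B : D.Vert → StrongMod G} {w : D.Vert}

theorem sideSet_nil : sideSet B [] = ∅ := by simp [sideSet]

theorem sideSet_cons (w : D.Vert) (q : List D.Vert) :
    sideSet B (w :: q) = sideSet B q ∪ (B w).1 := by
  rw [Set.union_comm]
  ext
  simp [sideSet]

theorem oneSet_subset_sideSet (q : List D.Vert) : D.oneSet B q ⊆ sideSet B q :=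
  fun _ ⟨w, hw, _, hx⟩ => ⟨w, hw, hx⟩

theorem oneSet_cons_of_eq (hw : D.label w = NLabel.one) (q : List D.Vert) :
    D.oneSet B (w :: q) = D.oneSet B q ∪ (B w).1 := by
  rw [Set.union_comm]
  ext
  simp [oneSet, hw]

theorem oneSet_cons_of_ne (hw : D.label w ≠ NLabel.one) (q : List D.Vert) :
    D.oneSet B (w :: q) = D.oneSet B q := by
  ext
  simp [oneSet, hw]

variable {D}

namespace IsCycleAt

variable {M : PrimeMod G} {C : RootedCycle D.network} {P Q p q : List D.Vert}
  (h : D.IsCycleAt M C B)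
include h

theorem covBy (hw : w ∈ C.lower) : B w ⋖ M.1 := h.bijOn.mapsTo hw

theorem coe_eq_union (hPQ : C.IsSides P Q) :
    (M.1.1 : Set V) = (sideSet B P ∪ (B C.hybrid).1) ∪ (sideSet B Q ∪ (B C.hybrid).1) := by
  have himage : {A | A ⋖ M.1} = B '' C.lower := h.bijOn.image_eq.symm
  rw [StrongMod.coe_eq_biUnion_covBy (card_ne_one_of_prime M), himage, Set.biUnion_image]
  ext x
  simp only [Set.mem_iUnion, hPQ.mem_lower_iff, sideSet, Set.mem_union, Set.mem_ofPred_eq,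
    Finset.mem_coe]
  grind

theorem reach_of_mem {a : Set D.Vert} (hw : w ∈ C.verts) :
    D.reach a w = ⋃ c ∈ D.ch w ∩ a, D.reach a c := by
  refine D.reach_eq_biUnion (fun A hA => ?_) a
  by_cases hr : w = C.root
  · rw [← Sum.inl.inj (h.root_eq.symm.trans (hr.symm.trans hA))]
    exact card_ne_one_of_prime M
  · obtain ⟨z, rfl⟩ := (h.mem_lower_iff w).1 ⟨hw, hr⟩
    exact absurd hA Sum.inr_ne_inl

section

variable (hL : ∀ A : StrongMod G, A ⋖ M.1 → D.leavesBelow (Sum.inl A) = (A.1 : Set V))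
include hL

theorem leavesBelow_headD_of_forall (hPQ : C.IsSides P Q) (hP : P = p ++ q) :
    D.leavesBelow (q.headD C.hybrid) = sideSet B q ∪ (B C.hybrid).1 := by
  induction q generalizing p with
  | nil =>
    rw [List.headD_nil, leavesBelow_eq_reach, h.reach_of_mem C.hybrid_mem_lower.1, h.ch_hybrid,
      Set.inter_univ, Set.biUnion_singleton, ← leavesBelow_eq_reach,
      hL _ (h.covBy C.hybrid_mem_lower), sideSet_nil, Set.empty_union]
  | cons w q ih =>
    have hw : w ∈ C.lower := hPQ.mem_lower (by simp [hP])
    rw [List.headD_cons, leavesBelow_eq_reach, h.reach_of_mem hw.1, h.ch_side hPQ hP,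
      Set.inter_univ, Set.biUnion_pair, ← leavesBelow_eq_reach, ← leavesBelow_eq_reach,
      hL _ (h.covBy hw), sideSet_cons, ih (p := p ++ [w]) (by simp [hP]), Set.union_right_comm]

theorem leavesBelow_root_of_forall : D.leavesBelow (Sum.inl M.1) = (M.1.1 : Set V) := by
  have hPQ := C.isSides_inner
  rw [← h.root_eq, leavesBelow_eq_reach, h.reach_of_mem C.root_mem_verts, h.ch_root hPQ,
    Set.inter_univ, Set.biUnion_pair, ← leavesBelow_eq_reach, ← leavesBelow_eq_reach,
    h.leavesBelow_headD_of_forall hL hPQ (p := []) rfl,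
    h.leavesBelow_headD_of_forall hL hPQ.symm (p := []) rfl, h.coe_eq_union hPQ]

end

end IsCycleAt

variable (D) in
theorem leavesBelow_inl (A : StrongMod G) : D.leavesBelow (Sum.inl A) = (A.1 : Set V) := by
  induction A using WellFoundedLT.induction with
  | ind A ih =>
    by_cases hc : A.1.card = 1
    · rw [leavesBelow_eq_reach, D.reach_inl_of_card_eq_one hc]
    by_cases hp : mdLabel G A = MDLabel.prime
    · obtain ⟨C, B, hC⟩ := exists_isCycleAt (D := D) ⟨A, hp⟩
      exact hC.leavesBelow_root_of_forall fun B hB => ih B hB.lt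
    · rw [leavesBelow_eq_reach, D.reach_eq_biUnion (by rintro _ ⟨⟩; exact hc), D.ch_inl hp,
        Set.inter_univ, Set.biUnion_image, StrongMod.coe_eq_biUnion_covBy hc]
      refine Set.iUnion₂_congr fun B hB => ?_
      rw [← leavesBelow_eq_reach, ih B hB.lt]

namespace IsCycleAt

variable {M : PrimeMod G} {C : RootedCycle D.network} {P Q p q : List D.Vert} {z : D.Vert}
  {a b : V} (h : D.IsCycleAt M C B)
include h

theorem leavesBelow_headD (hPQ : C.IsSides P Q) (hP : P = p ++ q) :
    D.leavesBelow (q.headD C.hybrid) = sideSet B q ∪ (B C.hybrid).1 :=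
  h.leavesBelow_headD_of_forall (fun A _ => D.leavesBelow_inl A) hPQ hP

theorem eq_of_mem_mod {x : V} (hw : w ∈ C.lower) (hz : z ∈ C.lower) (hxw : x ∈ (B w).1)
    (hxz : x ∈ (B z).1) : w = z :=
  h.bijOn.injOn hw hz (StrongMod.eq_of_covBy_of_mem (h.covBy hw) (h.covBy hz) hxw hxz)

theorem label_eq_zero_or_one (hw : w ∈ C.verts) :
    D.label w = NLabel.zero ∨ D.label w = NLabel.one := by
  have := h.label_ne_leaf w hw
  cases hl : D.label w <;> simp_all

theorem adj_iff_of_mem_side (hPQ : C.IsSides P Q) (hP : P = p ++ w :: q)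
    (ha : a ∈ sideSet B q ∪ (B C.hybrid).1) (hb : b ∈ (B w).1) :
    G.Adj a b ↔ D.label w = NLabel.one := by
  rw [G.adj_comm]
  rcases ha with ⟨u, hu, ha⟩ | ha
  · exact h.adj_side hPQ hP u (List.mem_append_left _ hu) b hb a ha
  · exact h.adj_side hPQ hP C.hybrid (by simp) b hb a ha

theorem adj_hybrid_iff_mem_oneSet (hPQ : C.IsSides P Q) (ha : a ∈ sideSet B P)
    (hb : b ∈ (B C.hybrid).1) : G.Adj a b ↔ a ∈ D.oneSet B P := by
  obtain ⟨w, hw, ha⟩ := ha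
  have hadj {z : D.Vert} (hz : z ∈ P) (haz : a ∈ (B z).1) :
      G.Adj a b ↔ D.label z = NLabel.one := by
    obtain ⟨p, q, hP⟩ := List.append_of_mem hz
    exact h.adj_side hPQ hP C.hybrid (by simp) a haz b hb
  exact ⟨fun hab => ⟨w, hw, (hadj hw ha).1 hab, ha⟩, fun ⟨z, hz, hl, haz⟩ => (hadj hz haz).2 hl⟩

theorem adj_cross_iff (hPQ : C.IsSides P Q) (ha : a ∈ sideSet B P) (hb : b ∈ sideSet B Q) :
    G.Adj a b ↔ D.label C.root = NLabel.one := by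
  obtain ⟨w, hw, ha⟩ := ha
  obtain ⟨u, hu, hb⟩ := hb
  exact h.adj_cross hPQ w hw u hu a ha b hb

theorem isCompleteBetween_mod (hPQ : C.IsSides P Q) (hP : P = p ++ w :: q)
    (hw : D.label w = NLabel.one) :
    G.IsCompleteBetween (sideSet B q ∪ (B C.hybrid).1) (B w).1 :=
  fun _ ha _ hb => (h.adj_iff_of_mem_side hPQ hP ha hb).2 hw

theorem isCompleteBetween_oneSet_hybrid (hPQ : C.IsSides P Q) :
    G.IsCompleteBetween (D.oneSet B P) (B C.hybrid).1 := fun _ ha _ hb =>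
  (h.adj_hybrid_iff_mem_oneSet hPQ (D.oneSet_subset_sideSet P ha) hb).2 ha

theorem isCompleteBetween_sides (hPQ : C.IsSides P Q) (hr : D.label C.root = NLabel.one) :
    G.IsCompleteBetween (sideSet B P) (sideSet B Q) :=
  fun _ ha _ hb => (h.adj_cross_iff hPQ ha hb).2 hr

theorem isCompleteBetween_oneSets (hPQ : C.IsSides P Q) (hr : D.label C.root = NLabel.one) :
    G.IsCompleteBetween (D.oneSet B P) (D.oneSet B Q) := fun _ ha _ hb =>
  h.isCompleteBetween_sides hPQ hr (D.oneSet_subset_sideSet P ha) (D.oneSet_subset_sideSet Q hb)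

theorem isCompleteBetween_oneSets_hybrid (hPQ : C.IsSides P Q) :
    G.IsCompleteBetween (D.oneSet B P ∪ D.oneSet B Q) (B C.hybrid).1 := by
  rintro a (ha | ha)
  exacts [h.isCompleteBetween_oneSet_hybrid hPQ ha,
    h.isCompleteBetween_oneSet_hybrid hPQ.symm ha]

theorem cliqueNum_cons_of_label_zero (hPQ : C.IsSides P Q) (hP : P = p ++ w :: q)
    (hw : D.label w = NLabel.zero) {S : Set V} (hS : S ⊆ sideSet B q ∪ (B C.hybrid).1) :
    (G.induce (S ∪ (B w).1)).cliqueNum =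
      max (G.induce S).cliqueNum (G.induce ((B w).1 : Set V)).cliqueNum := by
  refine cliqueNum_induce_union_of_not_adj fun a ha b hb => ?_
  rw [h.adj_iff_of_mem_side hPQ hP (hS ha.1) hb.1, hw]
  simp

theorem cliqueNum_cons_of_label_one (hPQ : C.IsSides P Q) (hP : P = p ++ w :: q)
    (hw : D.label w = NLabel.one) {S : Set V} (hS : S ⊆ sideSet B q ∪ (B C.hybrid).1) :
    (G.induce (S ∪ (B w).1)).cliqueNum =
      (G.induce S).cliqueNum + (G.induce ((B w).1 : Set V)).cliqueNum :=
  cliqueNum_induce_union_of_isCompleteBetween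
    fun _ ha _ hb => h.isCompleteBetween_mod hPQ hP hw (hS ha) hb

theorem cliqueNum_side_union_hybrid (hPQ : C.IsSides P Q) :
    (G.induce (sideSet B P ∪ (B C.hybrid).1)).cliqueNum =
      max (G.induce (sideSet B P)).cliqueNum
        ((G.induce (D.oneSet B P)).cliqueNum +
          (G.induce ((B C.hybrid).1 : Set V)).cliqueNum) := by
  have hunion : sideSet B P ∪ (B C.hybrid).1 =
      sideSet B P ∪ (D.oneSet B P ∪ ((B C.hybrid).1 : Set V)) := by
    rw [← Set.union_assoc, Set.union_eq_left.2 (D.oneSet_subset_sideSet P)]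
  rw [← cliqueNum_induce_union_of_isCompleteBetween (h.isCompleteBetween_oneSet_hybrid hPQ),
    hunion, cliqueNum_induce_union_of_not_adj]
  rintro a ⟨haP, ha⟩ b ⟨hb | hb, hbP⟩ hab
  · exact hbP (D.oneSet_subset_sideSet P hb)
  · exact ha (Or.inl ((h.adj_hybrid_iff_mem_oneSet hPQ haP hb).1 hab))

theorem cliqueNum_root_of_label_zero (hPQ : C.IsSides P Q) (hr : D.label C.root = NLabel.zero) :
    (G.induce (M.1.1 : Set V)).cliqueNum =
      max (G.induce (sideSet B P ∪ (B C.hybrid).1)).cliqueNum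
        (G.induce (sideSet B Q ∪ (B C.hybrid).1)).cliqueNum := by
  rw [h.coe_eq_union hPQ, cliqueNum_induce_union_of_not_adj]
  rintro a ⟨haP | ha, haQ⟩ b ⟨hbQ | hb, hbP⟩ hab
  · exact NLabel.noConfusion (hr.symm.trans ((h.adj_cross_iff hPQ haP hbQ).1 hab))
  · exact hbP (Or.inr hb)
  all_goals exact haQ (Or.inr ha)

theorem cliqueNum_root_of_label_one (hPQ : C.IsSides P Q) (hr : D.label C.root = NLabel.one) :
    (G.induce (M.1.1 : Set V)).cliqueNum =
      max ((G.induce (sideSet B P)).cliqueNum + (G.induce (sideSet B Q)).cliqueNum)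
        ((G.induce (D.oneSet B P)).cliqueNum + (G.induce (D.oneSet B Q)).cliqueNum +
          (G.induce ((B C.hybrid).1 : Set V)).cliqueNum) := by
  have hunion : (M.1.1 : Set V) = (sideSet B P ∪ sideSet B Q) ∪
      ((D.oneSet B P ∪ D.oneSet B Q) ∪ (B C.hybrid).1) := by
    rw [h.coe_eq_union hPQ, ← Set.union_assoc (sideSet B P ∪ sideSet B Q), Set.union_eq_left.2
      (Set.union_subset_union (D.oneSet_subset_sideSet P) (D.oneSet_subset_sideSet Q)),
      Set.union_union_union_comm, Set.union_self]
  rw [← cliqueNum_induce_union_of_isCompleteBetween (h.isCompleteBetween_sides hPQ hr),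
    ← cliqueNum_induce_union_of_isCompleteBetween (h.isCompleteBetween_oneSets hPQ hr),
    ← cliqueNum_induce_union_of_isCompleteBetween (h.isCompleteBetween_oneSets_hybrid hPQ),
    hunion,
    cliqueNum_induce_union_of_not_adj]
  rintro a ⟨ha, ha'⟩ b ⟨(hb | hb) | hb, hb'⟩ hab
  · exact hb' (Or.inl (D.oneSet_subset_sideSet P hb))
  · exact hb' (Or.inr (D.oneSet_subset_sideSet Q hb))
  · rcases ha with ha | ha
    · exact ha' (Or.inl (Or.inl ((h.adj_hybrid_iff_mem_oneSet hPQ ha hb).1 hab)))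
    · exact ha' (Or.inl (Or.inr ((h.adj_hybrid_iff_mem_oneSet hPQ.symm ha hb).1 hab)))

/-- The right-hand side is the maximum of `α` and `β` in the algorithm. -/
theorem cliqueNum_root_eq_max (hPQ : C.IsSides P Q) (hr : D.label C.root = NLabel.one) :
    ((G.induce (M.1.1 : Set V)).cliqueNum : ℤ) =
      max (((G.induce (sideSet B P ∪ (B C.hybrid).1)).cliqueNum : ℤ) +
          (G.induce (sideSet B Q ∪ (B C.hybrid).1)).cliqueNum -
          (G.induce ((B C.hybrid).1 : Set V)).cliqueNum)
        (((G.induce (sideSet B P)).cliqueNum : ℤ) + (G.induce (sideSet B Q)).cliqueNum) := by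
  rw [h.cliqueNum_root_of_label_one hPQ hr, h.cliqueNum_side_union_hybrid hPQ,
    h.cliqueNum_side_union_hybrid hPQ.symm]
  push_cast
  have hleP := cliqueNum_induce_mono (G := G) (D.oneSet_subset_sideSet (B := B) P)
  have hleQ := cliqueNum_induce_mono (G := G) (D.oneSet_subset_sideSet (B := B) Q)
  omega

end IsCycleAt

end PvrNetwork

end Leaves

section Initialization

namespace Loop

variable {α : Type*} {S : Type*} {body : α → S → S → Prop} {l l' : List α} {s s' : S}

theorem append_iff :
    Loop body (l ++ l') s s' ↔ ∃ a, Loop body l s a ∧ Loop body l' a s' := by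
  induction l generalizing s with
  | nil =>
    constructor
    · exact fun h => ⟨s, Loop.nil s, h⟩
    · rintro ⟨a, h, h'⟩
      cases h
      exact h'
  | cons b l ih =>
    constructor
    · rintro (_ | ⟨hb, hl⟩)
      obtain ⟨a, h, h'⟩ := ih.1 hl
      exact ⟨a, Loop.cons hb h, h'⟩
    · rintro ⟨a, _ | ⟨hb, hl⟩, h'⟩
      exact Loop.cons hb (ih.2 ⟨a, hl, h'⟩)

theorem singleton_iff {a : α} : Loop body [a] s s' ↔ body a s s' := by
  constructor
  · rintro (_ | ⟨hb, hl⟩)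
    cases hl
    exact hb
  · exact fun h => Loop.cons h (Loop.nil _)

theorem exists_of_forall (h : ∀ a ∈ l, ∀ s, ∃ s', body a s s') (s : S) :
    ∃ s', Loop body l s s' := by
  induction l generalizing s with
  | nil => exact ⟨s, Loop.nil s⟩
  | cons a l ih =>
    obtain ⟨b, hb⟩ := h a List.mem_cons_self s
    obtain ⟨s', hs'⟩ := ih (fun a ha => h a (List.mem_cons_of_mem _ ha)) b
    exact ⟨s', Loop.cons hb hs'⟩

theorem eq_of_forall {β : Type*} {f : S → β} (hloop : Loop body l s s')
    (h : ∀ a ∈ l, ∀ s s', body a s s' → f s' = f s) : f s' = f s := by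
  induction hloop with
  | nil => rfl
  | cons hb _ ih =>
    exact (ih fun a ha => h a (List.mem_cons_of_mem _ ha)).trans (h _ List.mem_cons_self _ _ hb)

theorem exists_union {β : Type*} {body : α → Set β → Set β → Prop} {Q : α → Set β → Prop}
    (hl : l.Nodup) (h : ∀ a ∈ l, ∀ b b', body a b b' → ∃ T, Q a T ∧ b' = b ∪ T) {b b' : Set β}
    (hloop : Loop body l b b') :
    ∃ f : α → Set β, (∀ a ∈ l, Q a (f a)) ∧ b' = b ∪ ⋃ a ∈ l, f a := by
  classical
  induction hloop with
  | nil s => exact ⟨fun _ => ∅, by simp, by simp⟩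
  | @cons a l s s' s'' hb _ ih =>
    obtain ⟨T, hT, rfl⟩ := h a List.mem_cons_self _ _ hb
    obtain ⟨hal, hl⟩ := List.nodup_cons.1 hl
    obtain ⟨f, hf, rfl⟩ := ih hl fun a ha => h a (List.mem_cons_of_mem _ ha)
    have hupd {c : α} (hc : c ∈ l) : Function.update f a T c = f c :=
      Function.update_of_ne (ne_of_mem_of_not_mem hc hal) _ _
    refine ⟨Function.update f a T, fun c hc => ?_, ?_⟩
    · rcases List.mem_cons.1 hc with rfl | hc
      · rwa [Function.update_self]
      · rw [hupd hc]
        exact hf c hc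
    · have hunion : ⋃ c ∈ l, Function.update f a T c = ⋃ c ∈ l, f c :=
        Set.iUnion₂_congr fun c hc => hupd hc
      simp only [List.mem_cons, Set.iUnion_iUnion_eq_or_left, Function.update_self, hunion,
        Set.union_assoc]

end Loop

theorem headD_mem_append_singleton {α : Type*} (q : List α) (a : α) : q.headD a ∈ q ++ [a] := by
  cases q <;> simp

namespace RootedCycle

variable {W : Type*} {N : Digraph W} {C : RootedCycle N} {P Q p q : List W} {w : W}

theorem IsSides.headD_mem_lower (hPQ : C.IsSides P Q) (hP : P = p ++ q) :
    q.headD C.hybrid ∈ C.lower := by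
  apply hPQ.mem_lower_of_mem_append_hybrid
  have := headD_mem_append_singleton q C.hybrid
  simp_all

theorem exists_eq_headD_of_mem_lower (hw : w ∈ C.lower) :
    ∃ P Q p q, C.IsSides P Q ∧ P = p ++ q ∧ w = q.headD C.hybrid := by
  have hPQ := C.isSides_inner
  rcases hPQ.mem_lower_iff.1 hw with rfl | hw | hw
  · exact ⟨_, _, C.inner₁, [], hPQ, by simp, rfl⟩
  · obtain ⟨p, q, hP⟩ := List.append_of_mem hw
    exact ⟨_, _, p, w :: q, hPQ, hP, rfl⟩
  · obtain ⟨p, q, hP⟩ := List.append_of_mem hw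
    exact ⟨_, _, p, w :: q, hPQ.symm, hP, rfl⟩

end RootedCycle

namespace PvrNetwork

variable {V : Type u} [Fintype V] {G : SimpleGraph V} {D : PvrNetwork.{u, v} G}
  {C : RootedCycle D.network} {s s' : D.State} {v w : D.Vert}

/-- The values of `ω` and `ω_¬η` at the vertex `w` of the cycle `C` are the clique numbers that they
are meant to be. -/
def IsCorrectAt (C : RootedCycle D.network) (s : D.State) (w : D.Vert) : Prop :=
  s.omega w = (G.induce (D.leavesBelow w)).cliqueNum ∧
    s.omegaNot w = (G.induce (D.leavesBelow w \ D.leavesBelow C.hybrid)).cliqueNum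

theorem IsCorrectAt.congr (hv : IsCorrectAt C s v)
    (hs : s'.omega v = s.omega v ∧ s'.omegaNot v = s.omegaNot v) : IsCorrectAt C s' v := by
  rwa [IsCorrectAt, hs.1, hs.2]

theorem InitInner.active_eq (h : D.InitInner C w s s') : s'.active = s.active := by
  obtain ⟨x, y, -, -, hs⟩ := h
  split_ifs at hs <;> rw [hs]

theorem InitInner.eq_of_ne (h : D.InitInner C w s s') (hv : v ≠ w) :
    (s'.omega v, s'.omegaNot v) = (s.omega v, s.omegaNot v) := by
  classical
  obtain ⟨x, y, -, -, hs⟩ := h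
  split_ifs at hs <;> simp only [hs, Function.update_of_ne hv]

theorem active_eq_of_loop_initInner {l : List D.Vert} (h : Loop (D.InitInner C) l s s') :
    s'.active = s.active :=
  h.eq_of_forall fun _ _ _ _ => InitInner.active_eq

theorem eq_of_loop_initInner {l : List D.Vert} (h : Loop (D.InitInner C) l s s') (hv : v ∉ l) :
    s'.omega v = s.omega v ∧ s'.omegaNot v = s.omegaNot v :=
  Prod.mk_inj.1 <| h.eq_of_forall (f := fun s => (s.omega v, s.omegaNot v))
    fun _ hw _ _ hs => hs.eq_of_ne (ne_of_mem_of_not_mem hw hv).symm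

namespace IsCycleAt

variable {M : PrimeMod G} {B : D.Vert → StrongMod G} {P Q p q : List D.Vert}
  (h : D.IsCycleAt M C B)
include h

theorem ne_inl (hv : v ∈ C.lower) (A : StrongMod G) : v ≠ Sum.inl A := by
  obtain ⟨w, rfl⟩ := (h.mem_lower_iff v).1 hv
  exact Sum.inr_ne_inl

theorem inl_mod_notMem_verts (hv : v ∈ C.lower) : (Sum.inl (B v) : D.Vert) ∉ C.verts := by
  intro hmem
  by_cases hr : (Sum.inl (B v) : D.Vert) = C.root
  · exact (h.covBy hv).lt.ne (Sum.inl.inj (hr.trans h.root_eq))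
  · exact h.ne_inl ⟨hmem, hr⟩ _ rfl

theorem ch_inter_verts (hPQ : C.IsSides P Q) (hP : P = p ++ w :: q) :
    D.ch w ∩ C.verts = {q.headD C.hybrid} := by
  have hq := hPQ.headD_mem_lower (p := p ++ [w]) (q := q) (by simp [hP])
  rw [h.ch_side hPQ hP, Set.insert_inter_of_mem hq.1, Set.singleton_inter_eq_empty.2
    (h.inl_mod_notMem_verts (hPQ.mem_lower (by simp [hP]))), insert_empty_eq]

theorem ch_diff_verts (hPQ : C.IsSides P Q) (hP : P = p ++ w :: q) :
    D.ch w \ C.verts = {Sum.inl (B w)} := by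
  have hq := hPQ.headD_mem_lower (p := p ++ [w]) (q := q) (by simp [hP])
  rw [h.ch_side hPQ hP, Set.insert_sdiff_of_mem _ hq.1, sdiff_eq_left,
    Set.disjoint_singleton_left]
  exact h.inl_mod_notMem_verts (hPQ.mem_lower (by simp [hP]))

theorem exists_initInner (hPQ : C.IsSides P Q) (hw : w ∈ P) (s : D.State) :
    ∃ s', D.InitInner C w s s' := by
  classical
  obtain ⟨p, q, hP⟩ := List.append_of_mem hw
  by_cases hl : D.label w = NLabel.zero
  · exact ⟨_, _, _, h.ch_inter_verts hPQ hP, h.ch_diff_verts hPQ hP, by rw [if_pos hl]⟩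
  · exact ⟨_, _, _, h.ch_inter_verts hPQ hP, h.ch_diff_verts hPQ hP, by rw [if_neg hl]⟩

theorem leavesBelow_hybrid : D.leavesBelow C.hybrid = (B C.hybrid).1 := by
  have := h.leavesBelow_headD C.isSides_inner (q := []) (p := C.inner₁) (by simp)
  rwa [sideSet_nil, Set.empty_union] at this

theorem leavesBelow_headD_diff (hPQ : C.IsSides P Q) (hP : P = p ++ q) :
    D.leavesBelow (q.headD C.hybrid) \ D.leavesBelow C.hybrid = sideSet B q := by
  rw [h.leavesBelow_headD hPQ hP, h.leavesBelow_hybrid, Set.union_sdiff_right]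
  refine sdiff_eq_left.2 (Set.disjoint_left.2 ?_)
  rintro x ⟨w, hw, hx⟩ hxη
  have hwP : w ∈ P := by simp [hP, hw]
  obtain rfl := h.eq_of_mem_mod (hPQ.mem_lower hwP) C.hybrid_mem_lower hx hxη
  exact hPQ.hybrid_notMem hwP

theorem isCorrectAt_headD_iff (hPQ : C.IsSides P Q) (hP : P = p ++ q) :
    IsCorrectAt C s (q.headD C.hybrid) ↔
      s.omega (q.headD C.hybrid) = (G.induce (sideSet B q ∪ (B C.hybrid).1)).cliqueNum ∧
      s.omegaNot (q.headD C.hybrid) = (G.induce (sideSet B q)).cliqueNum := by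
  rw [IsCorrectAt, h.leavesBelow_headD_diff hPQ hP, h.leavesBelow_headD hPQ hP]

theorem isCorrectAt_of_initInner (hPQ : C.IsSides P Q) (hP : P = p ++ w :: q)
    (hs : D.InitInner C w s s')
    (hB : s.omega (Sum.inl (B w)) = (G.induce ((B w).1 : Set V)).cliqueNum)
    (hq : IsCorrectAt C s (q.headD C.hybrid)) : IsCorrectAt C s' w := by
  obtain ⟨x, y, hx, hy, hs⟩ := hs
  rw [h.ch_inter_verts hPQ hP, Set.singleton_eq_singleton_iff] at hx
  rw [h.ch_diff_verts hPQ hP, Set.singleton_eq_singleton_iff] at hy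
  subst hx hy
  obtain ⟨hω, hωNot⟩ := (h.isCorrectAt_headD_iff hPQ (p := p ++ [w]) (by simp [hP])).1 hq
  have hw := hPQ.mem_lower (w := w) (by simp [hP])
  refine (h.isCorrectAt_headD_iff hPQ hP).2 ?_
  rw [List.headD_cons, sideSet_cons, Set.union_right_comm]
  rcases h.label_eq_zero_or_one hw.1 with hl | hl
  · rw [if_pos hl] at hs
    rw [hs, h.cliqueNum_cons_of_label_zero hPQ hP hl subset_rfl,
      h.cliqueNum_cons_of_label_zero hPQ hP hl Set.subset_union_left]
    simp only [Function.update_self, hω, hωNot, hB, Nat.cast_max, and_self]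
  · rw [if_neg (by simp [hl])] at hs
    rw [hs, h.cliqueNum_cons_of_label_one hPQ hP hl subset_rfl,
      h.cliqueNum_cons_of_label_one hPQ hP hl Set.subset_union_left]
    simp only [Function.update_self, hω, hωNot, hB, Nat.cast_add, and_self]

theorem isCorrectAt_of_loop_side (hPQ : C.IsSides P Q) (hP : P = p ++ q)
    (hloop : Loop (D.InitInner C) q.reverse s s')
    (hB : ∀ w ∈ q, s.omega (Sum.inl (B w)) = (G.induce ((B w).1 : Set V)).cliqueNum)
    (hη : IsCorrectAt C s C.hybrid) : ∀ v ∈ q ++ [C.hybrid], IsCorrectAt C s' v := by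
  induction q generalizing p s' with
  | nil =>
    cases hloop
    simpa using hη
  | cons w q ih =>
    rw [List.reverse_cons, Loop.append_iff] at hloop
    obtain ⟨a, hloop, hw⟩ := hloop
    rw [Loop.singleton_iff] at hw
    have hwP : w ∈ P := by simp [hP]
    have hwq : w ∉ q ++ [C.hybrid] := by
      have hnodup := hPQ.nodup_left
      rw [hP] at hnodup
      have := ne_of_mem_of_not_mem hwP hPQ.hybrid_notMem
      simp_all [List.nodup_append]
    have ih := ih (p := p ++ [w]) (by simp [hP]) hloop
      fun w hw => hB w (List.mem_cons_of_mem _ hw)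
    intro v hv
    rcases List.mem_cons.1 hv with rfl | hv
    · refine h.isCorrectAt_of_initInner hPQ hP hw ?_ (ih _ (headD_mem_append_singleton q _))
      rw [(eq_of_loop_initInner hloop ?_).1, hB v List.mem_cons_self]
      exact fun hmem => h.ne_inl (hPQ.mem_lower (by simp_all)) (B v) rfl
    · exact (ih v hv).congr (Prod.mk_inj.1 (hw.eq_of_ne (ne_of_mem_of_not_mem hv hwq)))

theorem isCorrectAt_of_loop
    (hloop : Loop (D.InitInner C) (C.inner₁.reverse ++ C.inner₂.reverse) s s')
    (hB : ∀ A, A ⋖ M.1 → s.omega (Sum.inl A) = (G.induce (A.1 : Set V)).cliqueNum)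
    (hη : IsCorrectAt C s C.hybrid) (hv : v ∈ C.lower) : IsCorrectAt C s' v := by
  have hPQ := C.isSides_inner
  obtain ⟨a, hloop₁, hloop₂⟩ := Loop.append_iff.1 hloop
  have hside₁ := h.isCorrectAt_of_loop_side hPQ (p := []) rfl hloop₁
    (fun w hw => hB _ (h.covBy (hPQ.mem_lower hw))) hη
  have hside₂ := h.isCorrectAt_of_loop_side hPQ.symm (p := []) rfl hloop₂
    (fun w hw => by
      rw [(eq_of_loop_initInner hloop₁ fun hmem =>
        h.ne_inl (hPQ.mem_lower (List.mem_reverse.1 hmem)) _ rfl).1,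
        hB _ (h.covBy (hPQ.symm.mem_lower hw))])
    (hside₁ _ (by simp))
  rcases hPQ.mem_lower_iff.1 hv with rfl | hv₁ | hv₂
  · exact hside₂ _ (by simp)
  · exact (hside₁ v (by simp [hv₁])).congr
      (eq_of_loop_initInner hloop₂ fun hmem => hPQ.notMem_right hv₁ (List.mem_reverse.1 hmem))
  · exact hside₂ v (by simp [hv₂])

end IsCycleAt

end PvrNetwork

end Initialization

section ActiveVertices

namespace PvrNetwork

variable {V : Type u} [Fintype V] {G : SimpleGraph V} {D : PvrNetwork.{u, v} G}
  {B : D.Vert → StrongMod G}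

variable (D) in
/-- The active children of the vertex `w` with children `x` and `y` are chosen as the algorithm does
if the values `m` and `n` are compared: all children if `w` has label `1`, and exactly one, with the
larger value, if `w` has label `0`. -/
def ActivatesMax (a : Set D.Vert) (w x y : D.Vert) (m n : ℤ) : Prop :=
  (D.label w = NLabel.zero → (n ≤ m ∧ D.ch w ∩ a = {x}) ∨ (m ≤ n ∧ D.ch w ∩ a = {y})) ∧
    (D.label w = NLabel.one → D.ch w ⊆ a)

namespace IsCycleAt

variable {M : PrimeMod G} {C : RootedCycle D.network} {P Q p q : List D.Vert} {w : D.Vert}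
  {a : Set D.Vert} (h : D.IsCycleAt M C B) (hPQ : C.IsSides P Q)
include h

theorem isMaxCliqueIn_hybrid (hη : Sum.inl (B C.hybrid) ∈ a)
    (hmod : IsMaxCliqueIn G (B C.hybrid).1 (D.reach a (Sum.inl (B C.hybrid)))) :
    IsMaxCliqueIn G (B C.hybrid).1 (D.reach a C.hybrid) := by
  rwa [h.reach_of_mem C.hybrid_mem_lower.1, h.ch_hybrid,
    Set.inter_eq_left.2 (Set.singleton_subset_iff.2 hη), Set.biUnion_singleton]

include hPQ

theorem isMaxCliqueIn_root_of_label_zero (hr : D.label C.root = NLabel.zero)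
    (hroot : D.ch C.root ∩ a = {P.headD C.hybrid})
    (hside : IsMaxCliqueIn G (sideSet B P ∪ (B C.hybrid).1) (D.reach a (P.headD C.hybrid)))
    (hmax : (G.induce (sideSet B Q ∪ (B C.hybrid).1)).cliqueNum ≤
      (G.induce (sideSet B P ∪ (B C.hybrid).1)).cliqueNum) :
    IsMaxCliqueIn G M.1.1 (D.reach a C.root) := by
  rw [h.reach_of_mem C.root_mem_verts, hroot, Set.biUnion_singleton]
  refine hside.superset ?_ ?_
  · rw [h.coe_eq_union hPQ]
    exact Set.subset_union_left
  · rw [h.cliqueNum_root_of_label_zero hPQ hr, max_eq_left hmax]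

theorem isMaxCliqueIn_root_of_sides (hr : D.label C.root = NLabel.one) (hroot : D.ch C.root ⊆ a)
    (hsideP : IsMaxCliqueIn G (sideSet B P) (D.reach a (P.headD C.hybrid)))
    (hsideQ : IsMaxCliqueIn G (sideSet B Q) (D.reach a (Q.headD C.hybrid)))
    (hmax : (G.induce (M.1.1 : Set V)).cliqueNum ≤
      (G.induce (sideSet B P)).cliqueNum + (G.induce (sideSet B Q)).cliqueNum) :
    IsMaxCliqueIn G M.1.1 (D.reach a C.root) := by
  have hcomplete := h.isCompleteBetween_sides hPQ hr
  rw [h.reach_of_mem C.root_mem_verts, Set.inter_eq_left.2 hroot, h.ch_root hPQ, Set.biUnion_pair]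
  refine (hsideP.union hsideQ hcomplete).superset ?_ ?_
  · rw [h.coe_eq_union hPQ]
    exact Set.union_subset_union Set.subset_union_left Set.subset_union_left
  · rwa [cliqueNum_induce_union_of_isCompleteBetween hcomplete]

theorem isMaxCliqueIn_cons {S : Set V} (hP : P = p ++ w :: q)
    (hS : S ⊆ sideSet B q ∪ (B C.hybrid).1)
    (hq : IsMaxCliqueIn G S (D.reach a (q.headD C.hybrid)))
    (hmod : IsMaxCliqueIn G (B w).1 (D.reach a (Sum.inl (B w))))
    (hact : D.ActivatesMax a w (q.headD C.hybrid) (Sum.inl (B w)) (G.induce S).cliqueNum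
      (G.induce ((B w).1 : Set V)).cliqueNum) :
    IsMaxCliqueIn G (S ∪ (B w).1) (D.reach a w) := by
  have hw : w ∈ C.verts := (hPQ.mem_lower (w := w) (by simp [hP])).1
  rw [h.reach_of_mem hw]
  rcases h.label_eq_zero_or_one hw with hl | hl
  · have hnum := h.cliqueNum_cons_of_label_zero hPQ hP hl hS
    rcases hact.1 hl with ⟨hle, hch⟩ | ⟨hle, hch⟩ <;> rw [hch, Set.biUnion_singleton]
    · exact hq.superset Set.subset_union_left (by omega)
    · exact hmod.superset Set.subset_union_right (by omega)
  · rw [Set.inter_eq_left.2 (hact.2 hl), h.ch_side hPQ hP, Set.biUnion_pair]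
    exact hq.union hmod fun _ ha _ hb => h.isCompleteBetween_mod hPQ hP hl (hS ha) hb

variable (hmods : ∀ A, A ⋖ M.1 → IsMaxCliqueIn G A.1 (D.reach a (Sum.inl A)))
include hmods

theorem isMaxCliqueIn_side_union_hybrid (hη : Sum.inl (B C.hybrid) ∈ a)
    (hact : ∀ p w q, P = p ++ w :: q → D.ActivatesMax a w (q.headD C.hybrid) (Sum.inl (B w))
      (G.induce (sideSet B q ∪ (B C.hybrid).1)).cliqueNum
      (G.induce ((B w).1 : Set V)).cliqueNum) (hP : P = p ++ q) :
    IsMaxCliqueIn G (sideSet B q ∪ (B C.hybrid).1) (D.reach a (q.headD C.hybrid)) := by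
  induction q generalizing p with
  | nil =>
    rw [sideSet_nil, Set.empty_union]
    exact h.isMaxCliqueIn_hybrid hη (hmods _ (h.covBy C.hybrid_mem_lower))
  | cons w q ih =>
    rw [sideSet_cons, Set.union_right_comm]
    exact h.isMaxCliqueIn_cons hPQ hP subset_rfl (ih (p := p ++ [w]) (by simp [hP]))
      (hmods _ (h.covBy (hPQ.mem_lower (by simp [hP])))) (hact p w q hP)

theorem isMaxCliqueIn_side (hlast : ∀ p w, P = p ++ [w] → D.ch w ∩ a = {Sum.inl (B w)})
    (hact : ∀ p w q, P = p ++ w :: q → q ≠ [] →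
      D.ActivatesMax a w (q.headD C.hybrid) (Sum.inl (B w))
        (G.induce (sideSet B q)).cliqueNum (G.induce ((B w).1 : Set V)).cliqueNum)
    (hP : P = p ++ q) (hq : q ≠ []) :
    IsMaxCliqueIn G (sideSet B q) (D.reach a (q.headD C.hybrid)) := by
  induction q generalizing p with
  | nil => exact absurd rfl hq
  | cons w q ih =>
    have hw := hPQ.mem_lower (w := w) (by simp [hP])
    have hmod := hmods _ (h.covBy hw)
    rw [sideSet_cons]
    by_cases hqn : q = []
    · subst hqn
      rwa [sideSet_nil, Set.empty_union, List.headD_cons, h.reach_of_mem hw.1, hlast p w hP,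
        Set.biUnion_singleton]
    · exact h.isMaxCliqueIn_cons hPQ hP Set.subset_union_left
        (ih (p := p ++ [w]) (by simp [hP]) hqn) hmod (hact p w q hP hqn)

theorem exists_isMaxCliqueIn_oneSet (hlower : C.lower ⊆ a)
    (hone : ∀ w ∈ P, Sum.inl (B w) ∈ a ↔ D.label w = NLabel.one) (hP : P = p ++ q) :
    ∃ R, IsMaxCliqueIn G (D.oneSet B q) R ∧
      D.reach a (q.headD C.hybrid) = R ∪ D.reach a C.hybrid := by
  induction q generalizing p with
  | nil => exact ⟨∅, by simpa [oneSet] using isMaxCliqueIn_empty, by simp⟩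
  | cons w q ih =>
    have hP' : P = (p ++ [w]) ++ q := by simp [hP]
    have hwP : w ∈ P := by simp [hP]
    have hw := hPQ.mem_lower hwP
    have hqa := hlower (hPQ.headD_mem_lower hP')
    obtain ⟨R, hR, hreach⟩ := ih hP'
    rw [List.headD_cons, h.reach_of_mem hw.1, h.ch_side hPQ hP, Set.insert_inter_of_mem hqa]
    by_cases hl : D.label w = NLabel.one
    · rw [Set.inter_eq_left.2 (Set.singleton_subset_iff.2 ((hone w hwP).2 hl)), Set.biUnion_pair,
        hreach, D.oneSet_cons_of_eq hl, Set.union_right_comm]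
      refine ⟨_, hR.union (hmods _ (h.covBy hw)) fun u hu b hb => ?_, rfl⟩
      exact h.isCompleteBetween_mod hPQ hP hl (Or.inl (D.oneSet_subset_sideSet q hu)) hb
    · rw [Set.singleton_inter_eq_empty.2 fun hwa => hl ((hone w hwP).1 hwa), insert_empty_eq,
        Set.biUnion_singleton, D.oneSet_cons_of_ne hl]
      exact ⟨R, hR, hreach⟩

theorem isMaxCliqueIn_root_of_oneSets (hr : D.label C.root = NLabel.one) (hlower : C.lower ⊆ a)
    (hη : Sum.inl (B C.hybrid) ∈ a)
    (hone : ∀ w, w ∈ P ∨ w ∈ Q → (Sum.inl (B w) ∈ a ↔ D.label w = NLabel.one))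
    (hmax : (G.induce (M.1.1 : Set V)).cliqueNum ≤
      (G.induce (D.oneSet B P)).cliqueNum + (G.induce (D.oneSet B Q)).cliqueNum +
        (G.induce ((B C.hybrid).1 : Set V)).cliqueNum) :
    IsMaxCliqueIn G M.1.1 (D.reach a C.root) := by
  obtain ⟨RP, hRP, hreachP⟩ := h.exists_isMaxCliqueIn_oneSet hPQ hmods hlower
    (fun w hw => hone w (Or.inl hw)) (p := []) rfl
  obtain ⟨RQ, hRQ, hreachQ⟩ := h.exists_isMaxCliqueIn_oneSet hPQ.symm hmods hlower
    (fun w hw => hone w (Or.inr hw)) (p := []) rfl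
  have hroot : D.ch C.root ⊆ a := by
    rw [h.ch_root hPQ]
    exact Set.pair_subset (hlower (hPQ.headD_mem_lower (p := []) rfl))
      (hlower (hPQ.symm.headD_mem_lower (p := []) rfl))
  have hsides := h.isCompleteBetween_oneSets hPQ hr
  have hhybrid := h.isCompleteBetween_oneSets_hybrid hPQ
  rw [h.reach_of_mem C.root_mem_verts, Set.inter_eq_left.2 hroot, h.ch_root hPQ, Set.biUnion_pair,
    hreachP, hreachQ, ← Set.union_union_distrib_right]
  refine ((hRP.union hRQ hsides).union (h.isMaxCliqueIn_hybrid hη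
    (hmods _ (h.covBy C.hybrid_mem_lower))) hhybrid).superset ?_ ?_
  · rw [h.coe_eq_union hPQ]
    refine Set.union_subset (Set.union_subset_union ?_ ?_) fun x hx => Or.inl (Or.inr hx)
    exacts [(D.oneSet_subset_sideSet P).trans Set.subset_union_left,
      (D.oneSet_subset_sideSet Q).trans Set.subset_union_left]
  · rwa [cliqueNum_induce_union_of_isCompleteBetween hhybrid,
      cliqueNum_induce_union_of_isCompleteBetween hsides]

end IsCycleAt

end PvrNetwork

end ActiveVertices

section Activation

namespace RootedCycle

variable {W : Type*} {N : Digraph W} {C : RootedCycle N} {w : W}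

theorem mem_flatMap_reverse_inner :
    w ∈ [C.inner₁, C.inner₂].flatMap List.reverse ↔ w ∈ C.inner₁ ∨ w ∈ C.inner₂ := by
  simp

theorem nodup_flatMap_reverse_inner : ([C.inner₁, C.inner₂].flatMap List.reverse).Nodup := by
  have hPQ := C.isSides_inner
  simp only [List.flatMap_cons, List.flatMap_nil, List.append_nil, List.nodup_append,
    List.nodup_reverse, List.mem_reverse]
  exact ⟨hPQ.nodup_left, hPQ.symm.nodup_left, fun x hx y hy hxy => hPQ.notMem_right hx (hxy ▸ hy)⟩

theorem exists_isSides_of_mem_inner (hw : w ∈ C.inner₁ ∨ w ∈ C.inner₂) :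
    ∃ P Q p q, C.IsSides P Q ∧ P = p ++ w :: q := by
  rcases hw with hw | hw <;> obtain ⟨p, q, hP⟩ := List.append_of_mem hw
  exacts [⟨_, _, p, q, C.isSides_inner, hP⟩, ⟨_, _, p, q, C.isSides_inner.symm, hP⟩]

theorem IsSides.mem_inner {P Q : List W} (hPQ : C.IsSides P Q) (hw : w ∈ P) :
    w ∈ C.inner₁ ∨ w ∈ C.inner₂ := by
  rcases hPQ with ⟨rfl, -⟩ | ⟨rfl, -⟩
  exacts [Or.inl hw, Or.inr hw]

theorem mem_lower_of_mem_inner (hw : w ∈ C.inner₁ ∨ w ∈ C.inner₂) : w ∈ C.lower :=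
  hw.elim C.isSides_inner.mem_lower C.isSides_inner.symm.mem_lower

end RootedCycle

namespace PvrNetwork

variable {V : Type u} [Fintype V] {G : SimpleGraph V} {D : PvrNetwork.{u, v} G}
  {B : D.Vert → StrongMod G}

variable (D) in
/-- The vertices that may be activated during the visit of `M`: the children of `M` in the modular
decomposition tree and, if `M` is prime, the vertices of its cycle other than the root. -/
def actZone (M : StrongMod G) : Set D.Vert :=
  {v | (∃ A : StrongMod G, A ⋖ M ∧ v = Sum.inl A) ∨ ∃ p, v = Sum.inr p ∧ p.1.1 = M}

variable (D) in
/-- `T` consists of the children of the vertex `w` of `C` that the algorithm activates while it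
builds a clique without leaves below the hybrid-vertex. -/
def IsChoiceNot (C : RootedCycle D.network) (ω ωNot : D.Vert → ℤ) (w : D.Vert) (T : Set D.Vert) :
    Prop :=
  ∃ x y, D.ch w ∩ C.verts = {x} ∧ D.ch w \ C.verts = {y} ∧
    (D.label w = NLabel.zero → (ω y ≤ ωNot x ∧ T = {x}) ∨ (ωNot x ≤ ω y ∧ T = {y})) ∧
    (D.label w = NLabel.one → T = {x, y})

theorem IsChoiceNot.subset_ch {C : RootedCycle D.network} {ω ωNot : D.Vert → ℤ} {w : D.Vert}
    {T : Set D.Vert} (hlabel : D.label w = NLabel.zero ∨ D.label w = NLabel.one)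
    (hT : D.IsChoiceNot C ω ωNot w T) : T ⊆ D.ch w := by
  obtain ⟨x, y, hx, hy, hzero, hone⟩ := hT
  have hxw : {x} ⊆ D.ch w := hx ▸ Set.inter_subset_left
  have hyw : {y} ⊆ D.ch w := hy ▸ Set.sdiff_subset
  rcases hlabel with hlabel | hlabel
  · rcases hzero hlabel with ⟨-, rfl⟩ | ⟨-, rfl⟩
    exacts [hxw, hyw]
  · exact hone hlabel ▸ Set.union_subset hxw hyw

theorem ActivatesMax.congr {a a' : Set D.Vert} {w x y : D.Vert} {m n : ℤ}
    (hact : D.ActivatesMax a w x y m n) (hch : D.ch w ∩ a' = D.ch w ∩ a) :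
    D.ActivatesMax a' w x y m n := by
  rwa [ActivatesMax, ← Set.inter_eq_left, hch, Set.inter_eq_left]

namespace IsCycleAt

variable {M : PrimeMod G} {C : RootedCycle D.network} {P Q p q : List D.Vert} {u w z : D.Vert}
  {ω ωNot : D.Vert → ℤ} {a b b' : Set D.Vert} {α β : ℤ} (h : D.IsCycleAt M C B)
include h

theorem lower_subset_actZone : C.lower ⊆ D.actZone M.1 := by
  intro w hw
  obtain ⟨w, rfl⟩ := (h.mem_lower_iff w).1 hw
  exact Or.inr ⟨_, rfl, rfl⟩

theorem inl_mod_mem_actZone (hw : w ∈ C.lower) : Sum.inl (B w) ∈ D.actZone M.1 :=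
  Or.inl ⟨_, h.covBy hw, rfl⟩

theorem mem_lower_or_eq_inl_mod (hw : w ∈ C.verts) (hz : z ∈ D.ch w) :
    z ∈ C.lower ∨ (w ∈ C.lower ∧ z = Sum.inl (B w)) := by
  have hPQ := C.isSides_inner
  by_cases hwr : w = C.root
  · rw [hwr, h.ch_root hPQ] at hz
    rcases hz with rfl | rfl
    exacts [Or.inl (hPQ.headD_mem_lower (p := []) rfl),
      Or.inl (hPQ.symm.headD_mem_lower (p := []) rfl)]
  have hwl : w ∈ C.lower := ⟨hw, hwr⟩
  rcases hPQ.mem_lower_iff.1 hwl with rfl | hwi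
  · rw [h.ch_hybrid] at hz
    exact Or.inr ⟨hwl, hz⟩
  · obtain ⟨P, Q, p, q, hPQ, hP⟩ := RootedCycle.exists_isSides_of_mem_inner hwi
    rw [h.ch_side hPQ hP] at hz
    rcases hz with rfl | rfl
    exacts [Or.inl (hPQ.headD_mem_lower (p := p ++ [w]) (by simp [hP])), Or.inr ⟨hwl, rfl⟩]

theorem ch_subset_actZone (hw : w ∈ C.verts) : D.ch w ⊆ D.actZone M.1 := by
  intro z hz
  rcases h.mem_lower_or_eq_inl_mod hw hz with hzl | ⟨hwl, rfl⟩
  exacts [h.lower_subset_actZone hzl, h.inl_mod_mem_actZone hwl]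

theorem eq_of_mem_ch (hu : u ∈ C.verts) (hw : w ∈ C.verts) (hzu : z ∈ D.ch u) (hzw : z ∈ D.ch w)
    (hz : z ≠ C.hybrid) : u = w := by
  rcases h.mem_lower_or_eq_inl_mod hu hzu with hzl | ⟨hul, rfl⟩
  · exact h.hasPendants.parents_subsingleton hzl hz hzu hzw
  · rcases h.mem_lower_or_eq_inl_mod hw hzw with hzl | ⟨hwl, hz⟩
    exacts [absurd hzl.1 (h.inl_mod_notMem_verts hul), h.bijOn.injOn hul hwl (Sum.inl.inj hz)]

theorem hybrid_mem_ch_iff (hPQ : C.IsSides P Q) (hP : P = p ++ w :: q) :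
    C.hybrid ∈ D.ch w ↔ q = [] := by
  refine (h.hasPendants.adj_hybrid_iff hPQ).trans ⟨?_, ?_⟩
  · rintro (⟨p', hp'⟩ | ⟨p', hp'⟩)
    · exact (eq_of_nodup_append_cons hPQ.nodup_left hP hp').2
    · exact absurd (by simp [hp']) (hPQ.notMem_right (w := w) (by simp [hP]))
  · rintro rfl
    exact Or.inl ⟨p, hP⟩

theorem mem_inner_of_hybrid_mem_ch (hw : C.hybrid ∈ D.ch w) : w ∈ C.inner₁ ∨ w ∈ C.inner₂ :=
  ((h.hasPendants.adj_hybrid_iff C.isSides_inner).1 hw).imp (fun ⟨_, hp⟩ => by simp [hp])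
    fun ⟨_, hp⟩ => by simp [hp]

theorem hybrid_notMem_ch_root : C.hybrid ∉ D.ch C.root := fun hmem =>
  (RootedCycle.mem_lower_of_mem_inner (h.mem_inner_of_hybrid_mem_ch hmem)).2 rfl

theorem eq_of_hybrid_mem_ch (hPQ : C.IsSides P Q) (hu : u ∈ P ++ [C.hybrid])
    (hw : w ∈ P ++ [C.hybrid]) (hηu : C.hybrid ∈ D.ch u) (hηw : C.hybrid ∈ D.ch w) : u = w := by
  have eq_append {w : D.Vert} (hw : w ∈ P ++ [C.hybrid]) (hηw : C.hybrid ∈ D.ch w) :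
      ∃ p, P = p ++ [w] := by
    refine ((h.hasPendants.adj_hybrid_iff hPQ).1 hηw).resolve_right fun ⟨p, hp⟩ => ?_
    have hwQ : w ∈ Q := by simp [hp]
    rcases List.mem_append.1 hw with hwP | hwη
    · exact hPQ.notMem_right hwP hwQ
    · exact hPQ.symm.hybrid_notMem (List.mem_singleton.1 hwη ▸ hwQ)
  obtain ⟨p, hp⟩ := eq_append hu hηu
  obtain ⟨q, hq⟩ := eq_append hw hηw
  simpa using congrArg List.getLast? (hp.symm.trans hq)

section OwnChildren

variable {l : List D.Vert} {F : D.Vert → Set D.Vert} {R : Set D.Vert} (hR : R ⊆ D.ch C.root)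
  (hl : ∀ u ∈ l, u ∈ C.lower) (hF : ∀ u ∈ l, F u ⊆ D.ch u)
include hR hl hF

theorem union_biUnion_subset_actZone : R ∪ ⋃ u ∈ l, F u ⊆ D.actZone M.1 :=
  Set.union_subset (hR.trans (h.ch_subset_actZone C.root_mem_verts)) <| Set.iUnion₂_subset
    fun u hu => (hF u hu).trans (h.ch_subset_actZone (hl u hu).1)

theorem ch_inter_union_biUnion (hη : ∀ u ∈ l, C.hybrid ∈ F u → C.hybrid ∈ D.ch w → u = w)
    (hw : w ∈ l) : D.ch w ∩ (R ∪ ⋃ u ∈ l, F u) = F w := by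
  refine Set.Subset.antisymm ?_ fun z hz =>
    ⟨hF w hw hz, Or.inr (Set.mem_iUnion₂.2 ⟨w, hw, hz⟩)⟩
  rintro z ⟨hzw, hzR | hzF⟩
  · have hzη : z ≠ C.hybrid := ne_of_mem_of_not_mem (hR hzR) h.hybrid_notMem_ch_root
    exact absurd (h.eq_of_mem_ch (hl w hw).1 C.root_mem_verts hzw (hR hzR) hzη) (hl w hw).2
  · obtain ⟨u, hu, hzu⟩ := Set.mem_iUnion₂.1 hzF
    by_cases hzη : z = C.hybrid
    · subst hzη
      exact hη u hu hzu hzw ▸ hzu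
    · exact h.eq_of_mem_ch (hl u hu).1 (hl w hw).1 (hF u hu hzu) hzw hzη ▸ hzu

theorem ch_root_inter_union_biUnion : D.ch C.root ∩ (R ∪ ⋃ u ∈ l, F u) = R := by
  refine Set.Subset.antisymm ?_ fun z hz => ⟨hR hz, Or.inl hz⟩
  rintro z ⟨hz, hzR | hzF⟩
  · exact hzR
  · obtain ⟨u, hu, hzu⟩ := Set.mem_iUnion₂.1 hzF
    have hzη : z ≠ C.hybrid := ne_of_mem_of_not_mem hz h.hybrid_notMem_ch_root
    exact absurd (h.eq_of_mem_ch (hl u hu).1 C.root_mem_verts (hF u hu hzu) hz hzη) (hl u hu).2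

end OwnChildren

theorem exists_union_of_activate_zero (hPQ : C.IsSides P Q)
    (hact : D.Activate C [P] ω ωNot α β NLabel.zero (b ∪ {P.headD C.hybrid}) b') :
    ∃ T ⊆ D.actZone M.1, b' = b ∪ T ∧ D.ch C.root ∩ T = {P.headD C.hybrid} ∧
      Sum.inl (B C.hybrid) ∈ T ∧
      ∀ p w q, P = p ++ w :: q → D.ActivatesMax T w (q.headD C.hybrid) (Sum.inl (B w))
        (ω (q.headD C.hybrid)) (ω (Sum.inl (B w))) := by
  classical
  rw [Activate, if_pos rfl, List.flatMap_cons, List.flatMap_nil, List.append_nil] at hact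
  obtain ⟨F, hF, rfl⟩ := Loop.exists_union (Q := fun u T => T ⊆ D.ch u ∧
      (D.label u = NLabel.zero → ∃ x ∈ D.ch u, (∀ z ∈ D.ch u, ω z ≤ ω x) ∧ T = {x}) ∧
      (D.label u = NLabel.one → T = D.ch u))
    (List.nodup_reverse.2 (List.nodup_cons.1 hPQ.nodup_path).2) (fun u _ b b' hbody => by
      split_ifs at hbody with hu
      · obtain ⟨x, hx, hmax, rfl⟩ := hbody
        exact ⟨{x}, ⟨Set.singleton_subset_iff.2 hx, fun _ => ⟨x, hx, hmax, rfl⟩, by simp [hu]⟩, rfl⟩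
      · exact ⟨D.ch u, ⟨subset_rfl, fun hu' => absurd hu' hu, fun _ => rfl⟩, hbody⟩) hact
  simp only [List.mem_reverse] at hF ⊢
  have hR : {P.headD C.hybrid} ⊆ D.ch C.root := by simp [h.ch_root hPQ]
  have hl (u : D.Vert) (hu : u ∈ P ++ [C.hybrid]) : u ∈ C.lower :=
    hPQ.mem_lower_of_mem_append_hybrid hu
  have hFch (u : D.Vert) (hu : u ∈ P ++ [C.hybrid]) : F u ⊆ D.ch u := (hF u hu).1
  have hch {w : D.Vert} (hw : w ∈ P ++ [C.hybrid]) := h.ch_inter_union_biUnion hR hl hFch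
    (fun u hu hηu hηw => h.eq_of_hybrid_mem_ch hPQ hu hw (hFch u hu hηu) hηw) hw
  refine ⟨_, h.union_biUnion_subset_actZone hR hl hFch, Set.union_assoc ..,
    h.ch_root_inter_union_biUnion hR hl hFch, Or.inr ?_, fun p w q hP => ?_⟩
  · have hη : C.hybrid ∈ P ++ [C.hybrid] := by simp
    obtain ⟨-, hzero, hone⟩ := hF C.hybrid hη
    rw [h.ch_hybrid] at hzero hone
    refine Set.mem_iUnion₂.2 ⟨C.hybrid, hη, ?_⟩
    rcases h.label_eq_zero_or_one C.hybrid_mem_lower.1 with hlabel | hlabel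
    · obtain ⟨x, rfl, -, hx⟩ := hzero hlabel
      simp [hx]
    · simp [hone hlabel]
  · have hw : w ∈ P ++ [C.hybrid] := by simp [hP]
    obtain ⟨-, hzero, hone⟩ := hF w hw
    refine ⟨fun hlabel => ?_, fun hlabel => ?_⟩
    · obtain ⟨x, hx, hmax, hFx⟩ := hzero hlabel
      rw [hch hw, hFx]
      rw [h.ch_side hPQ hP] at hx hmax
      rcases hx with rfl | rfl
      exacts [Or.inl ⟨hmax _ (by simp), rfl⟩, Or.inr ⟨hmax _ (by simp), rfl⟩]
    · rw [← Set.inter_eq_left, hch hw, hone hlabel]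

omit h in
theorem exists_isChoiceNot_of_activate_le (hαβ : α ≤ β)
    (hact : D.Activate C [C.inner₁, C.inner₂] ω ωNot α β NLabel.one b b') :
    ∃ f : D.Vert → Set D.Vert,
      (∀ w, (w ∈ C.inner₁ ∨ w ∈ C.inner₂) ∧ C.hybrid ∉ D.ch w → D.IsChoiceNot C ω ωNot w (f w)) ∧
      b' = b ∪ (D.ch C.root ∪ ((⋃ w ∈ {w | C.hybrid ∈ D.ch w}, D.ch w \ {C.hybrid}) ∪
        ⋃ w ∈ {w | (w ∈ C.inner₁ ∨ w ∈ C.inner₂) ∧ C.hybrid ∉ D.ch w}, f w)) := by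
  classical
  rw [Activate, if_neg (by simp), if_pos hαβ] at hact
  obtain ⟨w₁, w₂, -, hpar, hact⟩ := hact
  obtain ⟨f, hf, rfl⟩ := Loop.exists_union (Q := fun w T => D.IsChoiceNot C ω ωNot w T)
    (RootedCycle.nodup_flatMap_reverse_inner.filter _) (fun w _ b b' hbody => by
      obtain ⟨x, y, hx, hy, hbody⟩ := hbody
      split_ifs at hbody with hw
      · rcases hbody with ⟨hle, rfl⟩ | ⟨hle, rfl⟩
        exacts [⟨{x}, ⟨x, y, hx, hy, fun _ => Or.inl ⟨hle, rfl⟩, by simp [hw]⟩, rfl⟩,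
          ⟨{y}, ⟨x, y, hx, hy, fun _ => Or.inr ⟨hle, rfl⟩, by simp [hw]⟩, rfl⟩]
      · exact ⟨{x, y}, ⟨x, y, hx, hy, fun hw' => absurd hw' hw, fun _ => rfl⟩, hbody⟩) hact
  have hparents : {w | C.hybrid ∈ D.ch w} = {w₁, w₂} := hpar
  have hybrid_mem_ch (w : D.Vert) : C.hybrid ∈ D.ch w ↔ w = w₁ ∨ w = w₂ := Set.ext_iff.1 hpar w
  have mem_filter (w : D.Vert) :
      w ∈ ([C.inner₁, C.inner₂].flatMap List.reverse).filter (fun w => w ≠ w₁ ∧ w ≠ w₂) ↔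
        (w ∈ C.inner₁ ∨ w ∈ C.inner₂) ∧ C.hybrid ∉ D.ch w := by
    simp only [List.mem_filter, RootedCycle.mem_flatMap_reverse_inner, decide_eq_true_eq,
      hybrid_mem_ch, ne_eq, not_or]
  simp only [mem_filter] at hf ⊢
  refine ⟨f, hf, ?_⟩
  rw [hparents, Set.biUnion_pair]
  simp only [Set.union_assoc, Set.mem_ofPred_eq]

theorem exists_biUnion_of_activate_le (hαβ : α ≤ β)
    (hact : D.Activate C [C.inner₁, C.inner₂] ω ωNot α β NLabel.one b b') :
    ∃ F : D.Vert → Set D.Vert,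
      (∀ w, w ∈ C.inner₁ ∨ w ∈ C.inner₂ → F w ⊆ D.ch w \ {C.hybrid}) ∧
      (∀ w, C.hybrid ∈ D.ch w → F w = D.ch w \ {C.hybrid}) ∧
      (∀ w, w ∈ C.inner₁ ∨ w ∈ C.inner₂ → C.hybrid ∉ D.ch w → D.IsChoiceNot C ω ωNot w (F w)) ∧
      b' = b ∪ (D.ch C.root ∪ ⋃ w ∈ [C.inner₁, C.inner₂].flatMap List.reverse, F w) := by
  classical
  obtain ⟨f, hf, rfl⟩ := exists_isChoiceNot_of_activate_le hαβ hact
  refine ⟨fun w => if C.hybrid ∈ D.ch w then D.ch w \ {C.hybrid} else f w, fun w hw => ?_,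
    fun w hw => if_pos hw, fun w hw hη => ?_, ?_⟩
  · by_cases hη : C.hybrid ∈ D.ch w
    · exact (if_pos hη).subset
    · have hfw : f w ⊆ D.ch w := (hf w ⟨hw, hη⟩).subset_ch
        (h.label_eq_zero_or_one (RootedCycle.mem_lower_of_mem_inner hw).1)
      exact (if_neg hη).subset.trans (Set.subset_sdiff_singleton hfw fun hmem => hη (hfw hmem))
  · simpa only [if_neg hη] using hf w ⟨hw, hη⟩
  · congr 2
    ext z
    simp only [Set.mem_union, Set.mem_iUnion₂, RootedCycle.mem_flatMap_reverse_inner,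
      Set.mem_ofPred_eq]
    constructor
    · rintro (⟨w, hη, hz⟩ | ⟨w, ⟨hw, hη⟩, hz⟩)
      exacts [⟨w, h.mem_inner_of_hybrid_mem_ch hη, by rwa [if_pos hη]⟩,
        ⟨w, hw, by rwa [if_neg hη]⟩]
    · rintro ⟨w, hw, hz⟩
      split_ifs at hz with hη
      exacts [Or.inl ⟨w, hη, hz⟩, Or.inr ⟨w, ⟨hw, hη⟩, hz⟩]

theorem exists_union_of_activate_le (hαβ : α ≤ β)
    (hact : D.Activate C [C.inner₁, C.inner₂] ω ωNot α β NLabel.one b b') :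
    ∃ T ⊆ D.actZone M.1, b' = b ∪ T ∧ D.ch C.root ∩ T = D.ch C.root ∧
      ∀ {P Q}, C.IsSides P Q →
        (∀ p w, P = p ++ [w] → D.ch w ∩ T = {Sum.inl (B w)}) ∧
        ∀ p w q, P = p ++ w :: q → q ≠ [] →
          D.ActivatesMax T w (q.headD C.hybrid) (Sum.inl (B w))
            (ωNot (q.headD C.hybrid)) (ω (Sum.inl (B w))) := by
  obtain ⟨F, hFsub, hFη, hF, rfl⟩ := h.exists_biUnion_of_activate_le hαβ hact
  have hFch (w : D.Vert) (hw : w ∈ [C.inner₁, C.inner₂].flatMap List.reverse) : F w ⊆ D.ch w :=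
    (hFsub w (RootedCycle.mem_flatMap_reverse_inner.1 hw)).trans Set.sdiff_subset
  have hl (w : D.Vert) (hw : w ∈ [C.inner₁, C.inner₂].flatMap List.reverse) : w ∈ C.lower :=
    RootedCycle.mem_lower_of_mem_inner (RootedCycle.mem_flatMap_reverse_inner.1 hw)
  have hFside {P Q p w q} (hPQ : C.IsSides P Q) (hP : P = p ++ w :: q) (hq : q ≠ []) :
      (D.label w = NLabel.zero →
        (ω (Sum.inl (B w)) ≤ ωNot (q.headD C.hybrid) ∧ F w = {q.headD C.hybrid}) ∨
          (ωNot (q.headD C.hybrid) ≤ ω (Sum.inl (B w)) ∧ F w = {Sum.inl (B w)})) ∧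
        (D.label w = NLabel.one → F w = D.ch w) := by
    obtain ⟨x, y, hx, hy, hzero, hone⟩ := hF w (hPQ.mem_inner (by simp [hP]))
      fun hη => hq ((h.hybrid_mem_ch_iff hPQ hP).1 hη)
    rw [h.ch_inter_verts hPQ hP, Set.singleton_eq_singleton_iff] at hx
    rw [h.ch_diff_verts hPQ hP, Set.singleton_eq_singleton_iff] at hy
    subst hx hy
    exact ⟨hzero, h.ch_side hPQ hP ▸ hone⟩
  have hch {w : D.Vert} (hw : w ∈ C.inner₁ ∨ w ∈ C.inner₂) := h.ch_inter_union_biUnion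
    (w := w) subset_rfl hl hFch
    (fun u hu hη => absurd rfl (hFsub u (RootedCycle.mem_flatMap_reverse_inner.1 hu) hη).2)
    (RootedCycle.mem_flatMap_reverse_inner.2 hw)
  refine ⟨_, h.union_biUnion_subset_actZone subset_rfl hl hFch, rfl,
    h.ch_root_inter_union_biUnion subset_rfl hl hFch, fun {P Q} hPQ => ⟨?_, ?_⟩⟩
  · rintro p w hP
    have hη : (Sum.inl (B w) : D.Vert) ≠ C.hybrid := (h.ne_inl C.hybrid_mem_lower _).symm
    rw [hch (hPQ.mem_inner (by simp [hP])), hFη w ((h.hybrid_mem_ch_iff hPQ hP).2 rfl),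
      h.ch_side hPQ hP, List.headD_nil, Set.insert_sdiff_of_mem _ (Set.mem_singleton _),
      sdiff_eq_left, Set.disjoint_singleton]
    exact hη
  · intro p w q hP hq
    obtain ⟨hzero, hone⟩ := hFside hPQ hP hq
    rw [ActivatesMax, ← Set.inter_eq_left, hch (hPQ.mem_inner (by simp [hP]))]
    exact ⟨hzero, hone⟩

theorem eq_union_of_activate_gt (hαβ : ¬ α ≤ β)
    (hact : D.Activate C [C.inner₁, C.inner₂] ω ωNot α β NLabel.one b b') :
    b' = b ∪ (C.lower ∪
      (Sum.inl ∘ B) '' {w | w ∈ C.lower ∧ (w = C.hybrid ∨ D.label w = NLabel.one)}) := by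
  classical
  rw [Activate, if_neg (by simp), if_neg hαβ] at hact
  obtain ⟨f, hf, rfl⟩ := Loop.exists_union (Q := fun w T =>
      T = {w} ∪ (if D.label w = NLabel.one then D.ch w \ C.verts else ∅))
    RootedCycle.nodup_flatMap_reverse_inner
    (fun w _ b b' hbody => ⟨_, rfl, by rw [hbody, Set.union_assoc]⟩) hact
  simp only [RootedCycle.mem_flatMap_reverse_inner] at hf ⊢
  have hsides {w : D.Vert} (hw : w ∈ C.inner₁ ∨ w ∈ C.inner₂) (z : D.Vert) :
      z ∈ f w ↔ z = w ∨ D.label w = NLabel.one ∧ z = Sum.inl (B w) := by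
    obtain ⟨P, Q, p, q, hPQ, hP⟩ := RootedCycle.exists_isSides_of_mem_inner hw
    rw [hf w hw, h.ch_diff_verts hPQ hP]
    split_ifs with hlabel <;> simp only [Set.mem_union, Set.mem_singleton_iff,
      Set.mem_empty_iff_false, hlabel, true_and, false_and]
  have hroot : D.ch C.root ⊆ C.lower := fun z hz =>
    (h.mem_lower_or_eq_inl_mod C.root_mem_verts hz).resolve_right fun hr => hr.1.2 rfl
  simp only [h.ch_hybrid, Set.union_assoc]
  congr 1
  ext z
  simp only [Set.mem_union, Set.mem_singleton_iff, Set.mem_iUnion₂, Set.mem_image,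
    Set.mem_ofPred_eq, Function.comp_apply]
  constructor
  · rintro (hz | rfl | rfl | ⟨w, hw, hz⟩)
    · exact Or.inl (hroot hz)
    · exact Or.inl C.hybrid_mem_lower
    · exact Or.inr ⟨_, ⟨C.hybrid_mem_lower, Or.inl rfl⟩, rfl⟩
    · have hwl := RootedCycle.mem_lower_of_mem_inner hw
      rcases (hsides hw z).1 hz with rfl | ⟨hlabel, rfl⟩
      exacts [Or.inl hwl, Or.inr ⟨w, ⟨hwl, Or.inr hlabel⟩, rfl⟩]
  · rintro (hz | ⟨w, ⟨hw, hlabel⟩, rfl⟩)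
    · rcases C.isSides_inner.mem_lower_iff.1 hz with rfl | hz
      exacts [Or.inr (Or.inl rfl), Or.inr (Or.inr (Or.inr ⟨z, hz, (hsides hz z).2 (Or.inl rfl)⟩))]
    · rcases C.isSides_inner.mem_lower_iff.1 hw with rfl | hwi
      · exact Or.inr (Or.inr (Or.inl rfl))
      · have hne : w ≠ C.hybrid := by
          rintro rfl
          exact hwi.elim C.isSides_inner.hybrid_notMem C.isSides_inner.symm.hybrid_notMem
        exact Or.inr (Or.inr (Or.inr
          ⟨w, hwi, (hsides hwi _).2 (Or.inr ⟨hlabel.resolve_left hne, rfl⟩)⟩))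

theorem exists_union_of_activate_gt (hαβ : ¬ α ≤ β)
    (hact : D.Activate C [C.inner₁, C.inner₂] ω ωNot α β NLabel.one b b') :
    ∃ T ⊆ D.actZone M.1, b' = b ∪ T ∧ C.lower ⊆ T ∧
      ∀ w ∈ C.lower, Sum.inl (B w) ∈ T ↔ w = C.hybrid ∨ D.label w = NLabel.one := by
  refine ⟨_, Set.union_subset h.lower_subset_actZone ?_, h.eq_union_of_activate_gt hαβ hact,
    Set.subset_union_left, fun w hw => ⟨?_, fun hlabel => Or.inr ⟨w, ⟨hw, hlabel⟩, rfl⟩⟩⟩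
  · rintro _ ⟨w, ⟨hw, -⟩, rfl⟩
    exact h.inl_mod_mem_actZone hw
  · rintro (hz | ⟨u, ⟨hu, hlabel⟩, huw⟩)
    · exact absurd rfl (h.ne_inl hz _)
    · exact h.bijOn.injOn hu hw (Sum.inl.inj huw) ▸ hlabel

end IsCycleAt

end PvrNetwork

end Activation

section MaximumCliqueActivation

namespace PvrNetwork

variable {V : Type u} [Fintype V] {G : SimpleGraph V} {D : PvrNetwork.{u, v} G}
  {B : D.Vert → StrongMod G}

variable (D) in
/-- Activating the set `T` during the visit of `M` completes maximum cliques for the children of `M`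
to a maximum clique for `M`, whatever is active outside of `D.actZone M`. -/
def ActivatesMaxClique (M : StrongMod G) (T : Set D.Vert) : Prop :=
  ∀ a, D.actZone M ∩ a = T → (∀ A, A ⋖ M → IsMaxCliqueIn G A.1 (D.reach a (Sum.inl A))) →
    IsMaxCliqueIn G M.1 (D.reach a (Sum.inl M))

namespace IsCycleAt

variable {M : PrimeMod G} {C : RootedCycle D.network} {P Q p q : List D.Vert} {w z : D.Vert}
  {s : D.State} {a b b' : Set D.Vert} {α β : ℤ} (h : D.IsCycleAt M C B)
include h

theorem ch_inter_actZone_inter (hw : w ∈ C.verts) (a : Set D.Vert) :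
    D.ch w ∩ (D.actZone M.1 ∩ a) = D.ch w ∩ a := by
  rw [← Set.inter_assoc, Set.inter_eq_left.2 (h.ch_subset_actZone hw)]

variable (hs : ∀ w ∈ C.lower, IsCorrectAt C s w)
include hs

theorem omega_headD_eq (hPQ : C.IsSides P Q) (hP : P = p ++ q) :
    s.omega (q.headD C.hybrid) = (G.induce (sideSet B q ∪ (B C.hybrid).1)).cliqueNum :=
  ((h.isCorrectAt_headD_iff hPQ hP).1 (hs _ (hPQ.headD_mem_lower hP))).1

theorem omegaNot_headD_eq (hPQ : C.IsSides P Q) (hP : P = p ++ q) :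
    s.omegaNot (q.headD C.hybrid) = (G.induce (sideSet B q)).cliqueNum :=
  ((h.isCorrectAt_headD_iff hPQ hP).1 (hs _ (hPQ.headD_mem_lower hP))).2

theorem cliqueNum_eq_max_of_label_zero (hPQ : C.IsSides P Q)
    (hr : D.label C.root = NLabel.zero) :
    ((G.induce (M.1.1 : Set V)).cliqueNum : ℤ) =
      max (s.omega (P.headD C.hybrid)) (s.omega (Q.headD C.hybrid)) := by
  rw [h.cliqueNum_root_of_label_zero hPQ hr, h.omega_headD_eq hs hPQ (p := []) rfl,
    h.omega_headD_eq hs hPQ.symm (p := []) rfl, Nat.cast_max]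

theorem cliqueNum_eq_max_of_label_one (hPQ : C.IsSides P Q) (hr : D.label C.root = NLabel.one)
    (hα : α = s.omega (P.headD C.hybrid) + s.omega (Q.headD C.hybrid) - s.omega C.hybrid)
    (hβ : β = s.omegaNot (P.headD C.hybrid) + s.omegaNot (Q.headD C.hybrid)) :
    ((G.induce (M.1.1 : Set V)).cliqueNum : ℤ) = max α β := by
  rw [h.cliqueNum_root_eq_max hPQ hr, hα, hβ, h.omega_headD_eq hs hPQ (p := []) rfl,
    h.omega_headD_eq hs hPQ.symm (p := []) rfl, h.omegaNot_headD_eq hs hPQ (p := []) rfl,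
    h.omegaNot_headD_eq hs hPQ.symm (p := []) rfl, (hs _ C.hybrid_mem_lower).1,
    h.leavesBelow_hybrid]

variable (hB : ∀ A, A ⋖ M.1 → s.omega (Sum.inl A) = (G.induce (A.1 : Set V)).cliqueNum)
include hB

theorem exists_activatesMaxClique_of_label_zero (hPQ : C.IsSides P Q)
    (hr : D.label C.root = NLabel.zero)
    (hle : s.omega (Q.headD C.hybrid) ≤ s.omega (P.headD C.hybrid))
    (hact : D.Activate C [P] s.omega s.omegaNot α β NLabel.zero (b ∪ {P.headD C.hybrid}) b') :
    ∃ T ⊆ D.actZone M.1, b' = b ∪ T ∧ D.ActivatesMaxClique M.1 T := by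
  obtain ⟨T, hT, hb', hroot, hη, hside⟩ := h.exists_union_of_activate_zero hPQ hact
  refine ⟨T, hT, hb', ?_⟩
  rintro a rfl hmods
  rw [h.omega_headD_eq hs hPQ (p := []) rfl, h.omega_headD_eq hs hPQ.symm (p := []) rfl,
    Nat.cast_le] at hle
  rw [h.ch_inter_actZone_inter C.root_mem_verts] at hroot
  rw [← h.root_eq]
  refine h.isMaxCliqueIn_root_of_label_zero hPQ hr hroot ?_ hle
  refine h.isMaxCliqueIn_side_union_hybrid hPQ hmods hη.2 (fun p w q hP => ?_) (p := []) rfl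
  have hw : w ∈ C.lower := hPQ.mem_lower (by simp [hP])
  have hq := h.omega_headD_eq hs hPQ (p := p ++ [w]) (q := q) (by simp [hP])
  rw [← hq, ← hB _ (h.covBy hw)]
  exact (hside p w q hP).congr (h.ch_inter_actZone_inter hw.1 a).symm

theorem exists_activatesMaxClique_of_le (hr : D.label C.root = NLabel.one)
    (hmax : ((G.induce (M.1.1 : Set V)).cliqueNum : ℤ) ≤
      (G.induce (sideSet B C.inner₁)).cliqueNum + (G.induce (sideSet B C.inner₂)).cliqueNum)
    (hαβ : α ≤ β)
    (hact : D.Activate C [C.inner₁, C.inner₂] s.omega s.omegaNot α β NLabel.one b b') :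
    ∃ T ⊆ D.actZone M.1, b' = b ∪ T ∧ D.ActivatesMaxClique M.1 T := by
  obtain ⟨T, hT, hb', hroot, hside⟩ := h.exists_union_of_activate_le hαβ hact
  refine ⟨T, hT, hb', ?_⟩
  rintro a rfl hmods
  rw [h.ch_inter_actZone_inter C.root_mem_verts, Set.inter_eq_left] at hroot
  have hclique {P Q : List D.Vert} (hPQ : C.IsSides P Q) :
      IsMaxCliqueIn G (sideSet B P) (D.reach a (P.headD C.hybrid)) := by
    refine h.isMaxCliqueIn_side hPQ hmods (fun p w hP => ?_) (fun p w q hP hq => ?_) (p := []) rfl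
      (h.hasPendants.side_ne_nil hPQ)
    all_goals have hw : w ∈ C.lower := hPQ.mem_lower (by simp [hP])
    · rw [← (hside hPQ).1 p w hP, h.ch_inter_actZone_inter hw.1]
    · have hωq := h.omegaNot_headD_eq hs hPQ (p := p ++ [w]) (q := q) (by simp [hP])
      rw [← hωq, ← hB _ (h.covBy hw)]
      exact ((hside hPQ).2 p w q hP hq).congr (h.ch_inter_actZone_inter hw.1 a).symm
  rw [← h.root_eq]
  exact h.isMaxCliqueIn_root_of_sides C.isSides_inner hr hroot (hclique C.isSides_inner)
    (hclique C.isSides_inner.symm) (mod_cast hmax)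

omit hs hB in
theorem exists_activatesMaxClique_of_gt {ω ωNot : D.Vert → ℤ} (hr : D.label C.root = NLabel.one)
    (hmax : (G.induce (M.1.1 : Set V)).cliqueNum ≤ (G.induce (D.oneSet B C.inner₁)).cliqueNum +
      (G.induce (D.oneSet B C.inner₂)).cliqueNum + (G.induce ((B C.hybrid).1 : Set V)).cliqueNum)
    (hαβ : ¬ α ≤ β)
    (hact : D.Activate C [C.inner₁, C.inner₂] ω ωNot α β NLabel.one b b') :
    ∃ T ⊆ D.actZone M.1, b' = b ∪ T ∧ D.ActivatesMaxClique M.1 T := by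
  obtain ⟨T, hT, hb', hlower, hmodT⟩ := h.exists_union_of_activate_gt hαβ hact
  refine ⟨T, hT, hb', ?_⟩
  rintro a rfl hmods
  rw [← h.root_eq]
  refine h.isMaxCliqueIn_root_of_oneSets C.isSides_inner hmods hr
    (hlower.trans Set.inter_subset_right) ((hmodT _ C.hybrid_mem_lower).2 (Or.inl rfl)).2
    (fun w hw => ?_) hmax
  have hwη : w ≠ C.hybrid := by
    rintro rfl
    exact hw.elim C.isSides_inner.hybrid_notMem C.isSides_inner.symm.hybrid_notMem
  have hwl := RootedCycle.mem_lower_of_mem_inner hw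
  rw [← or_iff_right (b := D.label w = NLabel.one) hwη, ← hmodT w hwl, Set.mem_inter_iff,
    and_iff_right (h.inl_mod_mem_actZone hwl)]

theorem exists_activatesMaxClique_of_label_one (hPQ : C.IsSides P Q)
    (hr : D.label C.root = NLabel.one)
    (hα : α = s.omega (P.headD C.hybrid) + s.omega (Q.headD C.hybrid) - s.omega C.hybrid)
    (hβ : β = s.omegaNot (P.headD C.hybrid) + s.omegaNot (Q.headD C.hybrid))
    (hact : D.Activate C [C.inner₁, C.inner₂] s.omega s.omegaNot α β NLabel.one b b') :
    ∃ T ⊆ D.actZone M.1, b' = b ∪ T ∧ D.ActivatesMaxClique M.1 T := by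
  have hmax := h.cliqueNum_eq_max_of_label_one hs hPQ hr hα hβ
  have hβ' : β = (G.induce (sideSet B C.inner₁)).cliqueNum +
      (G.induce (sideSet B C.inner₂)).cliqueNum := by
    rw [h.omegaNot_headD_eq hs hPQ (p := []) rfl, h.omegaNot_headD_eq hs hPQ.symm (p := []) rfl]
      at hβ
    obtain ⟨rfl, rfl⟩ | ⟨rfl, rfl⟩ := hPQ
    exacts [hβ, hβ.trans (add_comm _ _)]
  by_cases hαβ : α ≤ β
  · refine h.exists_activatesMaxClique_of_le hs hB hr ?_ hαβ hact
    rw [hmax, max_eq_right hαβ, hβ']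
  · refine h.exists_activatesMaxClique_of_gt hr ?_ hαβ hact
    have hone := h.cliqueNum_root_of_label_one C.isSides_inner hr
    omega

end IsCycleAt

end PvrNetwork

end MaximumCliqueActivation

section Visits

namespace PvrNetwork

variable {V : Type u} [Fintype V] {G : SimpleGraph V} {D : PvrNetwork.{u, v} G}

variable (D) in
/-- The module during whose visit the algorithm computes the values of `ω` and `ω_¬η` at a
vertex. -/
def zone : D.Vert → StrongMod G
  | Sum.inl A => A
  | Sum.inr p => p.1.1

theorem eq_inl_of_zone_eq {M : StrongMod G} (hM : mdLabel G M ≠ MDLabel.prime) {v : D.Vert}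
    (hv : D.zone v = M) : v = Sum.inl M := by
  subst hv
  cases v with
  | inl A => rfl
  | inr p => exact absurd p.1.2 hM

namespace IsCycleAt

variable {M : PrimeMod G} {C : RootedCycle D.network} {B : D.Vert → StrongMod G} {w : D.Vert}
  (h : D.IsCycleAt M C B)
include h

theorem zone_eq_iff : D.zone w = M.1 ↔ w ∈ C.verts := by
  refine ⟨fun hw => ?_, fun hw => ?_⟩
  · rcases w with A | ⟨N, w⟩
    · obtain rfl : A = M.1 := hw
      exact h.root_eq ▸ C.root_mem_verts
    · obtain rfl : N = M := Subtype.ext hw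
      exact ((h.mem_lower_iff _).2 ⟨w, rfl⟩).1
  · by_cases hr : w = C.root
    · rw [hr, h.root_eq]
      rfl
    · obtain ⟨w, rfl⟩ := (h.mem_lower_iff w).1 ⟨hw, hr⟩
      rfl

theorem hybrid_eq {C' : RootedCycle D.network} {B' : D.Vert → StrongMod G}
    (h' : D.IsCycleAt M C' B') : C'.hybrid = C.hybrid := by
  by_contra hne
  have hPQ := C'.isSides_inner
  have hw := (h.mem_lower_iff _).2 ((h'.mem_lower_iff _).1 C'.hybrid_mem_lower)
  exact hPQ.getLast_ne
    (h.hasPendants.parents_subsingleton hw hne hPQ.adj_getLast hPQ.symm.adj_getLast)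

end IsCycleAt

theorem eq_of_mem_actZone {M M' : StrongMod G} {v : D.Vert} (h : v ∈ D.actZone M)
    (h' : v ∈ D.actZone M') : M = M' := by
  rcases h with ⟨A, hA, rfl⟩ | ⟨p, rfl, hp⟩ <;> rcases h' with ⟨A', hA', e⟩ | ⟨p', e, hp'⟩ <;>
    cases e
  exacts [StrongMod.eq_of_covBy hA hA', hp.symm.trans hp']

/-- The effect of visiting the modules in `L`, in the state `s` with outcome `s'`: only the values
computed during these visits change, they become the clique numbers that they are meant to be, and
the vertices activated during the visit of each of these modules single out a maximum clique. -/
structure IsVisit (L : Set (StrongMod G)) (s s' : D.State) : Prop where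
  eq_of_zone_notMem : ∀ v, D.zone v ∉ L → s'.omega v = s.omega v ∧ s'.omegaNot v = s.omegaNot v
  omega_eq : ∀ v, D.zone v ∈ L → s'.omega v = (G.induce (D.leavesBelow v)).cliqueNum
  omegaNot_eq : ∀ (C : RootedCycle D.network), ∀ w ∈ C.lower, D.zone w ∈ L →
    s'.omegaNot w = (G.induce (D.leavesBelow w \ D.leavesBelow C.hybrid)).cliqueNum
  actZone_inter_of_notMem : ∀ N ∉ L, D.actZone N ∩ s'.active = D.actZone N ∩ s.active
  activatesMaxClique : ∀ M ∈ L, D.ActivatesMaxClique M (D.actZone M ∩ s'.active)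

namespace IsVisit

variable {L L' : Set (StrongMod G)} {M : StrongMod G} {s s' s'' : D.State} {T : Set D.Vert}

theorem refl (s : D.State) : IsVisit ∅ s s := by
  constructor <;> simp

theorem trans (h : IsVisit L s s') (h' : IsVisit L' s' s'') (hL : Disjoint L L') :
    IsVisit (L ∪ L') s s'' where
  eq_of_zone_notMem v hv := by
    obtain ⟨hω, hωNot⟩ := h'.eq_of_zone_notMem v fun hv' => hv (Or.inr hv')
    rw [hω, hωNot]
    exact h.eq_of_zone_notMem v fun hv' => hv (Or.inl hv')
  omega_eq v hv := by
    rcases hv with hv | hv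
    · rw [(h'.eq_of_zone_notMem v (hL.notMem_of_mem_left hv)).1, h.omega_eq v hv]
    · exact h'.omega_eq v hv
  omegaNot_eq C w hw hwL := by
    rcases hwL with hwL | hwL
    · rw [(h'.eq_of_zone_notMem w (hL.notMem_of_mem_left hwL)).2, h.omegaNot_eq C w hw hwL]
    · exact h'.omegaNot_eq C w hw hwL
  actZone_inter_of_notMem N hN := by
    rw [h'.actZone_inter_of_notMem N fun hN' => hN (Or.inr hN'),
      h.actZone_inter_of_notMem N fun hN' => hN (Or.inl hN')]
  activatesMaxClique N hN := by
    rcases hN with hN | hN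
    · rw [h'.actZone_inter_of_notMem N (hL.notMem_of_mem_left hN)]
      exact h.activatesMaxClique N hN
    · exact h'.activatesMaxClique N hN

theorem of_active_eq_union (hs : D.actZone M ∩ s.active = ∅) (hT : T ⊆ D.actZone M)
    (hactive : s'.active = s.active ∪ T) (hclique : D.ActivatesMaxClique M T)
    (hframe : ∀ v, D.zone v ≠ M → s'.omega v = s.omega v ∧ s'.omegaNot v = s.omegaNot v)
    (homega : ∀ v, D.zone v = M → s'.omega v = (G.induce (D.leavesBelow v)).cliqueNum)
    (homegaNot : ∀ (C : RootedCycle D.network), ∀ w ∈ C.lower, D.zone w = M →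
      s'.omegaNot w = (G.induce (D.leavesBelow w \ D.leavesBelow C.hybrid)).cliqueNum) :
    IsVisit {M} s s' where
  eq_of_zone_notMem := hframe
  omega_eq := homega
  omegaNot_eq := homegaNot
  actZone_inter_of_notMem N hN := by
    have hNT : D.actZone N ∩ T = ∅ := Set.eq_empty_of_forall_notMem fun v hv =>
      hN (eq_of_mem_actZone hv.1 (hT hv.2))
    rw [hactive, Set.inter_union_distrib_left, hNT, Set.union_empty]
  activatesMaxClique := by
    rintro _ rfl
    rwa [hactive, Set.inter_union_distrib_left, hs, Set.empty_union, Set.inter_eq_right.2 hT]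

theorem of_mdLabel_ne_prime (hM : mdLabel G M ≠ MDLabel.prime)
    (hs : D.actZone M ∩ s.active = ∅) (hT : T ⊆ D.actZone M)
    (hclique : D.ActivatesMaxClique M T) [DecidableEq D.Vert] {n : ℤ}
    (hn : (G.induce (M.1 : Set V)).cliqueNum = n) :
    IsVisit {M} s
      { s with omega := Function.update s.omega (Sum.inl M) n, active := s.active ∪ T } := by
  refine .of_active_eq_union hs hT rfl hclique (fun v hv => ⟨?_, rfl⟩) (fun v hv => ?_)
    fun C w hw hwM => ?_
  · exact Function.update_of_ne (fun hvM => hv (congrArg D.zone hvM)) _ _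
  · rw [eq_inl_of_zone_eq hM hv, D.leavesBelow_inl, hn]
    exact Function.update_self ..
  · obtain ⟨N, B, h⟩ := exists_isCycleAt_of_rootedCycle C
    exact absurd (eq_inl_of_zone_eq hM hwM) (h.ne_inl hw M)

end IsVisit

section NonPrime

variable {M A : StrongMod G} {s s' : D.State}

theorem cliqueNum_eq_of_mdLabel_zero (hM : mdLabel G M = MDLabel.zero) (hA : A ⋖ M)
    (hmax : ∀ B, B ⋖ M →
      (G.induce (B.1 : Set V)).cliqueNum ≤ (G.induce (A.1 : Set V)).cliqueNum) :
    (G.induce (M.1 : Set V)).cliqueNum = (G.induce (A.1 : Set V)).cliqueNum := by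
  refine le_antisymm (cliqueNum_induce_le_of_forall fun K hKM hK => ?_)
    (cliqueNum_induce_mono hA.le)
  rcases K.eq_empty_or_nonempty with rfl | ⟨x, hx⟩
  · simp
  obtain ⟨B, hB, hxB⟩ := StrongMod.exists_covBy_mem (StrongMod.card_ne_one_of_covBy hA) (hKM hx)
  refine (ncard_le_cliqueNum_induce (fun y hy => ?_) hK).trans (hmax B hB)
  obtain ⟨B', hB', hyB'⟩ :=
    StrongMod.exists_covBy_mem (StrongMod.card_ne_one_of_covBy hA) (hKM hy)
  by_contra hyB
  have hBB' : B ≠ B' := fun e => hyB (e ▸ hyB')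
  exact not_adj_of_not_connected (not_connected_of_mdLabel_zero hM) hB hB' hBB' hxB hyB'
    (hK hx hy fun e => hyB (e ▸ hxB))

theorem isVisit_of_mdLabel_zero (hM : mdLabel G M = MDLabel.zero)
    (hs : ∀ A, A ⋖ M → s.omega (Sum.inl A) = (G.induce (A.1 : Set V)).cliqueNum)
    (hact : D.actZone M ∩ s.active = ∅) (hv : D.VisitVertex M s s') : IsVisit {M} s s' := by
  classical
  simp only [VisitVertex, hM] at hv
  obtain ⟨A, hA, hmax, rfl⟩ := hv
  have hnp : mdLabel G M ≠ MDLabel.prime := by simp [hM]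
  have hAM : (Sum.inl A : D.Vert) ∈ D.actZone M := Or.inl ⟨A, hA, rfl⟩
  have hnum := cliqueNum_eq_of_mdLabel_zero hM hA fun B hB => by
    exact_mod_cast hs A hA ▸ hs B hB ▸ hmax B hB
  refine .of_mdLabel_ne_prime hnp hact (Set.singleton_subset_iff.2 hAM) (fun a ha hmods => ?_)
    (by rw [hnum, hs A hA])
  have hch : D.ch (Sum.inl M) ∩ a = {Sum.inl A} := by
    have hsub : D.ch (Sum.inl M) ⊆ D.actZone M := by
      rw [D.ch_inl hnp]
      rintro _ ⟨B, hB, rfl⟩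
      exact Or.inl ⟨B, hB, rfl⟩
    rw [← Set.inter_eq_left.2 hsub, Set.inter_assoc, ha, Set.inter_eq_right, D.ch_inl hnp]
    exact Set.singleton_subset_iff.2 ⟨A, hA, rfl⟩
  rw [D.reach_eq_biUnion (by rintro _ ⟨⟩; exact StrongMod.card_ne_one_of_covBy hA), hch,
    Set.biUnion_singleton]
  exact (hmods A hA).superset hA.le hnum.le

theorem isVisit_of_mdLabel_one (hM : mdLabel G M = MDLabel.one)
    (hs : ∀ A, A ⋖ M → s.omega (Sum.inl A) = (G.induce (A.1 : Set V)).cliqueNum)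
    (hact : D.actZone M ∩ s.active = ∅) (hv : D.VisitVertex M s s') : IsVisit {M} s s' := by
  classical
  simp only [VisitVertex, hM] at hv
  subst hv
  have hnp : mdLabel G M ≠ MDLabel.prime := by simp [hM]
  have hcard : M.1.card ≠ 1 := fun hc => by simp [mdLabel_eq_leaf_iff.2 hc] at hM
  let F : Finset (StrongMod G) := {A | A ⋖ M}
  have hF {A : StrongMod G} : A ∈ F ↔ A ⋖ M := by simp [F]
  have hunion : (M.1 : Set V) = ⋃ A ∈ F, (A.1 : Set V) := by
    simp only [hF, StrongMod.coe_eq_biUnion_covBy hcard, Set.mem_ofPred_eq]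
  have hcomplete : (F : Set (StrongMod G)).Pairwise fun A B => G.IsCompleteBetween A.1 B.1 :=
    fun A hA B hB hAB a ha b hb => adj_of_not_connected_compl
      (not_connected_compl_of_mdLabel_one hM) (hF.1 hA) (hF.1 hB) hAB ha hb
  refine .of_mdLabel_ne_prime hnp hact (fun v => Or.inl) (fun a ha hmods => ?_) ?_
  · have hch : D.ch (Sum.inl M) ∩ a = Sum.inl '' {A | A ⋖ M} := by
      rw [D.ch_inl hnp, Set.inter_eq_left]
      rintro _ ⟨A, hA, rfl⟩
      exact (ha.symm.subset ⟨A, hA, rfl⟩).2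
    have hreach : D.reach a (Sum.inl M) = ⋃ A ∈ F, D.reach a (Sum.inl A) := by
      rw [D.reach_eq_biUnion (by rintro _ ⟨⟩; exact hcard), hch, Set.biUnion_image]
      simp only [hF, Set.mem_ofPred_eq]
    rw [hunion, hreach]
    exact IsMaxCliqueIn.biUnion (fun A hA => hmods A (hF.1 hA)) hcomplete
  · rw [hunion, cliqueNum_induce_biUnion_of_isCompleteBetween hcomplete, Nat.cast_sum]
    exact Finset.sum_congr (by ext; simp [hF]) fun A hA => (hs A (hF.1 hA)).symm

end NonPrime

end PvrNetwork

end Visits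

section PrimeVisits

namespace PvrNetwork

variable {V : Type u} [Fintype V] {G : SimpleGraph V} {D : PvrNetwork.{u, v} G}

namespace IsCycleAt

variable {M : PrimeMod G} {C : RootedCycle D.network} {B : D.Vert → StrongMod G}
  {P Q R : List D.Vert} {s s' : D.State} {T : Set D.Vert} {n : ℤ} {x y : D.Vert}
  (h : D.IsCycleAt M C B)
include h

theorem exists_isSides_of_ch_root_eq (hxy : D.ch C.root = {x, y}) :
    ∃ P Q, C.IsSides P Q ∧ x = P.headD C.hybrid ∧ y = Q.headD C.hybrid := by
  have hPQ := C.isSides_inner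
  rw [h.ch_root hPQ] at hxy
  rcases Set.pair_eq_pair_iff.1 hxy with ⟨hx, hy⟩ | ⟨hy, hx⟩
  exacts [⟨_, _, hPQ, hx.symm, hy.symm⟩, ⟨_, _, hPQ.symm, hx.symm, hy.symm⟩]

theorem headD_mem_side (hPQ : C.IsSides P Q) : P.headD C.hybrid ∈ P := by
  obtain ⟨w, p, rfl⟩ := List.exists_cons_of_ne_nil (h.hasPendants.side_ne_nil hPQ)
  simp

theorem eq_of_headD_mem (hPQ : C.IsSides P Q) (hR : R = C.inner₁ ∨ R = C.inner₂)
    (hmem : P.headD C.hybrid ∈ R ++ [C.hybrid]) : R = P := by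
  have hP := h.headD_mem_side hPQ
  have hRP : P.headD C.hybrid ∈ R := by
    refine (List.mem_append.1 hmem).resolve_right fun e => hPQ.hybrid_notMem ?_
    rwa [← List.mem_singleton.1 e]
  rcases hPQ with ⟨rfl, rfl⟩ | ⟨rfl, rfl⟩ <;> rcases hR with rfl | rfl
  · rfl
  · exact absurd hRP (C.isSides_inner.notMem_right hP)
  · exact absurd hRP (C.isSides_inner.symm.notMem_right hP)
  · rfl

open Classical in
theorem isCorrectAt_of_loop_update {c : D.Vert} (hc : D.ch C.hybrid = {c})
    (hB : ∀ A, A ⋖ M.1 → s.omega (Sum.inl A) = (G.induce (A.1 : Set V)).cliqueNum)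
    (hloop : Loop (D.InitInner C) (C.inner₁.reverse ++ C.inner₂.reverse)
      { s with
        omega := Function.update s.omega C.hybrid (s.omega c)
        omegaNot := Function.update s.omegaNot C.hybrid 0 } s')
    {w : D.Vert} (hw : w ∈ C.lower) : IsCorrectAt C s' w := by
  obtain rfl : Sum.inl (B C.hybrid) = c := Set.singleton_injective (h.ch_hybrid.symm.trans hc)
  refine h.isCorrectAt_of_loop hloop (fun A hA => ?_) ⟨?_, ?_⟩ hw
  · rw [← hB A hA]
    exact Function.update_of_ne (h.ne_inl C.hybrid_mem_lower A).symm _ _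
  · rw [h.leavesBelow_hybrid, ← hB _ (h.covBy C.hybrid_mem_lower)]
    exact Function.update_self ..
  · rw [Set.sdiff_self, cliqueNum_induce_empty]
    exact Function.update_self ..

omit h in
open Classical in
theorem eq_of_loop_update {m k : ℤ}
    (hloop : Loop (D.InitInner C) (C.inner₁.reverse ++ C.inner₂.reverse)
      { s with
        omega := Function.update s.omega C.hybrid m
        omegaNot := Function.update s.omegaNot C.hybrid k } s')
    {v : D.Vert} (hv : v ∉ C.lower) :
    s'.omega v = s.omega v ∧ s'.omegaNot v = s.omegaNot v := by
  have hvη : v ≠ C.hybrid := (ne_of_mem_of_not_mem C.hybrid_mem_lower hv).symm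
  have := eq_of_loop_initInner hloop (v := v) fun hmem =>
    hv (RootedCycle.mem_lower_of_mem_inner (by simpa using hmem))
  simpa only [Function.update_of_ne hvη] using this

open Classical in
theorem isVisit_update_root (hs : ∀ w ∈ C.lower, IsCorrectAt C s' w)
    (hframe : ∀ v ∉ C.lower, s'.omega v = s.omega v ∧ s'.omegaNot v = s.omegaNot v)
    (hact : D.actZone M.1 ∩ s.active = ∅) (hT : T ⊆ D.actZone M.1)
    (hclique : D.ActivatesMaxClique M.1 T)
    (hn : (G.induce (M.1.1 : Set V)).cliqueNum = n) :
    IsVisit {M.1} s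
      { s' with omega := Function.update s'.omega C.root n, active := s.active ∪ T } := by
  refine .of_active_eq_union hact hT rfl hclique (fun v hv => ?_) (fun v hv => ?_)
    fun C' w hw hwM => ?_
  · rw [ne_eq, h.zone_eq_iff] at hv
    have hvr : v ≠ C.root := fun e => hv (e ▸ C.root_mem_verts)
    simpa only [Function.update_of_ne hvr] using hframe v fun hv' => hv hv'.1
  · rw [h.zone_eq_iff] at hv
    by_cases hvr : v = C.root
    · rw [hvr, h.root_eq, D.leavesBelow_inl, hn]
      exact Function.update_self ..
    · rw [← (hs v ⟨hv, hvr⟩).1]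
      exact Function.update_of_ne hvr _ _
  · obtain ⟨M', B', h'⟩ := exists_isCycleAt_of_rootedCycle C'
    obtain rfl : M = M' := Subtype.ext (hwM.symm.trans (h'.zone_eq_iff.2 hw.1))
    rw [h.hybrid_eq h']
    exact (hs w ⟨h.zone_eq_iff.1 hwM, h.root_eq ▸ h'.ne_inl hw M.1⟩).2

end IsCycleAt

theorem isVisit_of_visitPrime (M : PrimeMod G) {s s' : D.State}
    (hs : ∀ A, A ⋖ M.1 → s.omega (Sum.inl A) = (G.induce (A.1 : Set V)).cliqueNum)
    (hact : D.actZone M.1 ∩ s.active = ∅) (hv : D.VisitPrime M.1 s s') :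
    IsVisit {M.1} s s' := by
  classical
  obtain ⟨C, hCr, c, _, s₂, hc, rfl, hloop, x, y, -, hxy, hv⟩ := hv
  obtain ⟨M', B, h⟩ := exists_isCycleAt_of_rootedCycle C
  obtain rfl : M' = M := Subtype.ext (Sum.inl.inj (h.root_eq.symm.trans hCr))
  have hcorrect := fun w => h.isCorrectAt_of_loop_update (w := w) hc hs hloop
  have hframe := fun v => IsCycleAt.eq_of_loop_update (v := v) hloop
  have hmods A (hA : A ⋖ M'.1) : s₂.omega (Sum.inl A) = (G.induce (A.1 : Set V)).cliqueNum :=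
    (hframe _ fun hA' => h.ne_inl hA' A rfl).1.trans (hs A hA)
  rw [active_eq_of_loop_initInner hloop] at hv
  obtain ⟨P, Q, hPQ, rfl, rfl⟩ := h.exists_isSides_of_ch_root_eq hxy
  split_ifs at hv with hr
  · obtain ⟨w, R, a, hw, hmax, hR, hwR, hactivate, rfl⟩ := hv
    have hnum := h.cliqueNum_eq_max_of_label_zero hcorrect hPQ hr
    obtain ⟨P', Q', hPQ', rfl, hle⟩ : ∃ P' Q', C.IsSides P' Q' ∧ w = P'.headD C.hybrid ∧
        s₂.omega (Q'.headD C.hybrid) ≤ s₂.omega w := by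
      rw [hmax]
      rcases hw with rfl | rfl
      exacts [⟨P, Q, hPQ, rfl, le_max_right ..⟩, ⟨Q, P, hPQ.symm, rfl, le_max_left ..⟩]
    obtain rfl := h.eq_of_headD_mem hPQ' hR hwR
    obtain ⟨T, hT, rfl, hclique⟩ :=
      h.exists_activatesMaxClique_of_label_zero hcorrect hmods hPQ' hr hle hactivate
    exact h.isVisit_update_root hcorrect hframe hact hT hclique hnum
  · obtain ⟨α, β, a, hα, hβ, hactivate, rfl⟩ := hv
    have hr' := (h.label_eq_zero_or_one C.root_mem_verts).resolve_left hr
    obtain ⟨T, hT, rfl, hclique⟩ :=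
      h.exists_activatesMaxClique_of_label_one hcorrect hmods hPQ hr' hα hβ hactivate
    exact h.isVisit_update_root hcorrect hframe hact hT hclique
      (h.cliqueNum_eq_max_of_label_one hcorrect hPQ hr' hα hβ)

end PvrNetwork

end PrimeVisits

section Correctness

namespace PvrNetwork

variable {V : Type u} [Fintype V] {G : SimpleGraph V} {D : PvrNetwork.{u, v} G}
  {A M : StrongMod G} {s s' : D.State} {l : List (StrongMod G)}

theorem isVisit_of_visitVertex
    (hs : ∀ A, A ⋖ M → s.omega (Sum.inl A) = (G.induce (A.1 : Set V)).cliqueNum)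
    (hact : D.actZone M ∩ s.active = ∅) (hv : D.VisitVertex M s s') : IsVisit {M} s s' := by
  cases hM : mdLabel G M with
  | leaf => simp [VisitVertex, hM] at hv
  | zero => exact isVisit_of_mdLabel_zero hM hs hact hv
  | one => exact isVisit_of_mdLabel_one hM hs hact hv
  | prime =>
    simp only [VisitVertex, hM] at hv
    exact isVisit_of_visitPrime ⟨M, hM⟩ hs hact hv

theorem isVisit_of_loop (hl : l.Nodup) (hord : l.Pairwise fun A B => ¬ B < A)
    (hs : ∀ M ∈ l, ∀ A, A ⋖ M → A ∉ l →
      s.omega (Sum.inl A) = (G.induce (A.1 : Set V)).cliqueNum)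
    (hact : ∀ M ∈ l, D.actZone M ∩ s.active = ∅) (hloop : Loop D.VisitVertex l s s') :
    IsVisit {M | M ∈ l} s s' := by
  induction hloop with
  | nil s => simpa using IsVisit.refl s
  | @cons M l s s₁ s' hM _ ih =>
    obtain ⟨hMl, hl⟩ := List.nodup_cons.1 hl
    obtain ⟨hMlt, hord⟩ := List.pairwise_cons.1 hord
    have hvisit : IsVisit {M} s s₁ := by
      refine isVisit_of_visitVertex (fun A hA => hs M List.mem_cons_self A hA fun hAl => ?_)
        (hact M List.mem_cons_self) hM
      rcases List.mem_cons.1 hAl with rfl | hAl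
      exacts [hA.lt.false, hMlt A hAl hA.lt]
    have hrest : IsVisit {N | N ∈ l} s₁ s' := by
      refine ih hl hord (fun N hN A hA hAl => ?_) fun N hN => ?_
      · by_cases hAM : A = M
        · rw [hvisit.omega_eq (Sum.inl A) hAM, D.leavesBelow_inl]
        · rw [(hvisit.eq_of_zone_notMem (Sum.inl A) hAM).1]
          exact hs N (List.mem_cons_of_mem _ hN) A hA (by simp [hAM, hAl])
      · rw [hvisit.actZone_inter_of_notMem N (ne_of_mem_of_not_mem hN hMl)]
        exact hact N (List.mem_cons_of_mem _ hN)
    convert hvisit.trans hrest (Set.disjoint_singleton_left.2 hMl) using 1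
    ext N
    simp

theorem omega_inl_eq_of_card_eq_one (hs : ∀ x, s.omega (D.leafVert x) = 1) (hA : A.1.card = 1) :
    s.omega (Sum.inl A) = (G.induce (A.1 : Set V)).cliqueNum := by
  obtain ⟨x, hx⟩ := Finset.card_eq_one.1 hA
  have hAx : Sum.inl A = D.leafVert x := congrArg Sum.inl (Subtype.ext hx)
  rw [hAx, hs, hx, Finset.coe_singleton, cliqueNum_induce_singleton, Nat.cast_one]

theorem IsResult.exists_isVisit (hs : D.IsResult s) :
    ∃ s₀ : D.State, (∀ x, s₀.omega (D.leafVert x) = 1) ∧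
      IsVisit {M | mdLabel G M ≠ MDLabel.leaf} s₀ s := by
  obtain ⟨l, s₀, hl, hmem, hord, hleaf, hact, hloop⟩ := hs
  refine ⟨s₀, hleaf, ?_⟩
  have hvisit := isVisit_of_loop hl hord (fun M _ A _ hA => ?_) (by simp [hact]) hloop
  · simpa only [hmem] using hvisit
  · rw [hmem, not_not, mdLabel_eq_leaf_iff] at hA
    exact omega_inl_eq_of_card_eq_one hleaf hA

theorem omega_of_isResult (hs : D.IsResult s) (v : D.Vert) :
    s.omega v = (G.induce (D.leavesBelow v)).cliqueNum := by
  obtain ⟨s₀, hleaf, hvisit⟩ := hs.exists_isVisit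
  by_cases hv : mdLabel G (D.zone v) = MDLabel.leaf
  · have hprime : mdLabel G (D.zone v) ≠ MDLabel.prime := by simp [hv]
    rw [(hvisit.eq_of_zone_notMem v (not_not.2 hv)).1, eq_inl_of_zone_eq hprime rfl,
      D.leavesBelow_inl]
    exact omega_inl_eq_of_card_eq_one hleaf (mdLabel_eq_leaf_iff.1 hv)
  · exact hvisit.omega_eq v hv

theorem omegaNot_of_isResult (hs : D.IsResult s) (C : RootedCycle D.network) {w : D.Vert}
    (hw : w ∈ C.lower) :
    s.omegaNot w = (G.induce (D.leavesBelow w \ D.leavesBelow C.hybrid)).cliqueNum := by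
  obtain ⟨s₀, -, hvisit⟩ := hs.exists_isVisit
  obtain ⟨M, B, h⟩ := exists_isCycleAt_of_rootedCycle C
  refine hvisit.omegaNot_eq C w hw ?_
  rw [Set.mem_ofPred_eq, h.zone_eq_iff.2 hw.1, M.2]
  exact MDLabel.noConfusion

theorem isMaxCliqueIn_of_isResult (hs : D.IsResult s) (A : StrongMod G) :
    IsMaxCliqueIn G A.1 (D.reach s.active (Sum.inl A)) := by
  obtain ⟨s₀, -, hvisit⟩ := hs.exists_isVisit
  induction A using WellFoundedLT.induction with
  | ind A ih =>
    by_cases hA : mdLabel G A = MDLabel.leaf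
    · have hcard := mdLabel_eq_leaf_iff.1 hA
      obtain ⟨x, hx⟩ := Finset.card_eq_one.1 hcard
      rw [D.reach_inl_of_card_eq_one hcard, hx, Finset.coe_singleton]
      exact isMaxCliqueIn_singleton x
    · exact hvisit.activatesMaxClique A hA _ rfl fun B hB => ih B hB.lt

theorem isMaximumClique_of_isResult [Nonempty V] (hs : D.IsResult s) :
    G.IsMaximumClique (D.Omega s) := by
  have h := isMaxCliqueIn_of_isResult hs ⟨Finset.univ, isStrongModule_univ G⟩
  have hcoe : (D.Omega s : Set V) =
      D.reach s.active (Sum.inl ⟨Finset.univ, isStrongModule_univ G⟩) := by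
    simp only [Omega, Finset.coe_filter_univ]
    rfl
  rw [← hcoe] at h
  refine ⟨h.isClique, fun t ht => ?_⟩
  rw [← Set.ncard_coe_finset (D.Omega s), h.ncard_eq, ← Set.ncard_coe_finset t]
  exact ncard_le_cliqueNum_induce (by simp) ht

end PvrNetwork

end Correctness

section Existence

namespace PvrNetwork

variable {V : Type u} [Fintype V] {G : SimpleGraph V} {D : PvrNetwork.{u, v} G}

namespace IsCycleAt

variable {M : PrimeMod G} {C : RootedCycle D.network} {B : D.Vert → StrongMod G}
  {P Q : List D.Vert} {w : D.Vert} (h : D.IsCycleAt M C B)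
include h

theorem exists_max_ch (hw : w ∈ C.lower) (ω : D.Vert → ℤ) :
    ∃ x ∈ D.ch w, ∀ z ∈ D.ch w, ω z ≤ ω x := by
  have hch : (D.ch w).Finite ∧ (D.ch w).Nonempty := by
    obtain ⟨P, Q, p, q, hPQ, hP, rfl⟩ := RootedCycle.exists_eq_headD_of_mem_lower hw
    cases q with
    | nil => simp [h.ch_hybrid]
    | cons w q => simp [h.ch_side hPQ hP]
  exact Set.exists_max_image _ ω hch.1 hch.2

theorem exists_activate_zero (hPQ : C.IsSides P Q) (ω ωNot : D.Vert → ℤ) (α β : ℤ)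
    (b : Set D.Vert) : ∃ b', D.Activate C [P] ω ωNot α β NLabel.zero b b' := by
  rw [show (∃ b', _) ↔ _ from exists_congr fun b' => by rw [Activate, if_pos rfl]]
  refine Loop.exists_of_forall (fun w hw a => ?_) b
  split_ifs with hl
  · obtain ⟨x, hx, hmax⟩ :=
      h.exists_max_ch (hPQ.mem_lower_of_mem_append_hybrid (by simpa [or_comm] using hw)) ω
    exact ⟨_, x, hx, hmax, rfl⟩
  · exact ⟨_, rfl⟩

theorem exists_parents_hybrid_eq :
    ∃ w₁ w₂, w₁ ≠ w₂ ∧ parents D.network C.hybrid = {w₁, w₂} := by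
  have hPQ := C.isSides_inner
  have hlast {L : List D.Vert} (hL : L ≠ []) (z : D.Vert) :
      (∃ p, L = p ++ [z]) ↔ z = L.getLast hL := by
    constructor
    · rintro ⟨p, rfl⟩
      simp
    · rintro rfl
      exact ⟨_, (List.dropLast_append_getLast hL).symm⟩
  have hne₁ := h.hasPendants.side_ne_nil hPQ
  have hne₂ := h.hasPendants.side_ne_nil hPQ.symm
  refine ⟨_, _, ne_of_mem_of_not_mem (List.getLast_mem hne₁) fun hmem =>
    hPQ.notMem_right hmem (List.getLast_mem hne₂), Set.ext fun z => ?_⟩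
  exact (h.hasPendants.adj_hybrid_iff hPQ).trans (or_congr (hlast hne₁ z) (hlast hne₂ z))

theorem exists_activate_one (ω ωNot : D.Vert → ℤ) (α β : ℤ) (b : Set D.Vert) :
    ∃ b', D.Activate C [C.inner₁, C.inner₂] ω ωNot α β NLabel.one b b' := by
  simp only [Activate, reduceCtorEq, if_false]
  split_ifs with hαβ
  · obtain ⟨w₁, w₂, hne, hpar⟩ := h.exists_parents_hybrid_eq
    suffices ∃ b', Loop _ _ _ b' from this.imp fun b' hb' => ⟨w₁, w₂, hne, hpar, hb'⟩
    refine Loop.exists_of_forall (fun w hw a => ?_) _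
    obtain ⟨P, Q, p, q, hPQ, hP⟩ := RootedCycle.exists_isSides_of_mem_inner
      (RootedCycle.mem_flatMap_reverse_inner.1 (List.mem_of_mem_filter hw))
    have hx := h.ch_inter_verts hPQ hP
    have hy := h.ch_diff_verts hPQ hP
    by_cases hl : D.label w = NLabel.zero
    · rcases le_total (ω (Sum.inl (B w))) (ωNot (q.headD C.hybrid)) with hle | hle
      · exact ⟨_, _, _, hx, hy, by rw [if_pos hl]; exact Or.inl ⟨hle, rfl⟩⟩
      · exact ⟨_, _, _, hx, hy, by rw [if_pos hl]; exact Or.inr ⟨hle, rfl⟩⟩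
    · exact ⟨_, _, _, hx, hy, by rw [if_neg hl]⟩
  · refine Loop.exists_of_forall (fun w _ a => ?_) _
    exact ⟨_, rfl⟩

end IsCycleAt

open Classical in
theorem exists_visitPrime (M : PrimeMod G) (s : D.State) : ∃ s', D.VisitPrime M.1 s s' := by
  obtain ⟨C, B, h⟩ := exists_isCycleAt M
  have hinit (w : D.Vert) (hw : w ∈ C.inner₁.reverse ++ C.inner₂.reverse) (s : D.State) :
      ∃ s', D.InitInner C w s s' := by
    obtain ⟨P, Q, p, q, hPQ, hP⟩ := RootedCycle.exists_isSides_of_mem_inner (C := C) (w := w)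
      (by simpa using hw)
    exact h.exists_initInner hPQ (by simp [hP]) s
  obtain ⟨s₂, hs₂⟩ := Loop.exists_of_forall hinit
    { s with
      omega := Function.update s.omega C.hybrid (s.omega (Sum.inl (B C.hybrid)))
      omegaNot := Function.update s.omegaNot C.hybrid 0 }
  have hne {P Q} (hPQ : C.IsSides P Q) : P.headD C.hybrid ≠ Q.headD C.hybrid := fun e =>
    hPQ.notMem_right (h.headD_mem_side hPQ) (e ▸ h.headD_mem_side hPQ.symm)
  by_cases hr : D.label C.root = NLabel.zero
  · obtain ⟨P, Q, hPQ, hle⟩ : ∃ P Q, C.IsSides P Q ∧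
        s₂.omega (Q.headD C.hybrid) ≤ s₂.omega (P.headD C.hybrid) := by
      rcases le_total (s₂.omega (C.inner₂.headD C.hybrid))
        (s₂.omega (C.inner₁.headD C.hybrid)) with hle | hle
      exacts [⟨_, _, C.isSides_inner, hle⟩, ⟨_, _, C.isSides_inner.symm, hle⟩]
    obtain ⟨a, ha⟩ := h.exists_activate_zero hPQ s₂.omega s₂.omegaNot 0 0
      (s₂.active ∪ {P.headD C.hybrid})
    exact ⟨_, C, h.root_eq, _, _, s₂, h.ch_hybrid, rfl, hs₂, _, _, hne hPQ, h.ch_root hPQ,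
      (if_pos hr).mpr
        ⟨_, P, a, Or.inl rfl, (max_eq_left hle).symm, hPQ.imp And.left And.left,
          List.mem_append_left _ (h.headD_mem_side hPQ), ha, rfl⟩⟩
  · have hPQ := C.isSides_inner
    obtain ⟨a, ha⟩ := h.exists_activate_one s₂.omega s₂.omegaNot _ _ s₂.active
    exact ⟨_, C, h.root_eq, _, _, s₂, h.ch_hybrid, rfl, hs₂, _, _, hne hPQ, h.ch_root hPQ,
      (if_neg hr).mpr ⟨_, _, a, rfl, rfl, ha, rfl⟩⟩

theorem exists_visitVertex {M : StrongMod G} (hM : mdLabel G M ≠ MDLabel.leaf) (s : D.State) :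
    ∃ s', D.VisitVertex M s s' := by
  cases hl : mdLabel G M with
  | leaf => exact absurd hl hM
  | one =>
    simp only [VisitVertex, hl]
    exact ⟨_, rfl⟩
  | prime =>
    simp only [VisitVertex, hl]
    exact exists_visitPrime ⟨M, hl⟩ s
  | zero =>
    simp only [VisitVertex, hl]
    obtain ⟨x, hx⟩ := M.nonempty
    obtain ⟨A, hA, -⟩ := StrongMod.exists_covBy_mem (fun e => hM (mdLabel_eq_leaf_iff.2 e)) hx
    obtain ⟨A, hA, hmax⟩ := Set.exists_max_image {A : StrongMod G | A ⋖ M}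
      (fun A => s.omega (Sum.inl A)) (Set.toFinite _) ⟨A, hA⟩
    exact ⟨_, A, hA, hmax, rfl⟩

theorem exists_isResult (D : PvrNetwork.{u, v} G) : ∃ s : D.State, D.IsResult s := by
  classical
  obtain ⟨r, hr, hle⟩ := extend_partialOrder fun A B : StrongMod G => A ≤ B
  let l := ({M | mdLabel G M ≠ MDLabel.leaf} : Finset (StrongMod G)).sort r
  have hmem (M : StrongMod G) : M ∈ l ↔ mdLabel G M ≠ MDLabel.leaf := by simp [l]
  have hord : l.Pairwise fun A B => ¬ B < A := (Finset.pairwise_sort _ r).imp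
    fun hAB hBA => hBA.ne' (antisymm_of r hAB (hle _ _ hBA.le))
  obtain ⟨s, hs⟩ := Loop.exists_of_forall (body := D.VisitVertex) (l := l)
    (fun M hM => exists_visitVertex ((hmem M).1 hM)) ⟨fun _ => 1, fun _ => 0, ∅⟩
  exact ⟨s, l, _, Finset.sort_nodup .., hmem, hord, fun _ => rfl, rfl, hs⟩

end PvrNetwork

end Existence

end Gatex

theorem mainTheorem8 {V : Type u} [Fintype V] [Nonempty V] (G : SimpleGraph V)
    (hG : Gatex.IsGaTEx G) (D : Gatex.PvrNetwork.{u, v} G) :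
    (∃ s : D.State, D.IsResult s) ∧
    ∀ s : D.State, D.IsResult s →
      s.omega D.root = (G.cliqueNum : ℤ) ∧
      (∀ w : D.Vert, s.omega w = ((G.induce (D.leavesBelow w)).cliqueNum : ℤ)) ∧
      (∀ (C : Gatex.RootedCycle D.network), ∀ w ∈ C.verts, w ≠ C.root →
        s.omegaNot w =
          ((G.induce (D.leavesBelow w \ D.leavesBelow C.hybrid)).cliqueNum : ℤ)) ∧
      G.IsMaximumClique (D.Omega s) := by
  refine ⟨D.exists_isResult, fun s hs => ⟨?_, Gatex.PvrNetwork.omega_of_isResult hs,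
    fun C w hw hwr => Gatex.PvrNetwork.omegaNot_of_isResult hs C ⟨hw, hwr⟩,
    Gatex.PvrNetwork.isMaximumClique_of_isResult hs⟩⟩
  rw [Gatex.PvrNetwork.omega_of_isResult hs, Gatex.PvrNetwork.root, D.leavesBelow_inl,
    Finset.coe_univ, Gatex.cliqueNum_induce_univ]
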